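/- Let $A$ be a complex C*-algebra. For Hilbert $A$-modules $E,F$, let $\mathcal L(E,F)$ be the adjointable operators and $\mathcal K(E,F)\subset\mathcal L(E,F)$ the compact ones, i.e. the operator-norm closure of the linear span of the maps $z\mapsto x\langle y,z\rangle$. An $A$-linear operator $t\colon \operatorname{dom}t\subset E\to F$ is *regular* if it is closed and densely defined, its adjoint $t^*$ is densely defined, and $1+t^*t$ has dense range. A regular operator $t$ is *$A$-Fredholm* if there are $P_l,P_r\in\mathcal L(F,E)$, $C_l\in\mathcal K(E,E)$ and $C_r\in\mathcal K(F,F)$ with $\operatorname{ran}P_r\subset\operatorname{dom}t$, $P_lt=1-C_l$ on $\operatorname{dom}t$ and $tP_r=1-C_r$. A *finite-length complex* consists of Hilbert $A$-modules $E_0,\dots,E_{N+1}$ and regular operators $t_k\colon\operatorname{dom}t_k\subset E_k\to E_{k+1}$ ($0\le k\le N$) with $\operatorname{ran}t_k\subset\ker t_{k+1}$ for $0\le k<N$; objects with an index outside these ranges are zero. It is *$A$-Fredholm* if it has a joint parametrix modulo compacts: there are $P_{l,k},P_{r,k}\in\mathcal L(E_{k+1},E_k)$ ($0\le k\le N$)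 and $C_k\in\mathcal K(E_k,E_k)$ ($0\le k\le N+1$) such that, for all $0\le k\le N+1$, $$P_{r,k-1}(\operatorname{dom}t_k)\subset\operatorname{dom}t_{k-1}\quad\text{and}\quad P_{l,k}t_k+t_{k-1}P_{r,k-1}=1-C_k\ \text{ on }\operatorname{dom}t_k .$$ For a chain complex (arrows reversed) the definition is the same with the outgoing and the incoming differential in place of $t_k$ and $t_{k-1}$. **Theorem.** Let $(E_\bullet,t_\bullet)$ be a finite-length complex as above. If one of the following objects is $A$-Fredholm, then all of them are. 1. The complex $(E_\bullet,t_\bullet)$. 2. Its even Dirac operator $D^+\colon\operatorname{dom}D^+\subset\bigoplus_kE_{2k}\to\bigoplus_kE_{2k+1}$, $D^+(x_{2k})_k=(t_{2k}x_{2k}+t_{2k+1}^*x_{2k+2})_k$, with $\operatorname{dom}D^+=\bigoplus_k(\operatorname{dom}t_{2k}\cap\operatorname{dom}t_{2k-1}^*)$. 3. Its Laplace operator $\Delta=\bigoplus_{k=0}^{N+1}\Delta_k$ on $\bigoplus_{k=0}^{N+1}E_k$, where $\Delta_k=t_k^*t_k+t_{k-1}t_{k-1}^*$ with $\operatorname{dom}\Delta_k=\operatorname{dom}(t_k^*t_k)\cap\operatorname{dom}(t_{k-1}t_{k-1}^*)$.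 4. Its bounded transform complex, with modules $E_k$ and differentials $F_{t_k}=t_k(1+t_k^*t_k)^{-1/2}\in\mathcal L(E_k,E_{k+1})$. 5. Its adjoint complex, i.e. the chain complex with modules $E_k$ and differentials $t_k^*\colon\operatorname{dom}t_k^*\subset E_{k+1}\to E_k$. 6. Its graph-norm complex, with modules $\operatorname{dom}t_k$ under the inner product $\langle x,y\rangle+\langle t_kx,t_ky\rangle$ and differentials $t_k\colon\operatorname{dom}t_k\to\operatorname{dom}t_{k+1}$. -/

import Mathlib

open scoped InnerProductSpace WithCStarModule

universe u v w

namespace HilbertCStar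

/-!
Hilbert `A`-modules are Mathlib's `CStarModule A E` on a complete normed space `E`. Mathlib writes
the action of `A` on the left, with inner product linear in the second variable,
`⟪x, a • y⟫ = a * ⟪x, y⟫`; over `Aᵐᵒᵖ` this is precisely a right Hilbert `A`-module,
`⟪x, y a⟫ = ⟪x, y⟫ a`.
-/

section Modules

variable {A : Type u} [NonUnitalCStarAlgebra A] [PartialOrder A]
variable {E : Type v} [NormedAddCommGroup E] [NormedSpace ℂ E] [SMul A E] [CStarModule A E]

variable (A) in
theorem ext_inner {x y : E} (h : ∀ z : E, ⟪z, x⟫_A = ⟪z, y⟫_A) : x = y := by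
  rw [← sub_eq_zero, ← CStarModule.inner_self (A := A), CStarModule.inner_sub_right, h, sub_self]

theorem op_smul_add (a : A) (x y : E) : a • (x + y) = a • x + a • y :=
  ext_inner A fun z => by simp [mul_add]

theorem op_smul_zero (a : A) : a • (0 : E) = 0 :=
  ext_inner A fun z => by simp

theorem op_smul_complex_smul (a : A) (c : ℂ) (x : E) : a • (c • x) = c • (a • x) :=
  ext_inner A fun z => by simp [mul_smul_comm]

end Modules

section Operators

variable (A : Type u) [NonUnitalCStarAlgebra A] [PartialOrder A]
variable (E : Type v) [NormedAddCommGroup E] [NormedSpace ℂ E] [SMul A E] [CStarModule A E]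
variable (F : Type w) [NormedAddCommGroup F] [NormedSpace ℂ F] [SMul A F] [CStarModule A F]

/-- The adjointable operators from `E` to `F`. -/
structure Adj extends E →L[ℂ] F where
  exists_adjoint : ∃ S : F →L[ℂ] E, ∀ x y, ⟪toContinuousLinearMap x, y⟫_A = ⟪x, S y⟫_A

/-- The (possibly unbounded) `A`-linear operators from a submodule of `E` to `F`. -/
structure UOp extends E →ₗ.[ℂ] F where
  smul_mem : ∀ (a : A) {x : E}, x ∈ domain → a • x ∈ domain
  map_op_smul : ∀ (a : A) (x : domain),
    toLinearPMap ⟨a • (x : E), smul_mem a x.2⟩ = a • toLinearPMap x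

end Operators

section Basic

variable {A : Type u} [NonUnitalCStarAlgebra A] [PartialOrder A]
variable {E : Type v} [NormedAddCommGroup E] [NormedSpace ℂ E] [SMul A E] [CStarModule A E]
variable {F : Type w} [NormedAddCommGroup F] [NormedSpace ℂ F] [SMul A F] [CStarModule A F]
variable {G : Type*} [NormedAddCommGroup G] [NormedSpace ℂ G] [SMul A G] [CStarModule A G]

instance : CoeFun (Adj A E F) fun _ => E → F := ⟨fun T => T.toContinuousLinearMap⟩

instance : CoeFun (UOp A E F) fun t => t.domain → F := ⟨fun t => t.toLinearPMap⟩

theorem Adj.map_op_smul (T : Adj A E F) (a : A) (x : E) :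
    T (a • x) = a • T x := by
  obtain ⟨S, hS⟩ := T.exists_adjoint
  refine ext_inner A fun z => star_injective ?_
  rw [CStarModule.star_inner, hS, CStarModule.inner_op_smul_left, ← hS,
    CStarModule.inner_op_smul_right, star_mul, CStarModule.star_inner]

/-- The zero operator. -/
instance : Zero (Adj A E F) := ⟨⟨0, 0, fun x y => by simp⟩⟩

/-- An operator is compact if it lies in the operator-norm closure of the linear span of the
rank-one operators `z ↦ x ⟨y, z⟩`. -/
def Adj.IsCompact (T : Adj A E F) : Prop :=
  T.toContinuousLinearMap ∈
    closure (Submodule.span ℂ {θ : E →L[ℂ] F | ∃ (x : F) (y : E), ∀ z, θ z = ⟪y, z⟫_A • x} :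
      Set (E →L[ℂ] F))

/-- An adjointable operator, regarded as an operator with domain the whole module. -/
def Adj.toUOp (T : Adj A E F) : UOp A E F where
  domain := ⊤
  toFun := T.toContinuousLinearMap.toLinearMap.comp (⊤ : Submodule ℂ E).subtype
  smul_mem _ _ _ := trivial
  map_op_smul a x := T.map_op_smul a x

namespace UOp

/-- All pairs `(y, z)` with `⟨t x, y⟩ = ⟨x, z⟩` for every `x` in the domain of `t`. -/
def adjointGraph (t : UOp A E F) : Submodule ℂ (F × E) where
  carrier := {p | ∀ x : t.domain, ⟪t x, p.1⟫_A = ⟪(x : E), p.2⟫_A}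
  add_mem' {p q} hp hq x := by simp [hp x, hq x]
  zero_mem' x := by simp
  smul_mem' c p hp x := by simp [hp x]

/-- The adjoint `t*`: its domain consists of the `y` for which there is a `z` such that
`⟨t x, y⟩ = ⟨x, z⟩` for all `x` in the domain of `t`, and `t* y = z`. (If `t` is densely defined
then `z` is unique; otherwise the value is set to `0`.) -/
noncomputable def adjoint (t : UOp A E F) : UOp A F E where
  toLinearPMap := t.adjointGraph.toLinearPMap
  smul_mem a x hx := by
    obtain ⟨p, hp, rfl⟩ := hx
    exact ⟨(a • p.1, a • p.2), fun x => by simp [hp x], rfl⟩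
  map_op_smul a x := by
    by_cases hg : ∀ p ∈ t.adjointGraph, p.1 = 0 → p.2 = 0
    · have hx := Submodule.mem_graph_toLinearPMap hg x
      have hax := Submodule.mem_graph_toLinearPMap hg ⟨a • (x : F), by
        obtain ⟨p, hp, hpx⟩ := x.2
        exact ⟨(a • p.1, a • p.2), fun x => by simp [hp x], by rw [← hpx]; rfl⟩⟩
      refine sub_eq_zero.mp (hg (0, _) (fun z => ?_) rfl)
      have h1 := hx z
      have h2 := hax z
      simp only [CStarModule.inner_op_smul_right, CStarModule.inner_sub_right,
        CStarModule.inner_zero_right] at h1 h2 ⊢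
      exact (sub_eq_zero.mpr (h2.symm.trans (congrArg (a * ·) h1))).symm
    · have h0 : ∀ z, t.adjointGraph.toLinearPMap z = 0 := fun z => by
        have : t.adjointGraph.toLinearPMap.toFun = 0 := dif_neg hg
        exact congrArg (fun f => f z) this
      rw [h0, h0, op_smul_zero]

/-- The composition `s t`, on the domain of all `x ∈ dom t` with `t x ∈ dom s`. -/
def comp (s : UOp A F G) (t : UOp A E F) : UOp A E G where
  domain :=
    { carrier := {x | ∃ h : x ∈ t.domain, t ⟨x, h⟩ ∈ s.domain}
      add_mem' := by
        rintro x y ⟨hx, hx'⟩ ⟨hy, hy'⟩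
        refine ⟨add_mem hx hy, ?_⟩
        have := t.map_add ⟨x, hx⟩ ⟨y, hy⟩
        exact this ▸ add_mem hx' hy'
      zero_mem' := ⟨zero_mem _, by
        have := t.map_zero
        exact this ▸ zero_mem _⟩
      smul_mem' := by
        rintro c x ⟨hx, hx'⟩
        refine ⟨Submodule.smul_mem _ c hx, ?_⟩
        have := t.map_smul c ⟨x, hx⟩
        exact this ▸ Submodule.smul_mem _ c hx' }
  toFun :=
    { toFun := fun x => s ⟨t ⟨x, x.2.1⟩, x.2.2⟩
      map_add' := fun x y => by
        rw [← s.map_add]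
        congr 2
        exact t.map_add ⟨x, x.2.1⟩ ⟨y, y.2.1⟩
      map_smul' := fun c x => by
        rw [RingHom.id_apply, ← s.map_smul]
        congr 2
        exact t.map_smul c ⟨x, x.2.1⟩ }
  smul_mem a x hx := ⟨t.smul_mem a hx.1, by
    have := t.map_op_smul a ⟨x, hx.1⟩
    exact this ▸ s.smul_mem a hx.2⟩
  map_op_smul a x := by
    have h := s.map_op_smul a ⟨t ⟨x, x.2.1⟩, x.2.2⟩
    refine Eq.trans ?_ h
    change s ⟨_, _⟩ = s ⟨_, _⟩
    congr 2
    exact t.map_op_smul a ⟨x, x.2.1⟩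

/-- The sum `s + t`, on the domain `dom s ∩ dom t`. -/
def add (s t : UOp A E F) : UOp A E F where
  domain := s.domain ⊓ t.domain
  toFun :=
    { toFun := fun x => s ⟨x, x.2.1⟩ + t ⟨x, x.2.2⟩
      map_add' := fun x y => by
        have hs := s.map_add ⟨x, x.2.1⟩ ⟨y, y.2.1⟩
        have ht := t.map_add ⟨x, x.2.2⟩ ⟨y, y.2.2⟩
        exact (congrArg₂ (· + ·) hs ht).trans (add_add_add_comm _ _ _ _)
      map_smul' := fun c x => by
        have hs := s.map_smul c ⟨x, x.2.1⟩
        have ht := t.map_smul c ⟨x, x.2.2⟩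
        exact (congrArg₂ (· + ·) hs ht).trans (smul_add _ _ _).symm }
  smul_mem a _ hx := ⟨s.smul_mem a hx.1, t.smul_mem a hx.2⟩
  map_op_smul a x := by
    have hs := s.map_op_smul a ⟨x, x.2.1⟩
    have ht := t.map_op_smul a ⟨x, x.2.2⟩
    exact (congrArg₂ (· + ·) hs ht).trans (op_smul_add _ _ _).symm

/-- An operator `t` is regular if it is closed and densely defined, its adjoint is densely defined,
and `1 + t* t` has dense range. -/
structure IsRegular (t : UOp A E F) : Prop where
  dense_domain : Dense (t.domain : Set E)
  dense_adjoint_domain : Dense (t.adjoint.domain : Set F)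
  closed : t.toLinearPMap.IsClosed
  dense_range : Dense (Set.range fun x : (t.adjoint.comp t).domain => (x : E) + t.adjoint.comp t x)

/-- `Q` is the operator `(1 + t* t)^(-1/2)`: it is positive, and its square is a two-sided inverse
of `1 + t* t`. -/
def IsInvSqrt (t : UOp A E F) (Q : Adj A E E) : Prop :=
  (∀ x, 0 ≤ ⟪x, Q x⟫_A) ∧
  (∀ x, ∃ h : Q (Q x) ∈ (t.adjoint.comp t).domain,
    Q (Q x) + t.adjoint.comp t ⟨Q (Q x), h⟩ = x) ∧
  ∀ x : (t.adjoint.comp t).domain, Q (Q ((x : E) + t.adjoint.comp t x)) = x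

open Classical in
/-- The operator `Q_t = (1 + t* t)^(-1/2)`. -/
noncomputable def invSqrt (t : UOp A E F) : Adj A E E :=
  if h : ∃ Q, t.IsInvSqrt Q then h.choose else 0

/-- The bounded transform `F_t = t (1 + t* t)^(-1/2)`. -/
noncomputable def boundedTransform (t : UOp A E F) : UOp A E F :=
  t.comp t.invSqrt.toUOp

/-- A regular operator is `A`-Fredholm if it has a left and a right adjointable inverse modulo
compact operators, the right one taking its values in the domain. -/
def IsFredholm (t : UOp A E F) : Prop :=
  t.IsRegular ∧ ∃ (Pl Pr : Adj A F E) (Cl : Adj A E E) (Cr : Adj A F F),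
    Cl.IsCompact ∧ Cr.IsCompact ∧
    (∀ x : t.domain, Pl (t x) = x - Cl x) ∧
    ∀ y : F, ∃ h : Pr y ∈ t.domain, t ⟨Pr y, h⟩ = y - Cr y

end UOp

end Basic

section GraphModule

variable {A : Type u} [NonUnitalCStarAlgebra A] [PartialOrder A]
variable {E : Type v} [NormedAddCommGroup E] [NormedSpace ℂ E] [SMul A E] [CStarModule A E]
variable {F : Type v} [NormedAddCommGroup F] [NormedSpace ℂ F] [SMul A F] [CStarModule A F]
variable {G : Type v} [NormedAddCommGroup G] [NormedSpace ℂ G] [SMul A G] [CStarModule A G]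

/-- The domain of `t`, to be equipped with the graph inner product. -/
def GraphModule (t : UOp A E F) : Type v := t.domain

namespace GraphModule

instance (t : UOp A E F) : AddCommGroup (GraphModule t) := inferInstanceAs (AddCommGroup t.domain)

instance (t : UOp A E F) : Module ℂ (GraphModule t) := inferInstanceAs (Module ℂ t.domain)

instance (t : UOp A E F) : SMul A (GraphModule t) := ⟨fun a x => ⟨a • x.1, t.smul_mem a x.2⟩⟩

/-- The identity map from the graph module of `t` to the domain of `t`. -/
def toDomain (t : UOp A E F) : GraphModule t ≃ₗ[ℂ] t.domain := LinearEquiv.refl ℂ t.domain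

noncomputable instance (t : UOp A E F) : Norm (GraphModule t) where
  norm x := √‖⟪(toDomain t x : E), (toDomain t x : E)⟫_A + ⟪t (toDomain t x), t (toDomain t x)⟫_A‖

variable [StarOrderedRing A]

/-- The graph inner product `⟨x, y⟩ + ⟨t x, t y⟩`. -/
noncomputable instance (t : UOp A E F) : CStarModule A (GraphModule t) where
  inner x y := ⟪(toDomain t x : E), (toDomain t y : E)⟫_A + ⟪t (toDomain t x), t (toDomain t y)⟫_A
  inner_add_right {x y z} := by
    simp only [map_add, Submodule.coe_add, LinearPMap.map_add, CStarModule.inner_add_right]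
    exact add_add_add_comm _ _ _ _
  inner_self_nonneg := add_nonneg CStarModule.inner_self_nonneg CStarModule.inner_self_nonneg
  inner_self {x} := by
    refine ⟨fun h => ?_, fun h => by subst h; simp [LinearPMap.map_zero]⟩
    have h1 : ⟪(toDomain t x : E), (toDomain t x : E)⟫_A = 0 :=
      le_antisymm ((le_add_of_nonneg_right CStarModule.inner_self_nonneg).trans_eq h)
        CStarModule.inner_self_nonneg
    exact Subtype.ext (CStarModule.inner_self.mp h1)
  inner_op_smul_right {a x y} := by
    have h1 : ((toDomain t (a • y) : t.domain) : E) = a • (toDomain t y : E) := rfl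
    have h2 : t (toDomain t (a • y)) = a • t (toDomain t y) := t.map_op_smul a (toDomain t y)
    rw [h1, h2]
    simp [mul_add]
  inner_smul_right_complex {z x y} := by
    simp only [map_smul, Submodule.coe_smul, LinearPMap.map_smul,
      CStarModule.inner_smul_right_complex, smul_add]
  star_inner x y := by simp
  norm_eq_sqrt_norm_inner_self x := rfl

noncomputable instance (t : UOp A E F) : NormedAddCommGroup (GraphModule t) :=
  CStarModule.normedAddCommGroup A

noncomputable instance (t : UOp A E F) : NormedSpace ℂ (GraphModule t) :=
  .ofCore (CStarModule.normedSpaceCore A)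

theorem norm_sq_eq_graph (t : UOp A E F) (x : GraphModule t) :
    ‖x‖ ^ 2 = ‖⟪(toDomain t x : E), (toDomain t x : E)⟫_A
      + ⟪t (toDomain t x), t (toDomain t x)⟫_A‖ :=
  CStarModule.norm_sq_eq A

theorem norm_coe_le (t : UOp A E F) (x : GraphModule t) : ‖(toDomain t x : E)‖ ≤ ‖x‖ := by
  refine abs_le_of_sq_le_sq' ?_ (norm_nonneg x) |>.2
  rw [norm_sq_eq_graph, CStarModule.norm_sq_eq A]
  exact CStarAlgebra.norm_le_norm_of_nonneg_of_le CStarModule.inner_self_nonneg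
    (le_add_of_nonneg_right CStarModule.inner_self_nonneg)

theorem norm_apply_le (t : UOp A E F) (x : GraphModule t) : ‖t (toDomain t x)‖ ≤ ‖x‖ := by
  refine abs_le_of_sq_le_sq' ?_ (norm_nonneg x) |>.2
  rw [norm_sq_eq_graph, CStarModule.norm_sq_eq A]
  exact CStarAlgebra.norm_le_norm_of_nonneg_of_le CStarModule.inner_self_nonneg
    (le_add_of_nonneg_left CStarModule.inner_self_nonneg)

theorem norm_le_add (t : UOp A E F) (x : GraphModule t) :
    ‖x‖ ≤ ‖(toDomain t x : E)‖ + ‖t (toDomain t x)‖ := by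
  refine abs_le_of_sq_le_sq' ?_ (by positivity) |>.2
  rw [norm_sq_eq_graph]
  calc _ ≤ ‖⟪(toDomain t x : E), (toDomain t x : E)⟫_A‖
        + ‖⟪t (toDomain t x), t (toDomain t x)⟫_A‖ := norm_add_le _ _
    _ = ‖(toDomain t x : E)‖ ^ 2 + ‖t (toDomain t x)‖ ^ 2 := by simp [CStarModule.norm_sq_eq A]
    _ ≤ _ := by nlinarith [norm_nonneg (toDomain t x : E), norm_nonneg (t (toDomain t x))]

/-- If `t` is closed then its domain is a Hilbert module for the graph inner product. -/
theorem completeSpace [CompleteSpace E] [CompleteSpace F] (t : UOp A E F)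
    (ht : t.toLinearPMap.IsClosed) : CompleteSpace (GraphModule t) := by
  refine Metric.complete_of_cauchySeq_tendsto fun f hf => ?_
  have h1 : CauchySeq fun n => (toDomain t (f n) : E) := by
    rw [Metric.cauchySeq_iff'] at hf ⊢
    intro ε hε
    obtain ⟨n, hn⟩ := hf ε hε
    refine ⟨n, fun m hm => lt_of_le_of_lt ?_ (hn m hm)⟩
    have := norm_coe_le t (f m - f n)
    rw [dist_eq_norm, dist_eq_norm]
    simpa using this
  have h2 : CauchySeq fun n => t (toDomain t (f n)) := by
    rw [Metric.cauchySeq_iff'] at hf ⊢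
    intro ε hε
    obtain ⟨n, hn⟩ := hf ε hε
    refine ⟨n, fun m hm => lt_of_le_of_lt ?_ (hn m hm)⟩
    have := norm_apply_le t (f m - f n)
    rw [dist_eq_norm, dist_eq_norm]
    simpa [LinearPMap.map_sub] using this
  obtain ⟨x, hx⟩ := cauchySeq_tendsto_of_complete h1
  obtain ⟨y, hy⟩ := cauchySeq_tendsto_of_complete h2
  have hxy : (x, y) ∈ t.toLinearPMap.graph :=
    ht.mem_of_tendsto (hx.prodMk_nhds hy)
      (Filter.Eventually.of_forall fun n => t.toLinearPMap.mem_graph (toDomain t (f n)))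
  obtain ⟨z, hz1, hz2⟩ := (LinearPMap.mem_graph_iff _).mp hxy
  refine ⟨(toDomain t).symm z, ?_⟩
  rw [tendsto_iff_norm_sub_tendsto_zero] at hx hy ⊢
  refine squeeze_zero (fun _ => norm_nonneg _) (fun n => norm_le_add t _) ?_
  have := hx.add hy
  simp only [add_zero] at this
  refine this.congr fun n => ?_
  simp only [map_sub, LinearEquiv.apply_symm_apply, LinearPMap.map_sub, Submodule.coe_sub]
  simp only at hz1 hz2
  rw [hz1, hz2]

/-- An operator `t` with range in the domain of `s`, regarded as an everywhere defined operator
between the graph modules of `t` and `s`. -/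
noncomputable def map (t : UOp A E F) (s : UOp A F G) (h : ∀ x : t.domain, t x ∈ s.domain) :
    UOp A (GraphModule t) (GraphModule s) where
  domain := ⊤
  toFun := (toDomain s).symm.toLinearMap ∘ₗ t.toFun.codRestrict s.domain h ∘ₗ
    (toDomain t).toLinearMap ∘ₗ (⊤ : Submodule ℂ (GraphModule t)).subtype
  smul_mem _ _ _ := trivial
  map_op_smul a x := Subtype.ext (t.map_op_smul a (toDomain t x))

end GraphModule

end GraphModule

section Complexes

set_option linter.unusedSectionVars false

variable {A : Type u} [NonUnitalCStarAlgebra A] [PartialOrder A]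
variable {E : ℕ → Type v} [∀ k, NormedAddCommGroup (E k)] [∀ k, NormedSpace ℂ (E k)]
  [∀ k, SMul A (E k)] [∀ k, CStarModule A (E k)]

/-- A sequence of modules has finite length if only finitely many of them are nonzero. -/
def FiniteLength (E : ℕ → Type v) : Prop := ∃ n, ∀ k, n < k → Subsingleton (E k)

/-- A cochain complex of Hilbert modules `E 0 → E 1 → E 2 → ⋯`: the `t k` are regular and
`ran (t k) ⊆ ker (t (k + 1))`. -/
structure IsComplex (t : ∀ k, UOp A (E k) (E (k + 1))) : Prop where
  regular : ∀ k, (t k).IsRegular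
  range_le_ker : ∀ k (x : (t k).domain),
    ∃ h : t k x ∈ (t (k + 1)).domain, t (k + 1) ⟨t k x, h⟩ = 0

/-- A chain complex of Hilbert modules `⋯ → E 2 → E 1 → E 0`. -/
structure IsChainComplex (s : ∀ k, UOp A (E (k + 1)) (E k)) : Prop where
  regular : ∀ k, (s k).IsRegular
  range_le_ker : ∀ k (x : (s (k + 1)).domain),
    ∃ h : s (k + 1) x ∈ (s k).domain, s k ⟨s (k + 1) x, h⟩ = 0

/-- `(Pl, Pr)` is a joint parametrix of the cochain complex `t`: in every degree there is a compact
operator `C` such that, on the domain of the outgoing differential,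
`Pl ∘ (outgoing) + (incoming) ∘ Pr = 1 - C`, where `Pr` maps that domain to the domain of the
incoming differential. In degree `0` the incoming differential is zero. -/
def IsJointParametrix (t : ∀ k, UOp A (E k) (E (k + 1)))
    (Pl Pr : ∀ k, Adj A (E (k + 1)) (E k)) : Prop :=
  (∃ C : Adj A (E 0) (E 0), C.IsCompact ∧ ∀ x : (t 0).domain, Pl 0 (t 0 x) = x - C x) ∧
  ∀ k, ∃ C : Adj A (E (k + 1)) (E (k + 1)), C.IsCompact ∧
    ∀ x : (t (k + 1)).domain, ∃ h : Pr k x ∈ (t k).domain,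
      Pl (k + 1) (t (k + 1) x) + t k ⟨Pr k x, h⟩ = x - C x

/-- `(Pl, Pr)` is a joint parametrix of the chain complex `s`: the same condition as for cochain
complexes. In degree `0` the outgoing differential is zero and everywhere defined. -/
def IsChainJointParametrix (s : ∀ k, UOp A (E (k + 1)) (E k))
    (Pl Pr : ∀ k, Adj A (E k) (E (k + 1))) : Prop :=
  (∃ C : Adj A (E 0) (E 0), C.IsCompact ∧
    ∀ x : E 0, ∃ h : Pr 0 x ∈ (s 0).domain, s 0 ⟨Pr 0 x, h⟩ = x - C x) ∧
  ∀ k, ∃ C : Adj A (E (k + 1)) (E (k + 1)), C.IsCompact ∧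
    ∀ x : (s k).domain, ∃ h : Pr (k + 1) x ∈ (s (k + 1)).domain,
      Pl k (s k x) + s (k + 1) ⟨Pr (k + 1) x, h⟩ = x - C x

/-- An `A`-Fredholm (cochain) complex: a complex of finite length with a joint parametrix. -/
def IsFredholmComplex (t : ∀ k, UOp A (E k) (E (k + 1))) : Prop :=
  FiniteLength E ∧ IsComplex t ∧ ∃ Pl Pr, IsJointParametrix t Pl Pr

/-- An `A`-Fredholm chain complex. -/
def IsFredholmChainComplex (s : ∀ k, UOp A (E (k + 1)) (E k)) : Prop :=
  FiniteLength E ∧ IsChainComplex s ∧ ∃ Pl Pr, IsChainJointParametrix s Pl Pr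

/-- The `k`-th Laplace operator `t_k* t_k + t_(k-1) t_(k-1)*`, on the intersection of the two
domains. -/
noncomputable def laplaceAt (t : ∀ k, UOp A (E k) (E (k + 1))) : ∀ k, UOp A (E k) (E k)
  | 0 => (t 0).adjoint.comp (t 0)
  | k + 1 => ((t (k + 1)).adjoint.comp (t (k + 1))).add ((t k).comp (t k).adjoint)

/-- The differentials of the graph-norm complex: `t k`, from `dom (t k)` to `dom (t (k + 1))`, both
with their graph inner products. -/
noncomputable def graphComplex [StarOrderedRing A] (t : ∀ k, UOp A (E k) (E (k + 1)))
    (ht : IsComplex t) (k : ℕ) : UOp A (GraphModule (t k)) (GraphModule (t (k + 1))) :=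
  GraphModule.map (t k) (t (k + 1)) fun x => (ht.range_le_ker k x).1

/-- The finite orthogonal sum of operators `T i`, with domain the sum of the domains. -/
noncomputable def directSum [StarOrderedRing A] {ι : Type} [Fintype ι] {M : ι → Type v}
    [∀ i, NormedAddCommGroup (M i)]
    [∀ i, NormedSpace ℂ (M i)] [∀ i, SMul A (M i)] [∀ i, CStarModule A (M i)]
    (T : ∀ i, UOp A (M i) (M i)) : UOp A C⋆ᵐᵒᵈ(A, Π i, M i) C⋆ᵐᵒᵈ(A, Π i, M i) where
  domain :=
    { carrier := {x | ∀ i, x i ∈ (T i).domain}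
      add_mem' := fun hx hy i => add_mem (hx i) (hy i)
      zero_mem' := fun i => zero_mem _
      smul_mem' := fun c _ hx i => Submodule.smul_mem _ c (hx i) }
  toFun :=
    { toFun := fun x => (WithCStarModule.equiv A (Π i, M i)).symm fun i => T i ⟨x.1 i, x.2 i⟩
      map_add' := fun x y => by
        ext i
        exact (T i).map_add ⟨x.1 i, x.2 i⟩ ⟨y.1 i, y.2 i⟩
      map_smul' := fun c x => by
        ext i
        exact (T i).map_smul c ⟨x.1 i, x.2 i⟩ }
  smul_mem a _ hx i := (T i).smul_mem a (hx i)
  map_op_smul a x := by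
    ext i
    exact (T i).map_op_smul a ⟨x.1 i, x.2 i⟩

/-- The Laplace operator of a complex concentrated in degrees `0, …, N + 1`: the orthogonal sum of
the `k`-th Laplace operators. -/
noncomputable def laplace [StarOrderedRing A] (N : ℕ) (t : ∀ k, UOp A (E k) (E (k + 1))) :
    UOp A C⋆ᵐᵒᵈ(A, Π k : Fin (N + 2), E k) C⋆ᵐᵒᵈ(A, Π k : Fin (N + 2), E k) :=
  directSum fun k : Fin (N + 2) => laplaceAt t k

/-- The even degrees in `0, …, N + 1`. -/
abbrev EvenDegree (N : ℕ) : Type := {k : Fin (N + 2) // Even (k : ℕ)}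

/-- The odd degrees in `0, …, N + 1`. -/
abbrev OddDegree (N : ℕ) : Type := {k : Fin (N + 2) // Odd (k : ℕ)}

variable (A E) in
/-- The orthogonal sum of the modules of even degree. -/
abbrev EvenSum (N : ℕ) : Type v := C⋆ᵐᵒᵈ(A, Π k : EvenDegree N, E (k.1 : ℕ))

variable (A E) in
/-- The orthogonal sum of the modules of odd degree. -/
abbrev OddSum (N : ℕ) : Type v := C⋆ᵐᵒᵈ(A, Π k : OddDegree N, E (k.1 : ℕ))

/-- The component of `x` in degree `n`, which is zero if `n` is odd or too large. -/
def evenComponent {N : ℕ} (x : EvenSum A E N) (n : ℕ) : E n :=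
  if h : n < N + 2 ∧ Even n then x ⟨⟨n, h.1⟩, h.2⟩ else 0

theorem evenComponent_add {N : ℕ} (x y : EvenSum A E N) (n : ℕ) :
    evenComponent (x + y) n = evenComponent x n + evenComponent y n := by
  unfold evenComponent; split_ifs <;> simp

theorem evenComponent_zero {N : ℕ} (n : ℕ) : evenComponent (0 : EvenSum A E N) n = 0 := by
  unfold evenComponent; split_ifs <;> simp

theorem evenComponent_smul {N : ℕ} (c : ℂ) (x : EvenSum A E N) (n : ℕ) :
    evenComponent (c • x) n = c • evenComponent x n := by
  unfold evenComponent; split_ifs <;> simp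

theorem evenComponent_op_smul {N : ℕ} (a : A) (x : EvenSum A E N) (n : ℕ) :
    evenComponent (a • x) n = a • evenComponent x n := by
  unfold evenComponent; split_ifs <;> simp [op_smul_zero]

/-- The graded families `x` such that `x n ∈ dom (t n) ∩ dom (t (n - 1))*` for all `n`. -/
def rollDomain (t : ∀ k, UOp A (E k) (E (k + 1))) : Submodule ℂ (∀ n, E n) where
  carrier := {x | ∀ n, x n ∈ (t n).domain ∧ x (n + 1) ∈ (t n).adjoint.domain}
  add_mem' hx hy n := ⟨add_mem (hx n).1 (hy n).1, add_mem (hx n).2 (hy n).2⟩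
  zero_mem' _ := ⟨zero_mem _, zero_mem _⟩
  smul_mem' c _ hx n := ⟨Submodule.smul_mem _ c (hx n).1, Submodule.smul_mem _ c (hx n).2⟩

/-- The degree `n` component `t (n - 1) x (n - 1) + (t n)* x (n + 1)` of `(t + t*) x`. -/
noncomputable def roll (t : ∀ k, UOp A (E k) (E (k + 1))) (x : rollDomain t) : ∀ n, E n
  | 0 => (t 0).adjoint ⟨x.1 1, (x.2 0).2⟩
  | n + 1 => t n ⟨x.1 n, (x.2 n).1⟩ + (t (n + 1)).adjoint ⟨x.1 (n + 1 + 1), (x.2 (n + 1)).2⟩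

theorem roll_add (t : ∀ k, UOp A (E k) (E (k + 1))) (x y : rollDomain t) (n : ℕ) :
    roll t (x + y) n = roll t x n + roll t y n := by
  cases n with
  | zero => exact (t 0).adjoint.map_add ⟨x.1 1, (x.2 0).2⟩ ⟨y.1 1, (y.2 0).2⟩
  | succ n =>
    have h1 := (t n).map_add ⟨x.1 n, (x.2 n).1⟩ ⟨y.1 n, (y.2 n).1⟩
    have h2 := (t (n + 1)).adjoint.map_add ⟨x.1 (n + 1 + 1), (x.2 (n + 1)).2⟩
      ⟨y.1 (n + 1 + 1), (y.2 (n + 1)).2⟩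
    exact (congrArg₂ (· + ·) h1 h2).trans (add_add_add_comm _ _ _ _)

theorem roll_smul (t : ∀ k, UOp A (E k) (E (k + 1))) (c : ℂ) (x : rollDomain t) (n : ℕ) :
    roll t (c • x) n = c • roll t x n := by
  cases n with
  | zero => exact (t 0).adjoint.map_smul c ⟨x.1 1, (x.2 0).2⟩
  | succ n =>
    have h1 := (t n).map_smul c ⟨x.1 n, (x.2 n).1⟩
    have h2 := (t (n + 1)).adjoint.map_smul c ⟨x.1 (n + 1 + 1), (x.2 (n + 1)).2⟩
    exact (congrArg₂ (· + ·) h1 h2).trans (smul_add _ _ _).symm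

theorem roll_op_smul (t : ∀ k, UOp A (E k) (E (k + 1))) (a : A) (x y : rollDomain t)
    (h : ∀ n, y.1 n = a • x.1 n) (n : ℕ) : roll t y n = a • roll t x n := by
  obtain ⟨y, hy⟩ := y
  obtain rfl : y = fun n => a • x.1 n := funext h
  cases n with
  | zero => exact (t 0).adjoint.map_op_smul a ⟨x.1 1, (x.2 0).2⟩
  | succ n =>
    have h1 := (t n).map_op_smul a ⟨x.1 n, (x.2 n).1⟩
    have h2 := (t (n + 1)).adjoint.map_op_smul a ⟨x.1 (n + 1 + 1), (x.2 (n + 1)).2⟩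
    exact (congrArg₂ (· + ·) h1 h2).trans (op_smul_add _ _ _).symm

/-- The even Dirac operator of a complex concentrated in degrees `0, …, N + 1`: it maps
`(x_(2k))_k`, with `x_(2k) ∈ dom t_(2k) ∩ dom t_(2k-1)*`, to
`(t_(2k) x_(2k) + t_(2k+1)* x_(2k+2))_k`. -/
noncomputable def evenDirac [StarOrderedRing A] (N : ℕ) (t : ∀ k, UOp A (E k) (E (k + 1))) :
    UOp A (EvenSum A E N) (OddSum A E N) where
  domain :=
    { carrier := {x | evenComponent x ∈ rollDomain t}
      add_mem' := fun {x y} hx hy => by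
        have : evenComponent (x + y) = evenComponent x + evenComponent y :=
          funext (evenComponent_add x y)
        change evenComponent (x + y) ∈ rollDomain t
        rw [this]
        exact add_mem hx hy
      zero_mem' := by
        have : evenComponent (0 : EvenSum A E N) = 0 := funext evenComponent_zero
        change evenComponent (0 : EvenSum A E N) ∈ rollDomain t
        rw [this]
        exact zero_mem _
      smul_mem' := fun c x hx => by
        have : evenComponent (c • x) = c • evenComponent x := funext (evenComponent_smul c x)
        change evenComponent (c • x) ∈ rollDomain t
        rw [this]
        exact Submodule.smul_mem _ c hx }
  toFun :=
    { toFun := fun x => (WithCStarModule.equiv A (Π k : OddDegree N, E (k.1 : ℕ))).symm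
        fun k => roll t ⟨evenComponent x.1, x.2⟩ (k.1 : ℕ)
      map_add' := fun x y => by
        ext k
        refine Eq.trans ?_ (roll_add t ⟨evenComponent x.1, x.2⟩ ⟨evenComponent y.1, y.2⟩ _)
        exact congrArg (fun z => roll t z _) (Subtype.ext (funext (evenComponent_add x.1 y.1)))
      map_smul' := fun c x => by
        ext k
        refine Eq.trans ?_ (roll_smul t c ⟨evenComponent x.1, x.2⟩ _)
        exact congrArg (fun z => roll t z _) (Subtype.ext (funext (evenComponent_smul c x.1))) }
  smul_mem a x hx n := by
    rw [evenComponent_op_smul, evenComponent_op_smul]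
    exact ⟨(t n).smul_mem a (hx n).1, (t n).adjoint.smul_mem a (hx n).2⟩
  map_op_smul a x := by
    ext k
    exact roll_op_smul t a ⟨evenComponent x.1, x.2⟩ _ (evenComponent_op_smul a x.1) _

end Complexes

end HilbertCStar

/-! All six properties are equivalent to one statement about bounded operators: in every degree k
the operator L_k = (1 - R_k) + (1 - R'_{k-1}) is invertible modulo compacts (`EssInv
(boundedLaplacian t k)`). Here R_k = (1 + t_k* t_k)⁻¹ and R'_{k-1} = (1 + t_{k-1} t_{k-1}*)⁻¹. As
ran t_{k-1} lies in ker t_k, R_k fixes the range of 1 - R'_{k-1}. So the two summands of L_k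
annihilate each other, and 1 - L_k = R_k R'_{k-1} = (1 + Δ_k)⁻¹.

A joint parametrix involves no coherence between degrees, so the complex splits into sequences v, u
with u v = 0, which `localFredholm_iff` treats. If S inverts L = p + q modulo compacts and p q = q p
= 0, then S p + q S is 1 modulo compacts; p = 1 - R factors through u and q = 1 - R' through v, so
this is a parametrix. Conversely, a parametrix yields (1 - L)² ≤ c L + compact as A-valued forms,
hence 1 ≤ (c + 2) L + compact, and a form bounded below by 1 belongs to an invertible operator
(`EssInv.of_bound`).

The other objects lead to the same L. Passing to adjoints exchanges its two summands. The bounded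
transform has F* F = 1 - R and F F* = 1 - R', so its own Laplacian is L. The operator (1 + t*
t)^(-1/2) is unitary onto the graph module and commutes with L, so it carries L to the Laplacian of
the graph-norm complex. Since 1 - L is the resolvent of Δ, Fredholmness of Δ is that of Δ(1 + Δ)⁻¹ =
L (`isFredholm_iff_of_inverse`). The sums of the 1 - L_k over even and odd k are the resolvents (1 +
D* D)⁻¹ and (1 + D D*)⁻¹ of the even Dirac operator D, and a regular operator is Fredholm iff 1
minus each of these is invertible modulo compacts (`UOp.IsRegular.isFredholm_iff`).

Unbounded operators are handled through their graphs. `IsResolvent` records the resolvents of two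
formally adjoint relations; their mere existence, with dense domains, forces closedness, regularity,
and that each relation is the adjoint of the other. -/

namespace HilbertCStar

/-! ### The C*-algebra of adjointable operators -/

section AdjAlgebra

variable {A : Type u} [NonUnitalCStarAlgebra A] [PartialOrder A]
variable {E : Type*} [NormedAddCommGroup E] [NormedSpace ℂ E] [SMul A E] [CStarModule A E]
variable {F : Type*} [NormedAddCommGroup F] [NormedSpace ℂ F] [SMul A F] [CStarModule A F]
variable {G : Type*} [NormedAddCommGroup G] [NormedSpace ℂ G] [SMul A G] [CStarModule A G]
variable {H : Type*} [NormedAddCommGroup H] [NormedSpace ℂ H] [SMul A H] [CStarModule A H]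

variable (A) in
theorem ext_inner_left {x y : E} (h : ∀ z : E, ⟪x, z⟫_A = ⟪y, z⟫_A) : x = y :=
  ext_inner A fun z => star_injective (by simpa using h z)

namespace Adj

theorem toCLM_injective :
    Function.Injective (Adj.toContinuousLinearMap : Adj A E F → E →L[ℂ] F) := by
  rintro ⟨S, _⟩ ⟨T, _⟩ rfl
  rfl

@[ext]
theorem ext {S T : Adj A E F} (h : ∀ x, S x = T x) : S = T :=
  toCLM_injective (ContinuousLinearMap.ext h)

/-- The adjoint of an adjointable operator. -/
noncomputable def adj (T : Adj A E F) : Adj A F E where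
  toContinuousLinearMap := T.exists_adjoint.choose
  exists_adjoint := ⟨T.toContinuousLinearMap, fun x y => by
    rw [← CStarModule.star_inner, ← T.exists_adjoint.choose_spec, CStarModule.star_inner]⟩

theorem inner_left (T : Adj A E F) (x : E) (y : F) : ⟪T x, y⟫_A = ⟪x, T.adj y⟫_A :=
  T.exists_adjoint.choose_spec x y

theorem inner_right (T : Adj A E F) (x : F) (y : E) : ⟪x, T y⟫_A = ⟪T.adj x, y⟫_A := by
  rw [← CStarModule.star_inner, inner_left, CStarModule.star_inner]

theorem eq_adj {S : Adj A E F} {T : Adj A F E} (h : ∀ x y, ⟪T x, y⟫_A = ⟪x, S y⟫_A) :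
    S = T.adj :=
  ext fun y => ext_inner A fun x => by rw [← h, inner_left]

@[simp]
theorem adj_adj (T : Adj A E F) : T.adj.adj = T :=
  (eq_adj fun x y => (T.inner_right x y).symm).symm

/-- The composition of adjointable operators. -/
noncomputable def comp (S : Adj A F G) (T : Adj A E F) : Adj A E G where
  toContinuousLinearMap := S.toContinuousLinearMap.comp T.toContinuousLinearMap
  exists_adjoint := ⟨T.adj.toContinuousLinearMap.comp S.adj.toContinuousLinearMap, fun x y => by
    simp [inner_left]⟩

@[simp]
theorem comp_apply (S : Adj A F G) (T : Adj A E F) (x : E) : S.comp T x = S (T x) := rfl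

instance : Add (Adj A E F) := ⟨fun S T =>
  ⟨S.toContinuousLinearMap + T.toContinuousLinearMap,
    S.adj.toContinuousLinearMap + T.adj.toContinuousLinearMap, fun x y => by
      simp [inner_left]⟩⟩

instance : Neg (Adj A E F) := ⟨fun S =>
  ⟨-S.toContinuousLinearMap, -S.adj.toContinuousLinearMap, fun x y => by simp [inner_left]⟩⟩

instance : Sub (Adj A E F) := ⟨fun S T =>
  ⟨S.toContinuousLinearMap - T.toContinuousLinearMap,
    S.adj.toContinuousLinearMap - T.adj.toContinuousLinearMap, fun x y => by
      simp [inner_left]⟩⟩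

instance : SMul ℂ (Adj A E F) := ⟨fun c S =>
  ⟨c • S.toContinuousLinearMap, (star c) • S.adj.toContinuousLinearMap, fun x y => by
      simp [inner_left]⟩⟩

instance : SMul ℕ (Adj A E F) := ⟨fun n S =>
  ⟨n • S.toContinuousLinearMap, n • S.adj.toContinuousLinearMap, fun x y => by
      change ⟪n • S x, y⟫_A = ⟪x, n • S.adj y⟫_A
      rw [← Nat.cast_smul_eq_nsmul ℂ, ← Nat.cast_smul_eq_nsmul ℂ]
      simp [inner_left]⟩⟩

instance : SMul ℤ (Adj A E F) := ⟨fun n S =>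
  ⟨n • S.toContinuousLinearMap, n • S.adj.toContinuousLinearMap, fun x y => by
      change ⟪n • S x, y⟫_A = ⟪x, n • S.adj y⟫_A
      rw [← Int.cast_smul_eq_zsmul ℂ, ← Int.cast_smul_eq_zsmul ℂ]
      simp [inner_left]⟩⟩

noncomputable instance : AddCommGroup (Adj A E F) :=
  toCLM_injective.addCommGroup _ rfl (fun _ _ => rfl) (fun _ => rfl) (fun _ _ => rfl)
    (fun _ _ => rfl) (fun _ _ => rfl)

variable (A E F) in
/-- Adjointable operators as bounded operators. -/
def toCLMHom : Adj A E F →+ (E →L[ℂ] F) where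
  toFun := Adj.toContinuousLinearMap
  map_zero' := rfl
  map_add' _ _ := rfl

noncomputable instance : Module ℂ (Adj A E F) :=
  toCLM_injective.module ℂ (toCLMHom A E F) fun _ _ => rfl

@[simp] theorem add_apply (S T : Adj A E F) (x : E) : (S + T) x = S x + T x := rfl
@[simp] theorem sub_apply (S T : Adj A E F) (x : E) : (S - T) x = S x - T x := rfl
@[simp] theorem neg_apply (S : Adj A E F) (x : E) : (-S) x = -S x := rfl
@[simp] theorem smul_apply (c : ℂ) (S : Adj A E F) (x : E) : (c • S) x = c • S x := rfl
@[simp] theorem zero_apply (x : E) : (0 : Adj A E F) x = 0 := rfl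
@[simp] theorem toCLM_sub (S T : Adj A E F) : (S - T).toContinuousLinearMap =
  S.toContinuousLinearMap - T.toContinuousLinearMap := rfl

instance : One (Adj A E E) := ⟨⟨ContinuousLinearMap.id ℂ E, ContinuousLinearMap.id ℂ E,
  fun _ _ => rfl⟩⟩

noncomputable instance : Mul (Adj A E E) := ⟨comp⟩

@[simp] theorem one_apply (x : E) : (1 : Adj A E E) x = x := rfl
@[simp] theorem mul_apply (S T : Adj A E E) (x : E) : (S * T) x = S (T x) := rfl

noncomputable instance : Ring (Adj A E E) :=
  { (inferInstance : AddCommGroup (Adj A E E)) with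
    left_distrib := fun a b c => by ext x; simp
    right_distrib := fun a b c => by ext x; simp
    zero_mul := fun a => by ext x; simp
    mul_zero := fun a => by ext x; simp
    mul_assoc := fun a b c => rfl
    one_mul := fun a => rfl
    mul_one := fun a => rfl }

@[simp] theorem adj_add (S T : Adj A E F) : (S + T).adj = S.adj + T.adj :=
  (eq_adj fun x y => by simp [inner_left]).symm
@[simp] theorem adj_sub (S T : Adj A E F) : (S - T).adj = S.adj - T.adj :=
  (eq_adj fun x y => by simp [inner_left]).symm
@[simp] theorem adj_smul (c : ℂ) (T : Adj A E F) : (c • T).adj = star c • T.adj :=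
  (eq_adj fun x y => by simp [inner_left]).symm
@[simp] theorem adj_one : (1 : Adj A E E).adj = 1 :=
  (eq_adj fun x y => by simp).symm
@[simp] theorem adj_zero : (0 : Adj A E F).adj = 0 :=
  (eq_adj fun x y => by simp).symm
@[simp] theorem adj_comp (S : Adj A F G) (T : Adj A E F) : (S.comp T).adj = T.adj.comp S.adj :=
  (eq_adj fun x y => by simp [inner_left]).symm
@[simp] theorem adj_mul (S T : Adj A E E) : (S * T).adj = T.adj * S.adj :=
  adj_comp S T

noncomputable instance : Algebra ℂ (Adj A E E) :=
  .ofModule (fun c S T => rfl) (fun c S T => by ext x; simp)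

noncomputable instance : StarRing (Adj A E E) where
  star := adj
  star_involutive := adj_adj
  star_mul := adj_mul
  star_add := adj_add

theorem star_eq_adj (T : Adj A E E) : star T = T.adj := rfl

instance : StarModule ℂ (Adj A E E) := ⟨fun c T => adj_smul c T⟩

variable (A E) in
/-- Adjointable endomorphisms as an algebra of bounded operators. -/
noncomputable def toCLMAlgHom : Adj A E E →ₐ[ℂ] (E →L[ℂ] E) :=
  AlgHom.ofLinearMap ⟨⟨Adj.toContinuousLinearMap, fun _ _ => rfl⟩, fun _ _ => rfl⟩ rfl
    fun _ _ => rfl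

noncomputable instance : NormedRing (Adj A E E) :=
  NormedRing.induced _ (E →L[ℂ] E) (toCLMAlgHom A E) toCLM_injective

noncomputable instance : NormedAlgebra ℂ (Adj A E E) :=
  NormedAlgebra.induced ℂ _ (E →L[ℂ] E) (toCLMAlgHom A E)

section Complete

variable [StarOrderedRing A]

theorem norm_adj_le (T : Adj A E F) :
    ‖T.adj.toContinuousLinearMap‖ ≤ ‖T.toContinuousLinearMap‖ := by
  refine ContinuousLinearMap.opNorm_le_bound _ (norm_nonneg _) fun y => ?_
  rcases (norm_nonneg (T.adj y)).eq_or_lt with h | h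
  · rw [← h]; positivity
  refine le_of_mul_le_mul_left ?_ h
  calc ‖T.adj y‖ * ‖T.adj y‖ = ‖⟪T (T.adj y), y⟫_A‖ := by
        rw [inner_left, ← CStarModule.norm_sq_eq A, sq]
    _ ≤ ‖T (T.adj y)‖ * ‖y‖ := CStarModule.norm_inner_le F
    _ ≤ (‖T.toContinuousLinearMap‖ * ‖T.adj y‖) * ‖y‖ := by
        gcongr; exact T.toContinuousLinearMap.le_opNorm _
    _ = _ := by ring

theorem norm_adj (T : Adj A E F) :
    ‖T.adj.toContinuousLinearMap‖ = ‖T.toContinuousLinearMap‖ :=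
  le_antisymm T.norm_adj_le (by simpa using T.adj.norm_adj_le)

instance : CStarRing (Adj A E E) where
  norm_mul_self_le T := by
    change ‖T.toContinuousLinearMap‖ * ‖T.toContinuousLinearMap‖ ≤ ‖(star T * T)‖
    have h : ‖T.toContinuousLinearMap‖ ≤ √‖(star T * T)‖ := by
      refine ContinuousLinearMap.opNorm_le_bound _ (Real.sqrt_nonneg _) fun x => ?_
      refine abs_le_of_sq_le_sq' ?_ (by positivity) |>.2
      rw [mul_pow, Real.sq_sqrt (norm_nonneg _), CStarModule.norm_sq_eq A, inner_left]
      calc _ ≤ ‖x‖ * ‖(star T * T) x‖ := CStarModule.norm_inner_le E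
        _ ≤ ‖x‖ * (‖star T * T‖ * ‖x‖) := by
          gcongr; exact (star T * T).toContinuousLinearMap.le_opNorm _
        _ = _ := by ring
    calc _ ≤ √‖(star T * T)‖ * √‖(star T * T)‖ := by gcongr
      _ = _ := Real.mul_self_sqrt (norm_nonneg _)

variable [CompleteSpace E]

/-- A norm limit of adjointable operators is adjointable because the adjoints form a Cauchy sequence
too. This completes the C*-algebra structure, and with it continuous functional calculus becomes
available. -/
instance : CompleteSpace (Adj A E E) := by
  refine Metric.complete_of_cauchySeq_tendsto fun f hf => ?_
  have h1 : CauchySeq fun n => (f n).toContinuousLinearMap := by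
    rw [Metric.cauchySeq_iff'] at hf ⊢
    exact hf
  have h2 : CauchySeq fun n => (f n).adj.toContinuousLinearMap := by
    rw [Metric.cauchySeq_iff'] at h1 ⊢
    intro ε hε
    obtain ⟨n, hn⟩ := h1 ε hε
    refine ⟨n, fun m hm => lt_of_le_of_lt ?_ (hn m hm)⟩
    rw [dist_eq_norm, dist_eq_norm, ← toCLM_sub, ← toCLM_sub, ← adj_sub]
    exact norm_adj_le _
  obtain ⟨T, hT⟩ := cauchySeq_tendsto_of_complete h1
  obtain ⟨S, hS⟩ := cauchySeq_tendsto_of_complete h2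
  have hTS : ∀ x y, ⟪T x, y⟫_A = ⟪x, S y⟫_A := fun x y => by
    have a1 : Filter.Tendsto (fun n => f n x) Filter.atTop (nhds (T x)) :=
      ((ContinuousLinearMap.apply ℂ E x).continuous.tendsto T).comp hT
    have a2 : Filter.Tendsto (fun n => (f n).adj y) Filter.atTop (nhds (S y)) :=
      ((ContinuousLinearMap.apply ℂ E y).continuous.tendsto S).comp hS
    have b1 := (CStarModule.continuous_inner (A := A) (E := E)).tendsto (T x, y) |>.comp
      (a1.prodMk_nhds tendsto_const_nhds)
    have b2 := (CStarModule.continuous_inner (A := A) (E := E)).tendsto (x, S y) |>.comp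
      (tendsto_const_nhds.prodMk_nhds a2)
    refine tendsto_nhds_unique b1 (b2.congr fun n => ?_)
    exact ((f n).inner_left x y).symm
  refine ⟨⟨T, S, hTS⟩, ?_⟩
  rw [tendsto_iff_norm_sub_tendsto_zero] at hT ⊢
  exact hT

noncomputable instance : CStarAlgebra (Adj A E E) where

end Complete

end Adj

end AdjAlgebra

/-! ### Positive forms and positive operators -/

section Positivity

variable {A : Type u} [NonUnitalCStarAlgebra A] [PartialOrder A] [StarOrderedRing A]
variable {E : Type*} [NormedAddCommGroup E] [NormedSpace ℂ E] [SMul A E] [CStarModule A E]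
variable {F : Type*} [NormedAddCommGroup F] [NormedSpace ℂ F] [SMul A F] [CStarModule A F]

namespace Adj

omit [StarOrderedRing A] in
/-- Polarization: an operator with vanishing quadratic form is zero. -/
theorem eq_zero_of_inner_self (T : Adj A E E) (h : ∀ x, ⟪x, T x⟫_A = 0) : T = 0 := by
  ext y
  refine ext_inner A fun x => ?_
  have h1 := h (x + y)
  have h2 := h (x + Complex.I • y)
  simp only [map_add, map_smul, CStarModule.inner_add_right, CStarModule.inner_add_left, h,
    CStarModule.inner_smul_right_complex, CStarModule.inner_smul_left_complex, add_zero,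
    zero_add, smul_zero] at h1 h2
  have h3 : ⟪y, T x⟫_A = -⟪x, T y⟫_A := eq_neg_of_add_eq_zero_left h1
  rw [h3] at h2
  have h4 : (2 * Complex.I) • ⟪x, T y⟫_A = 0 := by
    rw [← h2, mul_smul, two_smul]
    simp
  simpa using h4

theorem adj_eq_of_inner_nonneg {T : Adj A E E} (h : ∀ x, 0 ≤ ⟪x, T x⟫_A) : T.adj = T := by
  rw [← sub_eq_zero]
  refine eq_zero_of_inner_self _ fun x => ?_
  rw [sub_apply, CStarModule.inner_sub_right, ← inner_left, ← CStarModule.star_inner x (T x),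
    (IsSelfAdjoint.of_nonneg (h x)).star_eq, sub_self]

variable [CompleteSpace E]

/-- The negative part vanishes: with T⁻ = s* s, the form at T⁻ x equals -⟪s T⁻ x, s T⁻ x⟫, so s T⁻ =
0, then (T⁻)² = 0 and T⁻ = 0. This links A-valued form inequalities to the order of the C*-algebra.
-/
theorem exists_eq_star_mul_self {T : Adj A E E} (h : ∀ x, 0 ≤ ⟪x, T x⟫_A) :
    ∃ S : Adj A E E, T = star S * S := by
  let _ := CStarAlgebra.spectralOrder (Adj A E E)
  have _ := CStarAlgebra.spectralOrderedRing (Adj A E E)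
  have hT : IsSelfAdjoint T := adj_eq_of_inner_nonneg h
  have hn : 0 ≤ T⁻ := CFC.negPart_nonneg T
  have hTn : T * T⁻ = -(T⁻ * T⁻) := by
    calc T * T⁻ = (T⁺ - T⁻) * T⁻ := by rw [CFC.posPart_sub_negPart T]
      _ = _ := by rw [sub_mul, CFC.posPart_mul_negPart, zero_sub]
  obtain ⟨s, hs⟩ := CStarAlgebra.nonneg_iff_eq_star_mul_self.mp hn
  have hsn : ∀ x, s (T⁻ x) = 0 := fun x => by
    have h1 := h (T⁻ x)
    rw [← mul_apply, hTn, neg_apply, CStarModule.inner_neg_right] at h1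
    have h2 : ⟪T⁻ x, (T⁻ * T⁻) x⟫_A = ⟪s (T⁻ x), s (T⁻ x)⟫_A := by
      rw [mul_apply, inner_left s]
      congr 1
      exact congrArg (fun S : Adj A E E => S (T⁻ x)) hs
    rw [h2] at h1
    exact CStarModule.inner_self.mp
      (le_antisymm (neg_nonneg.mp h1) CStarModule.inner_self_nonneg)
  have hnn : T⁻ * T⁻ = 0 := by
    conv_lhs => rw [hs]
    rw [mul_assoc]
    ext x
    rw [mul_apply, ← hs, mul_apply, hsn, map_zero, zero_apply]
  have hn0 : T⁻ = 0 := by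
    have := (IsSelfAdjoint.of_nonneg hn).star_eq
    rw [← CStarRing.star_mul_self_eq_zero_iff, this, hnn]
  exact CStarAlgebra.nonneg_iff_eq_star_mul_self.mp ((CFC.negPart_eq_zero_iff T).mp hn0)

omit [CompleteSpace E] [StarOrderedRing A] in
theorem inner_star_mul_self_nonneg (S : Adj A E E) (x : E) : 0 ≤ ⟪x, (star S * S) x⟫_A := by
  rw [mul_apply, star_eq_adj, ← inner_left]
  exact CStarModule.inner_self_nonneg

/-- Positive operators have positive square roots. -/
theorem exists_sqrt {T : Adj A E E} (h : ∀ x, 0 ≤ ⟪x, T x⟫_A) :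
    ∃ Q : Adj A E E, (∀ x, 0 ≤ ⟪x, Q x⟫_A) ∧ Q * Q = T := by
  let _ := CStarAlgebra.spectralOrder (Adj A E E)
  have _ := CStarAlgebra.spectralOrderedRing (Adj A E E)
  obtain ⟨S, hS⟩ := exists_eq_star_mul_self h
  have hT : 0 ≤ T := CStarAlgebra.nonneg_iff_eq_star_mul_self.mpr ⟨S, hS⟩
  refine ⟨CFC.sqrt T, fun x => ?_, CFC.sqrt_mul_sqrt_self T⟩
  obtain ⟨s, hs⟩ := CStarAlgebra.nonneg_iff_eq_star_mul_self.mp (CFC.sqrt_nonneg T)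
  rw [hs]
  exact inner_star_mul_self_nonneg s x

/-- An operator that is bounded below by the identity is invertible. -/
theorem exists_inverse {T : Adj A E E} (h : ∀ x, ⟪x, x⟫_A ≤ ⟪x, T x⟫_A) :
    ∃ S : Adj A E E, S * T = 1 ∧ T * S = 1 := by
  let _ := CStarAlgebra.spectralOrder (Adj A E E)
  have _ := CStarAlgebra.spectralOrderedRing (Adj A E E)
  have h1 : (1 : Adj A E E) ≤ T := by
    rw [← sub_nonneg]
    refine CStarAlgebra.nonneg_iff_eq_star_mul_self.mpr (exists_eq_star_mul_self fun x => ?_)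
    rw [sub_apply, one_apply, CStarModule.inner_sub_right]
    exact sub_nonneg.mpr (h x)
  obtain ⟨U, rfl⟩ := CStarAlgebra.isUnit_of_le 1 h1
  exact ⟨↑U⁻¹, U.inv_mul, U.mul_inv⟩

/-- From T* T ≤ ‖T* T‖ in the C*-algebra. An inequality in A is needed, not just one between norms,
so that it can be added to other form inequalities. -/
theorem exists_inner_apply_le (T : Adj A E F) :
    ∃ c : ℝ, 0 ≤ c ∧ ∀ x, ⟪T x, T x⟫_A ≤ c • ⟪x, x⟫_A := by
  let _ := CStarAlgebra.spectralOrder (Adj A E E)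
  have _ := CStarAlgebra.spectralOrderedRing (Adj A E E)
  have hs : IsSelfAdjoint (T.adj.comp T) := by
    change (T.adj.comp T).adj = _
    simp
  have h1 := hs.le_algebraMap_norm_self
  rw [← sub_nonneg, CStarAlgebra.nonneg_iff_eq_star_mul_self] at h1
  obtain ⟨s, h1⟩ := h1
  refine ⟨‖T.adj.comp T‖, norm_nonneg _, fun x => ?_⟩
  have h2 := inner_star_mul_self_nonneg s x
  rw [← h1, Algebra.algebraMap_eq_smul_one, sub_apply, CStarModule.inner_sub_right] at h2
  rw [← sub_nonneg]
  convert h2 using 2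
  · rw [← Complex.coe_smul, ← Complex.coe_smul, smul_apply, one_apply,
      CStarModule.inner_smul_right_complex]
  · rw [comp_apply, ← inner_left]

end Adj

end Positivity

/-! ### Compact operators: a two-sided ideal stable under adjoints -/

section Compact

variable {A : Type u} [NonUnitalCStarAlgebra A] [PartialOrder A]
variable {E : Type*} [NormedAddCommGroup E] [NormedSpace ℂ E] [SMul A E] [CStarModule A E]
variable {F : Type*} [NormedAddCommGroup F] [NormedSpace ℂ F] [SMul A F] [CStarModule A F]
variable {G : Type*} [NormedAddCommGroup G] [NormedSpace ℂ G] [SMul A G] [CStarModule A G]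

variable (A E F) in
/-- The closed span of the rank-one operators. -/
noncomputable def compactOperators : Submodule ℂ (E →L[ℂ] F) :=
  (Submodule.span ℂ {θ : E →L[ℂ] F | ∃ (x : F) (y : E), ∀ z, θ z = ⟪y, z⟫_A • x}).topologicalClosure

namespace Adj

namespace IsCompact

protected theorem zero : (0 : Adj A E F).IsCompact := (compactOperators A E F).zero_mem

theorem add {S T : Adj A E F} (hS : S.IsCompact) (hT : T.IsCompact) : (S + T).IsCompact :=
  (compactOperators A E F).add_mem hS hT

theorem sub {S T : Adj A E F} (hS : S.IsCompact) (hT : T.IsCompact) : (S - T).IsCompact :=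
  (compactOperators A E F).sub_mem hS hT

theorem of_subsingleton [Subsingleton E] (T : Adj A E F) : T.IsCompact := by
  have : T = 0 := by
    ext x
    rw [Subsingleton.elim x 0, map_zero, map_zero]
  exact this ▸ IsCompact.zero

theorem comp_left {T : Adj A E F} (hT : T.IsCompact) (S : Adj A F G) :
    (S.comp T).IsCompact := by
  let φ : (E →L[ℂ] F) →L[ℂ] (E →L[ℂ] G) :=
    ContinuousLinearMap.compL ℂ E F G S.toContinuousLinearMap
  refine (map_mem_closure φ.continuous hT fun θ hθ => ?_ :
    φ T.toContinuousLinearMap ∈ compactOperators A E G)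
  refine (Submodule.span_le (p := (Submodule.span ℂ _).comap φ.toLinearMap)).mpr ?_ hθ
  rintro θ ⟨x, y, h⟩
  refine Submodule.subset_span ⟨S x, y, fun z => ?_⟩
  change S (θ z) = _
  rw [h, S.map_op_smul]

theorem comp_right {T : Adj A F G} (hT : T.IsCompact) (S : Adj A E F) :
    (T.comp S).IsCompact := by
  let φ : (F →L[ℂ] G) →L[ℂ] (E →L[ℂ] G) :=
    (ContinuousLinearMap.compL ℂ E F G).flip S.toContinuousLinearMap
  refine (map_mem_closure φ.continuous hT fun θ hθ => ?_ :
    φ T.toContinuousLinearMap ∈ compactOperators A E G)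
  refine (Submodule.span_le (p := (Submodule.span ℂ _).comap φ.toLinearMap)).mpr ?_ hθ
  rintro θ ⟨x, y, h⟩
  refine Submodule.subset_span ⟨x, S.adj y, fun z => ?_⟩
  change θ (S z) = _
  rw [h, inner_right]

theorem mul_left {T : Adj A E E} (hT : T.IsCompact) (S : Adj A E E) : (S * T).IsCompact :=
  hT.comp_left S

theorem mul_right {T : Adj A E E} (hT : T.IsCompact) (S : Adj A E E) : (T * S).IsCompact :=
  hT.comp_right S

end IsCompact

/-- The rank-one operator `z ↦ ⟪y, z⟫ • x`, when it is bounded. -/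
theorem exists_of_mem_span {θ : E →L[ℂ] F}
    (hθ : θ ∈ Submodule.span ℂ {θ : E →L[ℂ] F | ∃ (x : F) (y : E), ∀ z, θ z = ⟪y, z⟫_A • x})
    [StarOrderedRing A] :
    ∃ T : Adj A E F, T.toContinuousLinearMap = θ ∧ T.adj.toContinuousLinearMap ∈
      Submodule.span ℂ {θ : F →L[ℂ] E | ∃ (x : E) (y : F), ∀ z, θ z = ⟪y, z⟫_A • x} := by
  induction hθ using Submodule.span_induction with
  | mem θ h =>
    obtain ⟨x, y, h⟩ := h
    -- The flipped rank-one operator is the candidate adjoint; Cauchy–Schwarz for the A-valued inner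
    -- product makes it bounded.
    have hle : ∀ w : F, ‖⟪x, w⟫_A • y‖ ≤ (‖x‖ * ‖y‖) * ‖w‖ := fun w => by
      refine abs_le_of_sq_le_sq' ?_ (by positivity) |>.2
      rw [CStarModule.norm_sq_eq A]
      simp only [CStarModule.inner_op_smul_left, CStarModule.inner_op_smul_right]
      rw [← mul_assoc]
      calc _ ≤ ‖⟪x, w⟫_A‖ * ‖⟪y, y⟫_A‖ * ‖star ⟪x, w⟫_A‖ := by
            refine (norm_mul_le (⟪x, w⟫_A * ⟪y, y⟫_A) (star ⟪x, w⟫_A)).trans ?_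
            gcongr
            exact norm_mul_le ⟪x, w⟫_A ⟪y, y⟫_A
        _ ≤ (‖x‖ * ‖w‖) * (‖y‖ * ‖y‖) * (‖x‖ * ‖w‖) := by
            rw [norm_star]
            gcongr
            · exact CStarModule.norm_inner_le F
            · exact CStarModule.norm_inner_le E
            · exact CStarModule.norm_inner_le F
        _ = _ := by ring
    let φ : F →L[ℂ] E := LinearMap.mkContinuous
      { toFun := fun w => ⟪x, w⟫_A • y
        map_add' := fun w w' => ext_inner A fun z => by simp [add_mul]
        map_smul' := fun c w => ext_inner A fun z => by simp [smul_mul_assoc] } (‖x‖ * ‖y‖) hle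
    have hφ : ∀ w, φ w = ⟪x, w⟫_A • y := fun w => rfl
    have had : ∀ z w, ⟪θ z, w⟫_A = ⟪z, φ w⟫_A := fun z w => by
      rw [h, hφ]
      simp
    let T : Adj A E F := ⟨θ, φ, had⟩
    refine ⟨T, rfl, Submodule.subset_span ⟨y, x, fun z => ?_⟩⟩
    rw [← hφ]
    exact ext_inner A fun z' => by rw [← had, ← inner_left]
  | zero => exact ⟨0, rfl, by rw [adj_zero]; exact Submodule.zero_mem _⟩
  | add θ θ' _ _ h h' =>
    obtain ⟨T, rfl, hT⟩ := h
    obtain ⟨T', rfl, hT'⟩ := h'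
    exact ⟨T + T', rfl, by rw [adj_add]; exact Submodule.add_mem _ hT hT'⟩
  | smul c θ _ h =>
    obtain ⟨T, rfl, hT⟩ := h
    exact ⟨c • T, rfl, by rw [adj_smul]; exact Submodule.smul_mem _ _ hT⟩

/-- The closure is taken among all bounded operators, so an approximant must first be recognised as
adjointable, with adjoint again in the span; then the adjoint is isometric. -/
theorem IsCompact.adj [StarOrderedRing A] {T : Adj A E F} (hT : T.IsCompact) :
    T.adj.IsCompact := by
  refine Metric.mem_closure_iff.mpr fun ε hε => ?_
  obtain ⟨θ, hθ, h⟩ := Metric.mem_closure_iff.mp hT ε hε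
  obtain ⟨S, rfl, hS⟩ := exists_of_mem_span hθ
  refine ⟨_, hS, ?_⟩
  rw [dist_eq_norm, ← toCLM_sub] at h ⊢
  rwa [← adj_sub, norm_adj]

end Adj

end Compact

/-! ### Extending bounded linear relations by continuity -/

section Extension

variable {X : Type*} [NormedAddCommGroup X] [NormedSpace ℂ X]
variable {Y : Type*} [NormedAddCommGroup Y] [NormedSpace ℂ Y]

/-- A bounded, densely defined linear relation extends to an everywhere defined one. -/
theorem exists_mem_closure_of_bound [CompleteSpace Y] (S : Submodule ℂ (X × Y)) (C : ℝ)
    (hb : ∀ p ∈ S, ‖p.2‖ ≤ C * ‖p.1‖) (hd : Dense {x | ∃ y, (x, y) ∈ S}) (x : X) :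
    ∃ y, (x, y) ∈ closure (S : Set (X × Y)) := by
  obtain ⟨f, hf, hfx⟩ := mem_closure_iff_seq_limit.mp (hd x)
  choose g hg using hf
  -- Nothing is assumed about the sign of `C`, and a positive divisor is needed for the Cauchy
  -- estimate.
  have hC : 0 < |C| + 1 := by positivity
  have hc : CauchySeq g := by
    have h1 := hfx.cauchySeq
    rw [Metric.cauchySeq_iff'] at h1 ⊢
    intro ε hε
    obtain ⟨n, hn⟩ := h1 (ε / (|C| + 1)) (by positivity)
    refine ⟨n, fun m hm => ?_⟩
    have h2 := hb _ (S.sub_mem (hg m) (hg n))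
    have h3 := hn m hm
    rw [dist_eq_norm] at h3 ⊢
    rw [lt_div_iff₀ hC] at h3
    refine lt_of_le_of_lt h2 (lt_of_le_of_lt ?_ h3)
    change C * ‖f m - f n‖ ≤ _
    nlinarith [le_abs_self C, norm_nonneg (f m - f n)]
  obtain ⟨y, hy⟩ := cauchySeq_tendsto_of_complete hc
  exact ⟨y, mem_closure_of_tendsto (hfx.prodMk_nhds hy) (Filter.Eventually.of_forall hg)⟩

/-- A bounded, everywhere defined linear relation is a bounded operator. -/
theorem exists_clm_of_bound (S : Submodule ℂ (X × Y)) (C : ℝ)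
    (hb : ∀ p ∈ S, ‖p.2‖ ≤ C * ‖p.1‖) (h : ∀ x, ∃ y, (x, y) ∈ S) :
    ∃ f : X →L[ℂ] Y, ∀ x, (x, f x) ∈ S := by
  choose f hf using h
  have huniq : ∀ x y z, (x, y) ∈ S → (x, z) ∈ S → y = z := fun x y z hy hz => by
    have := hb _ (S.sub_mem hy hz)
    simp only [Prod.mk_sub_mk, sub_self, norm_zero, mul_zero, norm_le_zero_iff] at this
    exact sub_eq_zero.mp this
  exact ⟨LinearMap.mkContinuous
    { toFun := f
      map_add' := fun x y => huniq _ _ _ (hf _) (S.add_mem (hf x) (hf y))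
      map_smul' := fun c x => huniq _ _ _ (hf _) (S.smul_mem c (hf x)) } C fun x => hb _ (hf x), hf⟩

end Extension

/-! ### Formally adjoint relations and their resolvents -/

section Relations

variable {A : Type u} [NonUnitalCStarAlgebra A] [PartialOrder A]
variable {E : Type*} [NormedAddCommGroup E] [NormedSpace ℂ E] [SMul A E] [CStarModule A E]
variable {F : Type*} [NormedAddCommGroup F] [NormedSpace ℂ F] [SMul A F] [CStarModule A F]

theorem norm_le_of_inner_le [StarOrderedRing A] {x : E} {y : F} (h : ⟪x, x⟫_A ≤ ⟪y, y⟫_A) :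
    ‖x‖ ≤ ‖y‖ := by
  refine abs_le_of_sq_le_sq' ?_ (norm_nonneg y) |>.2
  rw [CStarModule.norm_sq_eq A, CStarModule.norm_sq_eq A]
  exact CStarAlgebra.norm_le_norm_of_nonneg_of_le CStarModule.inner_self_nonneg h

variable (A) in
/-- Two linear relations are formally adjoint if `⟪y, a⟫ = ⟪x, b⟫` for all `(x, y)` in the first
and `(a, b)` in the second. -/
def FormallyAdjoint (D : Submodule ℂ (E × F)) (D' : Submodule ℂ (F × E)) : Prop :=
  ∀ x y, (x, y) ∈ D → ∀ a b, (a, b) ∈ D' → ⟪y, a⟫_A = ⟪x, b⟫_A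

theorem FormallyAdjoint.symm {D : Submodule ℂ (E × F)} {D' : Submodule ℂ (F × E)}
    (h : FormallyAdjoint A D D') : FormallyAdjoint A D' D := fun x y hx a b ha => by
  rw [← CStarModule.star_inner, ← h a b ha x y hx, CStarModule.star_inner]

/-- The triples `(x, (a, b))` with `(a, b) ∈ D` and `(b, x - a) ∈ D'`, that is, with
`x = (1 + D' D) a` and `b = D a`. -/
def solutions (D : Submodule ℂ (E × F)) (D' : Submodule ℂ (F × E)) :
    Submodule ℂ (E × (E × F)) where
  carrier := {p | p.2 ∈ D ∧ (p.2.2, p.1 - p.2.1) ∈ D'}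
  add_mem' {p q} hp hq := ⟨D.add_mem hp.1 hq.1, by
    have := D'.add_mem hp.2 hq.2
    rwa [Prod.mk_add_mk, sub_add_sub_comm] at this⟩
  zero_mem' := ⟨D.zero_mem, by
    simp only [Prod.snd_zero, Prod.fst_zero, sub_zero]
    exact D'.zero_mem⟩
  smul_mem' c p hp := ⟨D.smul_mem c hp.1, by
    have := D'.smul_mem c hp.2
    rwa [Prod.smul_mk, smul_sub] at this⟩

theorem isClosed_solutions {D : Submodule ℂ (E × F)} {D' : Submodule ℂ (F × E)}
    (hD : IsClosed (D : Set (E × F))) (hD' : IsClosed (D' : Set (F × E))) :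
    IsClosed (solutions D D' : Set (E × (E × F))) :=
  (hD.preimage continuous_snd).inter (hD'.preimage (f := fun p : E × (E × F) =>
    (p.2.2, p.1 - p.2.1)) (by fun_prop))

/-- Expand x = a + (x - a): formal adjointness turns each cross term ⟪a, x - a⟫ and ⟪x - a, a⟫ into
⟪b, b⟫. -/
theorem FormallyAdjoint.inner_self {D : Submodule ℂ (E × F)} {D' : Submodule ℂ (F × E)}
    (h : FormallyAdjoint A D D') {x a : E} {b : F} (hp : (x, (a, b)) ∈ solutions D D') :
    ⟪x, x⟫_A = ⟪a, a⟫_A + ⟪b, b⟫_A + (⟪b, b⟫_A + ⟪x - a, x - a⟫_A) := by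
  have h1 := h _ _ hp.1 _ _ hp.2
  have h2 := h.symm _ _ hp.2 _ _ hp.1
  simp only [CStarModule.inner_sub_right, CStarModule.inner_sub_left] at h1 h2 ⊢
  have h3 : ⟪x, a⟫_A = ⟪a, a⟫_A + ⟪b, b⟫_A := by rw [← h2]; abel
  have h4 : ⟪a, x⟫_A = ⟪a, a⟫_A + ⟪b, b⟫_A := by rw [h1]; abel
  rw [h3, h4]
  abel

/-- Solving x = (1 + D' D) a is contractive, both for a and for D a. This gives uniqueness of
solutions and lets them pass to limits. -/
theorem FormallyAdjoint.norm_le [StarOrderedRing A] {D : Submodule ℂ (E × F)}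
    {D' : Submodule ℂ (F × E)} (h : FormallyAdjoint A D D') (p : E × (E × F))
    (hp : p ∈ solutions D D') : ‖p.2‖ ≤ 1 * ‖p.1‖ := by
  obtain ⟨x, a, b⟩ := p
  have h1 := h.inner_self hp
  have ha : (0 : A) ≤ ⟪a, a⟫_A := CStarModule.inner_self_nonneg
  have hb : (0 : A) ≤ ⟪b, b⟫_A := CStarModule.inner_self_nonneg
  have hx : (0 : A) ≤ ⟪x - a, x - a⟫_A := CStarModule.inner_self_nonneg
  rw [one_mul]
  refine max_le (norm_le_of_inner_le (A := A) ?_) (norm_le_of_inner_le (A := A) ?_)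
  · rw [h1, add_assoc]
    exact le_add_of_nonneg_right (by positivity)
  · rw [h1, add_comm ⟪a, a⟫_A, add_assoc]
    exact le_add_of_nonneg_right (by positivity)

/-- `R = (1 + D' D)⁻¹`, `B = D R` and `R' = (1 + D D')⁻¹`, for formally adjoint relations `D`
and `D'`. -/
structure IsResolvent (D : Submodule ℂ (E × F)) (D' : Submodule ℂ (F × E)) (R : Adj A E E)
    (B : Adj A E F) (R' : Adj A F F) : Prop where
  formallyAdjoint : FormallyAdjoint A D D'
  mem (x : E) : (R x, B x) ∈ D
  mem_adj (x : E) : (B x, x - R x) ∈ D'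
  adj_mem_adj (y : F) : (R' y, B.adj y) ∈ D'
  adj_mem (y : F) : (B.adj y, y - R' y) ∈ D

/-- If `1 + D' D` and `1 + D D'` are surjective, then the resolvents exist. -/
theorem FormallyAdjoint.exists_isResolvent [StarOrderedRing A] {D : Submodule ℂ (E × F)}
    {D' : Submodule ℂ (F × E)} (h : FormallyAdjoint A D D')
    (h1 : ∀ x, ∃ y, (x, y) ∈ solutions D D') (h2 : ∀ x, ∃ y, (x, y) ∈ solutions D' D) :
    ∃ (R : Adj A E E) (B : Adj A E F) (R' : Adj A F F), IsResolvent D D' R B R' := by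
  obtain ⟨f, hf⟩ := exists_clm_of_bound _ 1 h.norm_le h1
  obtain ⟨g, hg⟩ := exists_clm_of_bound _ 1 h.symm.norm_le h2
  -- Write f = (R, B). Evaluating ⟪B x, B y⟫ by moving D to either side gives ⟪R x, y - R y⟫ = ⟪x -
  -- R x, R y⟫, whence R is symmetric.
  have self : ∀ x y, ⟪(f x).1, y⟫_A = ⟪x, (f y).1⟫_A := fun x y => by
    have a1 : ⟪(f x).2, (f y).2⟫_A = ⟪(f x).1, y - (f y).1⟫_A := h _ _ (hf x).1 _ _ (hf y).2
    have a2 : ⟪x - (f x).1, (f y).1⟫_A = ⟪(f x).2, (f y).2⟫_A :=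
      h.symm _ _ (hf x).2 _ _ (hf y).1
    rw [CStarModule.inner_sub_right] at a1
    rw [CStarModule.inner_sub_left] at a2
    exact sub_left_injective (a2.trans a1).symm
  have self' : ∀ x y, ⟪(g x).1, y⟫_A = ⟪x, (g y).1⟫_A := fun x y => by
    have a1 : ⟪(g x).2, (g y).2⟫_A = ⟪(g x).1, y - (g y).1⟫_A :=
      h.symm _ _ (hg x).1 _ _ (hg y).2
    have a2 : ⟪x - (g x).1, (g y).1⟫_A = ⟪(g x).2, (g y).2⟫_A := h _ _ (hg x).2 _ _ (hg y).1
    rw [CStarModule.inner_sub_right] at a1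
    rw [CStarModule.inner_sub_left] at a2
    exact sub_left_injective (a2.trans a1).symm
  have mixed : ∀ x y, ⟪(f x).2, y⟫_A = ⟪x, (g y).2⟫_A := fun x y => by
    have a1 : ⟪(f x).2, (g y).1⟫_A = ⟪(f x).1, (g y).2⟫_A := h _ _ (hf x).1 _ _ (hg y).1
    have a2 : ⟪x - (f x).1, (g y).2⟫_A = ⟪(f x).2, y - (g y).1⟫_A :=
      h.symm _ _ (hf x).2 _ _ (hg y).2
    rw [CStarModule.inner_sub_left, CStarModule.inner_sub_right, ← a1] at a2
    exact (sub_left_injective a2).symm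
  let R : Adj A E E := ⟨(ContinuousLinearMap.fst ℂ E F).comp f,
    (ContinuousLinearMap.fst ℂ E F).comp f, self⟩
  let R' : Adj A F F := ⟨(ContinuousLinearMap.fst ℂ F E).comp g,
    (ContinuousLinearMap.fst ℂ F E).comp g, self'⟩
  let B : Adj A E F := ⟨(ContinuousLinearMap.snd ℂ E F).comp f,
    (ContinuousLinearMap.snd ℂ F E).comp g, mixed⟩
  have hB : ∀ y, B.adj y = (g y).2 := fun y =>
    ext_inner A fun x => by rw [← mixed, ← Adj.inner_left]; rfl
  exact ⟨R, B, R', h, fun x => (hf x).1, fun x => (hf x).2,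
    fun y => by rw [hB]; exact (hg y).1, fun y => by rw [hB]; exact (hg y).2⟩

namespace IsResolvent

variable {D : Submodule ℂ (E × F)} {D' : Submodule ℂ (F × E)} {R : Adj A E E} {B : Adj A E F}
  {R' : Adj A F F}

protected theorem symm (h : IsResolvent D D' R B R') : IsResolvent D' D R' B.adj R :=
  ⟨h.1.symm, h.4, h.5, fun x => by simpa using h.2 x, fun x => by simpa using h.3 x⟩

theorem mem_solutions (h : IsResolvent D D' R B R') (x : E) :
    (x, (R x, B x)) ∈ solutions D D' := ⟨h.mem x, h.mem_adj x⟩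

theorem eq_of_mem [StarOrderedRing A] (h : IsResolvent D D' R B R') {x a : E} {b : F}
    (hab : (a, b) ∈ D) (hb : (b, x - a) ∈ D') : R x = a ∧ B x = b := by
  have h1 : (x, (a, b)) ∈ solutions D D' := ⟨hab, hb⟩
  have := h.formallyAdjoint.norm_le _ ((solutions D D').sub_mem (h.mem_solutions x) h1)
  simp only [Prod.mk_sub_mk, sub_self, norm_zero, mul_zero, norm_le_zero_iff, Prod.mk_eq_zero,
    sub_eq_zero] at this
  exact this

theorem adj_eq (h : IsResolvent D D' R B R') : R.adj = R := by
  refine (Adj.eq_adj fun x y => ?_).symm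
  have a1 := h.1 _ _ (h.2 x) _ _ (h.3 y)
  have a2 := h.1.symm _ _ (h.3 x) _ _ (h.2 y)
  rw [CStarModule.inner_sub_right] at a1
  rw [CStarModule.inner_sub_left] at a2
  exact sub_left_injective (a2.trans a1).symm

theorem inner_apply (h : IsResolvent D D' R B R') (x y : E) : ⟪R x, y⟫_A = ⟪x, R y⟫_A := by
  rw [Adj.inner_left, h.adj_eq]

/-- In operator terms B* D = 1 - R on dom D: the identity that later factors 1 - R through the
differential. -/
theorem adj_apply (h : IsResolvent D D' R B R') {x : E} {y : F} (hx : (x, y) ∈ D) :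
    B.adj y = x - R x :=
  ext_inner_left A fun m => by
    rw [← Adj.inner_right, h.1 _ _ hx _ _ (h.3 m), CStarModule.inner_sub_left,
      CStarModule.inner_sub_right, h.inner_apply]

/-- B* is the bounded extension of R D'. -/
theorem apply_eq (h : IsResolvent D D' R B R') {y : F} {z : E} (hy : (y, z) ∈ D') :
    B.adj y = R z :=
  ext_inner_left A fun m => by
    rw [← Adj.inner_right, h.inner_apply, h.1.symm _ _ hy _ _ (h.2 m)]

theorem inner_mul (h : IsResolvent D D' R B R') (x y : E) :
    ⟪B x, B y⟫_A = ⟪x, R (y - R y)⟫_A := by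
  rw [h.1 _ _ (h.2 x) _ _ (h.3 y), h.inner_apply]

theorem inner_apply_self_nonneg [StarOrderedRing A] (h : IsResolvent D D' R B R') (x : E) :
    0 ≤ ⟪x, R x⟫_A := by
  have h1 := h.inner_mul x x
  rw [map_sub, CStarModule.inner_sub_right, ← h.inner_apply x (R x), eq_sub_iff_add_eq] at h1
  rw [← h1]
  exact add_nonneg CStarModule.inner_self_nonneg CStarModule.inner_self_nonneg

/-- On the kernel of `D` the resolvent is the identity. -/
theorem apply_of_mem_ker [StarOrderedRing A] (h : IsResolvent D D' R B R') {x : E}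
    (hx : (x, (0 : F)) ∈ D) : R x = x :=
  (h.eq_of_mem hx (by rw [sub_self]; exact D'.zero_mem)).1

/-- A relation having resolvents contains every pair that is formally adjoint to `D'`. -/
theorem mem_of_formallyAdjoint (h : IsResolvent D D' R B R') {x : E} {y : F}
    (hxy : ∀ a b, (a, b) ∈ D' → ⟪y, a⟫_A = ⟪x, b⟫_A) [StarOrderedRing A] : (x, y) ∈ D := by
  -- Orthogonal decomposition of E × F along D and the rotated D': the first pair is the component
  -- of (x, y) in D, and the second pair is, up to rotation, the remainder. The hypothesis makes the
  -- remainder orthogonal to itself.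
  have h1 := D.add_mem (h.mem x) (h.adj_mem y)
  have h2 := D'.sub_mem (h.adj_mem_adj y) (h.mem_adj x)
  simp only [Prod.mk_add_mk, Prod.mk_sub_mk] at h1 h2
  have h3 := hxy _ _ h2
  have h4 := h.1 _ _ h1 _ _ h2
  have h5 : ⟪R' y - B x, R' y - B x⟫_A
      = -⟪x - (R x + B.adj y), x - (R x + B.adj y)⟫_A := by
    have e1 : R' y - B x = y - (B x + (y - R' y)) := by abel
    have e2 : x - (R x + B.adj y) = -(B.adj y - (x - R x)) := by abel
    conv_lhs => rw [e1, CStarModule.inner_sub_left]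
    rw [← e1, h3, h4, e2, CStarModule.inner_neg_right, neg_neg, ← e2,
      CStarModule.inner_sub_left]
  have h6 : ⟪R' y - B x, R' y - B x⟫_A = 0 :=
    le_antisymm (h5.trans_le (neg_nonpos.mpr CStarModule.inner_self_nonneg))
      CStarModule.inner_self_nonneg
  have h7 : ⟪x - (R x + B.adj y), x - (R x + B.adj y)⟫_A = 0 := by
    rw [h6, zero_eq_neg] at h5
    exact h5
  rw [CStarModule.inner_self, sub_eq_zero] at h6 h7
  have e : (x, y) = (R x + B.adj y, B x + (y - R' y)) := by
    rw [← h7, h6]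
    simp
  rw [e]
  exact h1

theorem isClosed [StarOrderedRing A] (h : IsResolvent D D' R B R') :
    IsClosed (D : Set (E × F)) := by
  have : (D : Set (E × F)) = ⋂ p ∈ D', {q | ⟪q.2, p.1⟫_A = ⟪q.1, p.2⟫_A} := by
    ext ⟨x, y⟩
    simp only [SetLike.mem_coe, Set.mem_iInter, Set.mem_ofPred_eq, Prod.forall]
    exact ⟨fun hxy a b hab => h.1 _ _ hxy _ _ hab, fun hxy => h.mem_of_formallyAdjoint hxy⟩
  rw [this]
  refine isClosed_biInter fun p _ => isClosed_eq ?_ ?_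
  · exact (CStarModule.continuous_inner (A := A)).comp (by fun_prop :
      Continuous fun q : E × F => (q.2, p.1))
  · exact (CStarModule.continuous_inner (A := A)).comp (by fun_prop :
      Continuous fun q : E × F => (q.1, p.2))

/-- The domain of `D' D` is dense. -/
theorem denseRange (h : IsResolvent D D' R B R') (hD : Dense {x | ∃ y, (x, y) ∈ D})
    (hD' : Dense {x | ∃ y, (x, y) ∈ D'}) : DenseRange R := by
  have hR : (LinearMap.range R.toLinearMap).topologicalClosure = ⊤ := by
    rw [← Submodule.dense_iff_topologicalClosure_eq_top]
    refine dense_closure.mp (hD.mono ?_)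
    rintro x ⟨y, hxy⟩
    -- For (x, y) in D, x = B* y + R x; approximating y from dom D', where B* = R D', puts B* y in
    -- the closure of ran R.
    have hy : B.adj y ∈ (LinearMap.range R.toLinearMap).topologicalClosure := by
      refine map_mem_closure B.adj.continuous (hD' y) ?_
      rintro y ⟨z, hz⟩
      exact ⟨z, (h.apply_eq hz).symm⟩
    have := Submodule.add_mem _ hy (Submodule.le_topologicalClosure _ ⟨x, rfl⟩)
    rw [h.adj_apply hxy] at this
    change x - R x + R x ∈ _ at this
    rwa [sub_add_cancel] at this
  exact (Submodule.dense_iff_topologicalClosure_eq_top.mpr hR)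

end IsResolvent

end Relations

/-! ### Regular operators and their resolvents -/

section Regular

set_option linter.unusedSectionVars false

variable {A : Type u} [NonUnitalCStarAlgebra A] [PartialOrder A]
variable {E : Type*} [NormedAddCommGroup E] [NormedSpace ℂ E] [SMul A E] [CStarModule A E]
variable {F : Type*} [NormedAddCommGroup F] [NormedSpace ℂ F] [SMul A F] [CStarModule A F]
variable {G : Type*} [NormedAddCommGroup G] [NormedSpace ℂ G] [SMul A G] [CStarModule A G]

namespace UOp

/-- The graph of an operator. -/
def gr (t : UOp A E F) : Submodule ℂ (E × F) := t.toLinearPMap.graph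

theorem mem_gr {t : UOp A E F} {x : E} {y : F} :
    (x, y) ∈ t.gr ↔ ∃ h : x ∈ t.domain, t ⟨x, h⟩ = y := by
  rw [gr, LinearPMap.mem_graph_iff]
  constructor
  · rintro ⟨⟨z, hz⟩, rfl, h⟩
    exact ⟨hz, h⟩
  · rintro ⟨h, h'⟩
    exact ⟨⟨x, h⟩, rfl, h'⟩

theorem apply_mem_gr (t : UOp A E F) (x : t.domain) : ((x : E), t x) ∈ t.gr :=
  mem_gr.mpr ⟨x.2, rfl⟩

theorem mem_domain_iff {t : UOp A E F} {x : E} : x ∈ t.domain ↔ ∃ y, (x, y) ∈ t.gr :=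
  ⟨fun h => ⟨_, t.apply_mem_gr ⟨x, h⟩⟩, fun ⟨_, h⟩ => (mem_gr.mp h).1⟩

theorem coe_domain (t : UOp A E F) : (t.domain : Set E) = {x | ∃ y, (x, y) ∈ t.gr} :=
  Set.ext fun _ => mem_domain_iff

theorem gr_unique {t : UOp A E F} {x : E} {y z : F} (hy : (x, y) ∈ t.gr) (hz : (x, z) ∈ t.gr) :
    y = z := by
  obtain ⟨_, rfl⟩ := mem_gr.mp hy
  obtain ⟨_, rfl⟩ := mem_gr.mp hz
  rfl

theorem ext_gr {s t : UOp A E F} (h : s.gr = t.gr) : s = t := by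
  have := LinearPMap.eq_of_eq_graph h
  cases s
  cases t
  congr

theorem mem_gr_comp {s : UOp A F G} {t : UOp A E F} {x : E} {z : G} :
    (x, z) ∈ (s.comp t).gr ↔ ∃ y, (x, y) ∈ t.gr ∧ (y, z) ∈ s.gr := by
  simp only [mem_gr]
  constructor
  · rintro ⟨⟨h1, h2⟩, h3⟩
    exact ⟨_, ⟨h1, rfl⟩, h2, h3⟩
  · rintro ⟨_, ⟨h1, rfl⟩, h2, h3⟩
    exact ⟨⟨h1, h2⟩, h3⟩

theorem mem_gr_add {s t : UOp A E F} {x : E} {z : F} :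
    (x, z) ∈ (s.add t).gr ↔ ∃ y y', (x, y) ∈ s.gr ∧ (x, y') ∈ t.gr ∧ y + y' = z := by
  simp only [mem_gr]
  constructor
  · rintro ⟨⟨h1, h2⟩, h3⟩
    exact ⟨_, _, ⟨h1, rfl⟩, ⟨h2, rfl⟩, h3⟩
  · rintro ⟨_, _, ⟨h1, rfl⟩, ⟨h2, rfl⟩, h3⟩
    exact ⟨⟨h1, h2⟩, h3⟩

theorem mem_gr_toUOp {T : Adj A E F} {x : E} {y : F} : (x, y) ∈ T.toUOp.gr ↔ T x = y :=
  mem_gr.trans ⟨fun ⟨_, h⟩ => h, fun h => ⟨trivial, h⟩⟩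

/-- Density of the domain makes the adjoint relation single-valued, so the default value 0 in
`UOp.adjoint` never intervenes. -/
theorem mem_gr_adjoint [StarOrderedRing A] {t : UOp A E F} (ht : Dense (t.domain : Set E))
    {y : F} {z : E} :
    (y, z) ∈ t.adjoint.gr ↔ ∀ x w, (x, w) ∈ t.gr → ⟪w, y⟫_A = ⟪x, z⟫_A := by
  have h0 : ∀ p ∈ t.adjointGraph, p.1 = 0 → p.2 = 0 := by
    rintro ⟨y, z⟩ hp (rfl : y = 0)
    have h1 : ∀ x ∈ t.domain, ⟪x, z⟫_A = 0 := fun x hx => by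
      simpa using (hp ⟨x, hx⟩).symm
    have h2 : ∀ x, ⟪x, z⟫_A = 0 := fun x => by
      refine (isClosed_eq ?_ continuous_const).closure_subset_iff.mpr h1 (ht x)
      exact (CStarModule.continuous_inner (A := A)).comp (by fun_prop :
        Continuous fun x : E => (x, z))
    exact CStarModule.inner_self.mp (h2 z)
  have h1 : t.adjoint.gr = t.adjointGraph := Submodule.toLinearPMap_graph_eq _ h0
  rw [h1]
  constructor
  · intro h x w hx
    obtain ⟨hx', rfl⟩ := mem_gr.mp hx
    exact h ⟨x, hx'⟩
  · exact fun h x => h _ _ (t.apply_mem_gr x)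

theorem formallyAdjoint [StarOrderedRing A] {t : UOp A E F} (ht : Dense (t.domain : Set E)) :
    FormallyAdjoint A t.gr t.adjoint.gr :=
  fun x y hx _ _ ha => (mem_gr_adjoint ht).mp ha x y hx

theorem isClosed_gr_adjoint [StarOrderedRing A] {t : UOp A E F}
    (ht : Dense (t.domain : Set E)) : IsClosed (t.adjoint.gr : Set (F × E)) := by
  have : (t.adjoint.gr : Set (F × E)) = ⋂ p ∈ t.gr, {q | ⟪p.2, q.1⟫_A = ⟪p.1, q.2⟫_A} := by
    ext ⟨x, y⟩
    simp only [SetLike.mem_coe, Set.mem_iInter, Set.mem_ofPred_eq, Prod.forall]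
    exact mem_gr_adjoint ht
  rw [this]
  refine isClosed_biInter fun p _ => isClosed_eq ?_ ?_
  · exact (CStarModule.continuous_inner (A := A)).comp (by fun_prop :
      Continuous fun q : F × E => (p.2, q.1))
  · exact (CStarModule.continuous_inner (A := A)).comp (by fun_prop :
      Continuous fun q : F × E => (p.1, q.2))

end UOp

variable [StarOrderedRing A]

/-- An operator with resolvents, relative to some relation with dense domain, is regular, and the
relation is its adjoint. -/
theorem IsResolvent.isRegular {t : UOp A E F} {D' : Submodule ℂ (F × E)} {R : Adj A E E}
    {B : Adj A E F} {R' : Adj A F F} (h : IsResolvent t.gr D' R B R')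
    (ht : Dense (t.domain : Set E)) (hD' : Dense {x | ∃ y, (x, y) ∈ D'}) :
    t.IsRegular ∧ t.adjoint.gr = D' := by
  -- A relation with resolvents is maximal among those formally adjoint to its partner, so D' is
  -- already the whole adjoint.
  have hle : D' = t.adjoint.gr := by
    ext ⟨y, z⟩
    rw [UOp.mem_gr_adjoint ht]
    refine ⟨fun hy x w hx => h.1 _ _ hx _ _ hy, fun hy => ?_⟩
    refine h.symm.mem_of_formallyAdjoint fun a b hab => ?_
    rw [← CStarModule.star_inner, ← hy a b hab, CStarModule.star_inner]
  subst hle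
  refine ⟨⟨ht, by rwa [UOp.coe_domain], h.isClosed, ?_⟩, rfl⟩
  refine Function.Surjective.denseRange fun x => ?_
  have h1 : (R x, x - R x) ∈ (t.adjoint.comp t).gr :=
    UOp.mem_gr_comp.mpr ⟨_, h.mem x, h.mem_adj x⟩
  obtain ⟨h2, h3⟩ := UOp.mem_gr.mp h1
  exact ⟨⟨R x, h2⟩, by rw [h3]; exact add_sub_cancel _ _⟩

namespace UOp

open Classical in
/-- The resolvent `(1 + t* t)⁻¹` of a regular operator. -/
noncomputable def res (t : UOp A E F) : Adj A E E :=
  if h : ∃ (R : Adj A E E) (B : Adj A E F) (R' : Adj A F F),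
    IsResolvent t.gr t.adjoint.gr R B R' then h.choose else 0

open Classical in
/-- The bounded operator `t (1 + t* t)⁻¹`, for a regular operator `t`. -/
noncomputable def tres (t : UOp A E F) : Adj A E F :=
  if h : ∃ (R : Adj A E E) (B : Adj A E F) (R' : Adj A F F),
    IsResolvent t.gr t.adjoint.gr R B R' then h.choose_spec.choose else 0

namespace IsRegular

variable {t : UOp A E F} [CompleteSpace E] [CompleteSpace F]

theorem exists_isResolvent (ht : t.IsRegular) :
    ∃ (R : Adj A E E) (B : Adj A E F) (R' : Adj A F F),
      IsResolvent t.gr t.adjoint.gr R B R' := by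
  have hf := formallyAdjoint ht.dense_domain
  have hc := isClosed_gr_adjoint ht.dense_domain
  have h1 : ∀ x, ∃ y, (x, y) ∈ solutions t.gr t.adjoint.gr := fun x => by
    -- Dense range, contractivity and closed graphs together make 1 + t* t surjective.
    have hd : Dense {x | ∃ y, (x, y) ∈ solutions t.gr t.adjoint.gr} := ht.dense_range.mono (by
      rintro _ ⟨⟨x, hx⟩, rfl⟩
      obtain ⟨w, h1, h2⟩ := mem_gr_comp.mp ((t.adjoint.comp t).apply_mem_gr ⟨x, hx⟩)
      refine ⟨(x, w), h1, ?_⟩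
      dsimp only
      rwa [add_sub_cancel_left])
    obtain ⟨y, hy⟩ := exists_mem_closure_of_bound _ 1 hf.norm_le hd x
    exact ⟨y, (isClosed_solutions ht.closed hc).closure_subset hy⟩
  refine hf.exists_isResolvent h1 fun y => ?_
  have hd : Dense {x | ∃ y, (x, y) ∈ solutions t.adjoint.gr t.gr} :=
    ht.dense_adjoint_domain.mono (by
      intro y hy
      obtain ⟨z, hyz⟩ := mem_domain_iff.mp hy
      obtain ⟨⟨a, b⟩, h2, h3⟩ := h1 z
      -- If (1 + t* t) a = t* y and b = t a, then t*(y - b) = a, so (1 + t t*)(y - b) = y. Thus 1 +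
      -- t t* hits the dense set dom t*.
      refine ⟨(y - b, a), ?_, ?_⟩
      · have := t.adjoint.gr.sub_mem hyz h3
        simpa using this
      · simpa using h2)
  obtain ⟨z, hz⟩ := exists_mem_closure_of_bound _ 1 hf.symm.norm_le hd y
  exact ⟨z, (isClosed_solutions hc ht.closed).closure_subset hz⟩

theorem adjoint_adjoint_gr (ht : t.IsRegular) : t.adjoint.adjoint.gr = t.gr := by
  obtain ⟨R, B, R', h⟩ := ht.exists_isResolvent
  exact (h.symm.isRegular ht.dense_adjoint_domain (t.coe_domain ▸ ht.dense_domain)).2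

theorem adjoint_adjoint (ht : t.IsRegular) : t.adjoint.adjoint = t :=
  ext_gr ht.adjoint_adjoint_gr

/-- The adjoint of a regular operator is regular. -/
theorem adjoint (ht : t.IsRegular) : t.adjoint.IsRegular := by
  obtain ⟨R, B, R', h⟩ := ht.exists_isResolvent
  exact (h.symm.isRegular ht.dense_adjoint_domain (t.coe_domain ▸ ht.dense_domain)).1

/-- Resolvents are unique, so the choice made in `res` and `tres` is harmless. -/
theorem res_eq (ht : t.IsRegular) {R : Adj A E E} {B : Adj A E F} {R' : Adj A F F}
    (h : IsResolvent t.gr t.adjoint.gr R B R') : t.res = R ∧ t.tres = B := by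
  have h1 := ht.exists_isResolvent
  rw [res, dif_pos h1, tres, dif_pos h1]
  have h2 := h1.choose_spec.choose_spec.choose_spec
  exact ⟨Adj.ext fun x => (h2.eq_of_mem (h.mem x) (h.mem_adj x)).1,
    Adj.ext fun x => (h2.eq_of_mem (h.mem x) (h.mem_adj x)).2⟩

theorem isResolvent (ht : t.IsRegular) :
    IsResolvent t.gr t.adjoint.gr t.res t.tres t.adjoint.res := by
  obtain ⟨R, B, R', h⟩ := ht.exists_isResolvent
  have h' := h.symm
  rw [← ht.adjoint_adjoint_gr] at h'
  rwa [(ht.res_eq h).1, (ht.res_eq h).2, (ht.adjoint.res_eq h').1]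

end IsRegular

end UOp

/-- For bounded T the form of 1 + T* T dominates the identity, so it is invertible. -/
theorem Adj.exists_mem_solutions [CompleteSpace E] (T : Adj A E F) (x : E) :
    ∃ y, (x, y) ∈ solutions T.toUOp.gr T.adj.toUOp.gr := by
  obtain ⟨S, -, hS⟩ := Adj.exists_inverse (T := 1 + T.adj.comp T) fun x => by
    simp only [add_apply, one_apply, comp_apply, CStarModule.inner_add_right, ← inner_left]
    exact le_add_of_nonneg_right CStarModule.inner_self_nonneg
  refine ⟨(S x, T (S x)), UOp.mem_gr_toUOp.mpr rfl, UOp.mem_gr_toUOp.mpr ?_⟩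
  have h1 : S x + T.adj (T (S x)) = x := congrArg (fun U : Adj A E E => U x) hS
  exact eq_sub_of_add_eq' h1

/-- An everywhere defined adjointable operator is regular. -/
theorem Adj.isResolvent_toUOp [CompleteSpace E] [CompleteSpace F] (T : Adj A E F) :
    ∃ (R : Adj A E E) (B : Adj A E F) (R' : Adj A F F),
      IsResolvent T.toUOp.gr T.adj.toUOp.gr R B R' := by
  have hf : FormallyAdjoint A T.toUOp.gr T.adj.toUOp.gr := fun x y hx a b ha => by
    rw [← UOp.mem_gr_toUOp.mp hx, ← UOp.mem_gr_toUOp.mp ha, inner_left]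
  exact hf.exists_isResolvent T.exists_mem_solutions (by simpa using T.adj.exists_mem_solutions)

theorem Adj.toUOp_adjoint [CompleteSpace E] [CompleteSpace F] (T : Adj A E F) :
    T.toUOp.IsRegular ∧ T.toUOp.adjoint = T.adj.toUOp := by
  obtain ⟨R, B, R', h⟩ := T.isResolvent_toUOp
  have h1 := h.isRegular dense_univ (dense_univ.mono fun x _ => ⟨_, UOp.mem_gr_toUOp.mpr rfl⟩)
  exact ⟨h1.1, UOp.ext_gr h1.2⟩

theorem Adj.isRegular_toUOp [CompleteSpace E] [CompleteSpace F] (T : Adj A E F) :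
    T.toUOp.IsRegular := T.toUOp_adjoint.1

end Regular

/-! ### Invertibility modulo compact operators -/

section EssentialInverse

set_option linter.unusedSectionVars false

variable {A : Type u} [NonUnitalCStarAlgebra A] [PartialOrder A]
variable {E : Type*} [NormedAddCommGroup E] [NormedSpace ℂ E] [SMul A E] [CStarModule A E]
variable {F : Type*} [NormedAddCommGroup F] [NormedSpace ℂ F] [SMul A F] [CStarModule A F]
variable {G : Type*} [NormedAddCommGroup G] [NormedSpace ℂ G] [SMul A G] [CStarModule A G]

/-- Invertibility modulo compact operators. -/
def EssInv (L : Adj A E E) : Prop :=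
  ∃ S : Adj A E E, (1 - S * L).IsCompact ∧ (1 - L * S).IsCompact

theorem EssInv.of_subsingleton [Subsingleton E] (L : Adj A E E) : EssInv L :=
  ⟨0, .of_subsingleton _, .of_subsingleton _⟩

variable [StarOrderedRing A]

/-- Taking adjoints makes S* a right inverse modulo compacts; a left and a right inverse in the
quotient by the compacts agree. -/
theorem EssInv.of_left {L S : Adj A E E} (hL : L.adj = L) (h : (1 - S * L).IsCompact) :
    EssInv L := by
  have h1 : (1 - L * S.adj).IsCompact := by
    have := h.adj
    rwa [Adj.adj_sub, Adj.adj_one, Adj.adj_mul, hL] at this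
  refine ⟨S, h, ?_⟩
  have e : 1 - L * S = (1 - L * S.adj) - L * (S * (1 - L * S.adj) - (1 - S * L) * S.adj) := by
    noncomm_ring
  rw [e]
  exact h1.sub (((h1.mul_left S).sub (h.mul_right S.adj)).mul_left L)

/-- Modulo compacts the inverse S of p + q commutes with q, since q commutes with p + q. Hence S p +
q S agrees with S (p + q), which is 1. -/
theorem EssInv.exists_parametrix {p q : Adj A E E} (hpq : p * q = 0) (hqp : q * p = 0)
    (h : EssInv (p + q)) : ∃ S, (1 - (S * p + q * S)).IsCompact := by
  obtain ⟨S, h1, h2⟩ := h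
  refine ⟨S, ?_⟩
  have e : 1 - (S * p + q * S) = (1 - S * (p + q)) +
      (S * q * (1 - (p + q) * S) - (1 - S * (p + q)) * (q * S)) := by
    have : S * q * (1 - (p + q) * S) - (1 - S * (p + q)) * (q * S)
      = S * q - q * S - S * (q * p) * S + S * (p * q) * S := by noncomm_ring
    rw [this, hpq, hqp]
    noncomm_ring
  rw [e]
  exact h1.add ((h2.mul_left _).sub (h1.mul_right _))

/-- The inequality `2 Re ⟪x, y⟫ ≤ s⁻¹ ⟪x, x⟫ + s ⟪y, y⟫`. -/
theorem inner_add_inner_le (x y : E) {s : ℝ} (hs : 0 < s) :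
    ⟪x, y⟫_A + ⟪y, x⟫_A ≤ s⁻¹ • ⟪x, x⟫_A + s • ⟪y, y⟫_A := by
  have h : (0 : A) ≤ s⁻¹ • ⟪x - s • y, x - s • y⟫_A :=
    smul_nonneg (inv_nonneg.mpr hs.le) CStarModule.inner_self_nonneg
  rw [← sub_nonneg]
  convert h using 1
  simp only [CStarModule.inner_sub_left, CStarModule.inner_sub_right,
    CStarModule.inner_smul_left_real, CStarModule.inner_smul_right_real, smul_sub, smul_smul,
    inv_mul_cancel₀ hs.ne', one_smul]
  rw [← mul_assoc, inv_mul_cancel₀ hs.ne', one_mul]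
  abel

/-- If `T² ∈ W* V T + T Z Y + 𝒦` with `W* W + Y* Y ≤ L` and `1 ≤ T² + 2 L`, then `L` is bounded
below modulo compact operators, hence invertible modulo compact operators. -/
theorem EssInv.of_bound [CompleteSpace E] {L T K : Adj A E E} {W V : Adj A E F} {Y : Adj A E G}
    {Z : Adj A G E} (hL : L.adj = L) (hT : T.adj = T) (hK : K.IsCompact)
    (h1 : ∀ m, ⟪W m, W m⟫_A + ⟪Y m, Y m⟫_A ≤ ⟪m, L m⟫_A)
    (h2 : ∀ m, ⟪m, m⟫_A ≤ ⟪T m, T m⟫_A + (2 : ℝ) • ⟪m, L m⟫_A)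
    (h3 : ∀ m, T (T m) = W.adj (V (T m)) + T (Z (Y m)) + K m) : EssInv L := by
  obtain ⟨c₁, hc₁, hV⟩ := V.exists_inner_apply_le
  obtain ⟨c₂, hc₂, hZ⟩ := Z.adj.exists_inner_apply_le
  -- Weighting both cross terms by c makes their T² contribution (c₁ + c₂)/c = 1 - c⁻¹, strictly
  -- below 1; of 2 T² on the left this leaves at least T² ≤ c L + K + K*. The bound `h2` supplies
  -- the further 2 L.
  set c : ℝ := c₁ + c₂ + 1 with hc
  have hc0 : 0 < c := by positivity
  have key : ∀ m, ⟪m, m⟫_A ≤ ⟪m, (((c + 2 : ℝ) : ℂ) • L + (K + K.adj)) m⟫_A := fun m => by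
    have a1 := inner_add_inner_le (A := A) (V (T m)) (W m) hc0
    have a2 := inner_add_inner_le (A := A) (Z.adj (T m)) (Y m) hc0
    have a3 := smul_le_smul_of_nonneg_left (hV (T m)) (inv_nonneg.mpr hc0.le)
    have a4 := smul_le_smul_of_nonneg_left (hZ (T m)) (inv_nonneg.mpr hc0.le)
    have a5 := smul_le_smul_of_nonneg_left (h1 m) hc0.le
    have a6 := h2 m
    have a7 : 0 ≤ c⁻¹ • ⟪T m, T m⟫_A :=
      smul_nonneg (inv_nonneg.mpr hc0.le) CStarModule.inner_self_nonneg
    have b1 : ⟪T m, T m⟫_A = ⟪W m, V (T m)⟫_A + ⟪Z.adj (T m), Y m⟫_A + ⟪m, K m⟫_A := by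
      rw [Adj.inner_left, hT, h3, CStarModule.inner_add_right, CStarModule.inner_add_right,
        ← Adj.inner_left, Adj.inner_right T, hT, Adj.inner_right Z]
    -- The form of T² is self-adjoint in A; adding its expansion to the starred one produces the
    -- symmetric sums that `inner_add_inner_le` estimates.
    have b2 : ⟪T m, T m⟫_A = ⟪V (T m), W m⟫_A + ⟪Y m, Z.adj (T m)⟫_A + ⟪m, K.adj m⟫_A := by
      have := congrArg star b1
      simpa [Adj.inner_left] using this
    have b3 : ⟪T m, T m⟫_A = c⁻¹ • c₁ • ⟪T m, T m⟫_A + c⁻¹ • c₂ • ⟪T m, T m⟫_A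
        + c⁻¹ • ⟪T m, T m⟫_A := by
      rw [smul_smul, smul_smul, ← add_smul, ← add_smul]
      have : c⁻¹ * c₁ + c⁻¹ * c₂ + c⁻¹ = 1 := by
        rw [← mul_add, ← mul_add_one]
        exact inv_mul_cancel₀ hc0.ne'
      rw [this, one_smul]
    rw [Adj.add_apply, Adj.add_apply, Adj.smul_apply, CStarModule.inner_add_right,
      CStarModule.inner_add_right, CStarModule.inner_smul_right_complex, Complex.coe_smul,
      add_smul]
    generalize ⟪T m, T m⟫_A = x at *
    rw [smul_add] at a5
    rw [← sub_nonneg] at a1 a2 a3 a4 a5 a6 ⊢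
    refine (add_nonneg (add_nonneg (add_nonneg a1 a2) (add_nonneg a3 a4))
      (add_nonneg (add_nonneg a5 a6) a7)).trans_eq ?_
    have b4 : ⟪m, K m⟫_A + ⟪m, K.adj m⟫_A = x + x - (⟪W m, V (T m)⟫_A + ⟪Z.adj (T m), Y m⟫_A)
        - (⟪V (T m), W m⟫_A + ⟪Y m, Z.adj (T m)⟫_A) := by
      nth_rewrite 1 [b1]
      rw [b2]
      abel
    rw [b4]
    nth_rewrite 6 [b3]
    abel
  obtain ⟨S, hS, -⟩ := Adj.exists_inverse key
  refine EssInv.of_left (S := ((c + 2 : ℝ) : ℂ) • S) hL ?_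
  have e : 1 - (((c + 2 : ℝ) : ℂ) • S) * L = S * (K + K.adj) := by
    rw [← hS, mul_add, smul_mul_assoc, mul_smul_comm]
    abel
  rw [e]
  exact (hK.add hK.adj).mul_left S

end EssentialInverse

/-! ### Parametrices of a sequence at one module -/

section LocalFredholm

variable {A : Type u} [NonUnitalCStarAlgebra A] [PartialOrder A]
variable {X : Type*} [NormedAddCommGroup X] [NormedSpace ℂ X] [SMul A X] [CStarModule A X]
variable {M : Type*} [NormedAddCommGroup M] [NormedSpace ℂ M] [SMul A M] [CStarModule A M]
variable {Y : Type*} [NormedAddCommGroup Y] [NormedSpace ℂ Y] [SMul A Y] [CStarModule A Y]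

/-- The sequence `X → M → Y` given by `v` and `u` has a parametrix at `M`. -/
def LocalFredholm (v : UOp A X M) (u : UOp A M Y) : Prop :=
  ∃ (Pl : Adj A Y M) (Pr : Adj A M X) (C : Adj A M M), C.IsCompact ∧
    ∀ x y, (x, y) ∈ u.gr → (Pr x, x - C x - Pl y) ∈ v.gr

theorem localFredholm_iff_apply {v : UOp A X M} {u : UOp A M Y} :
    LocalFredholm v u ↔ ∃ (Pl : Adj A Y M) (Pr : Adj A M X) (C : Adj A M M), C.IsCompact ∧
      ∀ x : u.domain, ∃ h : Pr x ∈ v.domain, Pl (u x) + v ⟨Pr x, h⟩ = x - C x := by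
  refine exists_congr fun Pl => exists_congr fun Pr => exists_congr fun C =>
    and_congr_right fun _ => ⟨fun h x => ?_, fun h x y hx => ?_⟩
  · obtain ⟨h1, h2⟩ := UOp.mem_gr.mp (h _ _ (u.apply_mem_gr x))
    exact ⟨h1, by rw [h2]; abel⟩
  · obtain ⟨hx', rfl⟩ := UOp.mem_gr.mp hx
    obtain ⟨h1, h2⟩ := h ⟨x, hx'⟩
    exact UOp.mem_gr.mpr ⟨h1, by rw [← h2]; abel⟩

/-- The bounded operator `(1 - (1 + u* u)⁻¹) + (1 - (1 + v v*)⁻¹)`. -/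
noncomputable def localLaplacian (v : UOp A X M) (u : UOp A M Y) : Adj A M M :=
  (1 - u.res) + (1 - v.adjoint.res)

variable [StarOrderedRing A] [CompleteSpace X] [CompleteSpace M] [CompleteSpace Y]

section Resolvents

variable {v : UOp A X M} {u : UOp A M Y}

theorem UOp.IsRegular.res_adj (hu : u.IsRegular) : u.res.adj = u.res := hu.isResolvent.adj_eq

/-- The element m - (1 + v v*)⁻¹ m lies in ran v, hence in ker u, where (1 + u* u)⁻¹ is the
identity. All commutation relations of the resolvents come from this. -/
theorem res_apply_range (hu : u.IsRegular) (hv : v.IsRegular)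
    (huv : ∀ x m, (x, m) ∈ v.gr → (m, 0) ∈ u.gr) (m : M) :
    u.res (m - v.adjoint.res m) = m - v.adjoint.res m :=
  hu.isResolvent.apply_of_mem_ker (huv _ _ (hv.isResolvent.adj_mem m))

theorem res_mul_res (hu : u.IsRegular) (hv : v.IsRegular)
    (huv : ∀ x m, (x, m) ∈ v.gr → (m, 0) ∈ u.gr) :
    u.res * v.adjoint.res = u.res + v.adjoint.res - 1 := by
  ext m
  have := res_apply_range hu hv huv m
  rw [map_sub] at this
  simp only [Adj.mul_apply, Adj.sub_apply, Adj.add_apply, Adj.one_apply]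
  rw [← sub_eq_zero] at this ⊢
  rw [← neg_eq_zero, ← this]
  abel

theorem res_mul_res' (hu : u.IsRegular) (hv : v.IsRegular)
    (huv : ∀ x m, (x, m) ∈ v.gr → (m, 0) ∈ u.gr) :
    v.adjoint.res * u.res = u.res + v.adjoint.res - 1 := by
  have := congrArg Adj.adj (res_mul_res hu hv huv)
  simpa only [Adj.adj_mul, Adj.adj_sub, Adj.adj_add, Adj.adj_one, hu.res_adj,
    hv.adjoint.res_adj] using this

theorem one_sub_localLaplacian (hu : u.IsRegular) (hv : v.IsRegular)
    (huv : ∀ x m, (x, m) ∈ v.gr → (m, 0) ∈ u.gr) :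
    1 - localLaplacian v u = u.res * v.adjoint.res := by
  rw [res_mul_res hu hv huv, localLaplacian]
  abel

theorem localLaplacian_adj (hu : u.IsRegular) (hv : v.IsRegular) :
    (localLaplacian v u).adj = localLaplacian v u := by
  simp [localLaplacian, hu.res_adj, hv.adjoint.res_adj]

theorem one_sub_mul_one_sub (hu : u.IsRegular) (hv : v.IsRegular)
    (huv : ∀ x m, (x, m) ∈ v.gr → (m, 0) ∈ u.gr) :
    (1 - u.res) * (1 - v.adjoint.res) = 0 ∧ (1 - v.adjoint.res) * (1 - u.res) = 0 := by
  constructor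
  · rw [mul_sub, sub_mul, sub_mul, res_mul_res hu hv huv]
    noncomm_ring
  · rw [mul_sub, sub_mul, sub_mul, res_mul_res' hu hv huv]
    noncomm_ring

/-- If `v`, `u` are regular and `u v = 0`, then the sequence given by `v` and `u` has a parametrix
if and only if its bounded Laplacian is invertible modulo compact operators. -/
theorem localFredholm_iff (hu : u.IsRegular) (hv : v.IsRegular)
    (huv : ∀ x m, (x, m) ∈ v.gr → (m, 0) ∈ u.gr) :
    LocalFredholm v u ↔ EssInv (localLaplacian v u) := by
  have hR := hu.isResolvent
  have hR' := hv.isResolvent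
  have hLa := localLaplacian_adj hu hv
  constructor
  · rintro ⟨Pl, Pr, C, hC, h⟩
    set L := localLaplacian v u with hL
    have hG : u.res * v.adjoint.res = 1 - L := (one_sub_localLaplacian hu hv huv).symm
    have hG' : v.adjoint.res * u.res = 1 - L := by
      rw [← hG, res_mul_res hu hv huv, res_mul_res' hu hv huv]
    have g1 : ∀ m, u.res (v.adjoint.res m) = m - L m := fun m =>
      congrArg (fun S : Adj A M M => S m) hG
    have g2 : ∀ m, v.adjoint.res (u.res m) = m - L m := fun m =>
      congrArg (fun S : Adj A M M => S m) hG'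
    have g3 : ∀ m, L m = (m - u.res m) + (m - v.adjoint.res m) := fun m => rfl
    -- Compressing the parametrix identity by 1 - L = (1 + Δ)⁻¹ makes it bounded: Y = u (1 - L), and
    -- W* extends (1 - L) v.
    refine EssInv.of_bound (T := 1 - L) (K := (1 - L) * C * (1 - L)) (W := v.tres.adj.comp u.res)
      (V := Pr) (Y := u.tres.comp v.adjoint.res) (Z := Pl) hLa (by simp [hLa])
      ((hC.mul_left _).mul_right _) (fun m => ?_) (fun m => ?_) (fun m => ?_)
    · have a1 : ⟪u.tres (v.adjoint.res m), u.tres (v.adjoint.res m)⟫_A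
          = ⟪m, (1 - L) (m - u.res m)⟫_A := by
        have e : v.adjoint.res m - (m - L m) = m - u.res m := by
          rw [g3]
          abel
        rw [hR.inner_mul, hR'.symm.inner_apply, g2, g1, e]
        rfl
      have a2 : ⟪v.tres.adj (u.res m), v.tres.adj (u.res m)⟫_A
          = ⟪m, (1 - L) (m - v.adjoint.res m)⟫_A := by
        have e : u.res m - (m - L m) = m - v.adjoint.res m := by
          rw [g3]
          abel
        rw [hR'.symm.inner_mul, hR.inner_apply, g1, g2, e]
        rfl
      -- The two squares add up to the form of (1 - L) L = L - L², which is at most that of L.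
      rw [Adj.comp_apply, Adj.comp_apply, a1, a2, ← CStarModule.inner_add_right, ← map_add,
        add_comm, ← g3, Adj.sub_apply, Adj.one_apply, CStarModule.inner_sub_right,
        Adj.inner_right L m (L m), hLa]
      exact sub_le_self _ CStarModule.inner_self_nonneg
    · have a1 : ⟪L m, m⟫_A = ⟪m, L m⟫_A := by rw [Adj.inner_left, hLa]
      simp only [Adj.sub_apply, Adj.one_apply, CStarModule.inner_sub_left,
        CStarModule.inner_sub_right, a1]
      rw [← sub_nonneg]
      -- Here (1 - L)² + 2 L - 1 = L².
      refine (CStarModule.inner_self_nonneg (A := A) (x := L m)).trans_eq ?_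
      rw [two_smul]
      abel
    · set x := (1 - L) m with hx
      have a1 : (x, u.tres (v.adjoint.res m)) ∈ u.gr := by
        have := hR.mem (v.adjoint.res m)
        rwa [g1] at this
      have a2 := h _ _ a1
      -- The argument of 1 - L is v (Pr x), so formal adjointness of v and v* identifies the left
      -- side with W* Pr x.
      have a3 : (1 - L) (x - C x - Pl (u.tres (v.adjoint.res m)))
          = (v.tres.adj.comp u.res).adj (Pr x) := by
        refine ext_inner_left A fun m' => ?_
        rw [Adj.inner_left, Adj.inner_left, Adj.adj_adj, Adj.adj_sub, hLa, Adj.adj_one]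
        have a5 := hR'.1 _ _ a2 _ _ (hR'.adj_mem_adj (u.res m'))
        rw [g2] at a5
        exact a5
      rw [← a3]
      simp only [map_sub, Adj.mul_apply, Adj.comp_apply]
      rw [← hx]
      abel
  · intro h
    obtain ⟨hpq, hqp⟩ := one_sub_mul_one_sub hu hv huv
    obtain ⟨S, hS⟩ := h.exists_parametrix hpq hqp
    -- With p = 1 - (1 + u* u)⁻¹ = `u.tres.adj` ∘ u on dom u and q = 1 - (1 + v v*)⁻¹ = v ∘
    -- `v.tres.adj`, the two terms of S p + q S have the shape of a parametrix.
    refine ⟨S.comp u.tres.adj, v.tres.adj.comp S, _, hS, fun x y hxy => ?_⟩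
    have e : x - (1 - (S * (1 - u.res) + (1 - v.adjoint.res) * S)) x - (S.comp u.tres.adj) y
        = S x - v.adjoint.res (S x) := by
      simp only [Adj.sub_apply, Adj.one_apply, Adj.add_apply, Adj.mul_apply, Adj.comp_apply,
        hR.adj_apply hxy, map_sub]
      abel
    rw [e]
    exact hR'.adj_mem (S x)

end Resolvents

set_option linter.unusedSectionVars false in
/-- A sequence of bounded operators `X → M → Y` with composition zero has a parametrix if and only
if its Laplacian is invertible modulo compact operators. -/
theorem localFredholm_toUOp_iff {a : Adj A M Y} {b : Adj A X M} (hab : ∀ x, a (b x) = 0) :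
    LocalFredholm b.toUOp a.toUOp ↔ EssInv (a.adj.comp a + b.comp b.adj) := by
  have hL : (a.adj.comp a + b.comp b.adj).adj = a.adj.comp a + b.comp b.adj := by simp
  have e : ∀ m, ⟪m, (a.adj.comp a + b.comp b.adj) m⟫_A
      = ⟪b.adj m, b.adj m⟫_A + ⟪a m, a m⟫_A := fun m => by
    rw [Adj.add_apply, Adj.comp_apply, Adj.comp_apply, CStarModule.inner_add_right,
      ← Adj.inner_left a, Adj.inner_right b m, add_comm]
  constructor
  · rintro ⟨Pl, Pr, C, hC, h⟩
    -- For bounded operators no compression is needed, so T = 1.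
    refine EssInv.of_bound (T := 1) (K := C) (W := b.adj) (V := Pr) (Y := a) (Z := Pl) hL
      (by simp) hC (fun m => ?_) (fun m => ?_) (fun m => ?_)
    · rw [e]
    · rw [e]
      exact le_add_of_nonneg_right (smul_nonneg zero_le_two
        (add_nonneg CStarModule.inner_self_nonneg CStarModule.inner_self_nonneg))
    · have := UOp.mem_gr_toUOp.mp (h m (a m) (UOp.mem_gr_toUOp.mpr rfl))
      simp only [Adj.one_apply, Adj.adj_adj]
      rw [this]
      abel
  · intro h
    have hpq : (a.adj.comp a) * (b.comp b.adj) = 0 := by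
      ext m
      simp [hab]
    have hqp : (b.comp b.adj) * (a.adj.comp a) = 0 := by
      have := congrArg Adj.adj hpq
      simpa using this
    obtain ⟨S, hS⟩ := h.exists_parametrix hpq hqp
    refine ⟨S.comp a.adj, b.adj.comp S, _, hS, fun x y hxy => UOp.mem_gr_toUOp.mpr ?_⟩
    rw [← UOp.mem_gr_toUOp.mp hxy]
    simp

end LocalFredholm

/-! ### The bounded transform -/

section BoundedTransform

set_option linter.unusedSectionVars false

variable {A : Type u} [NonUnitalCStarAlgebra A] [PartialOrder A] [StarOrderedRing A]
variable {E : Type*} [NormedAddCommGroup E] [NormedSpace ℂ E] [SMul A E] [CStarModule A E]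
variable {F : Type*} [NormedAddCommGroup F] [NormedSpace ℂ F] [SMul A F] [CStarModule A F]

/-- A bounded operator with densely defined formal adjoint is adjointable. -/
theorem exists_adjoint_of_dense [CompleteSpace E] (T : E →L[ℂ] F)
    (hd : Dense {y : F | ∃ z, ∀ x, ⟪T x, y⟫_A = ⟪x, z⟫_A}) :
    ∃ S : F →L[ℂ] E, ∀ x y, ⟪T x, y⟫_A = ⟪x, S y⟫_A := by
  let S : Submodule ℂ (F × E) :=
    { carrier := {p | ∀ x, ⟪T x, p.1⟫_A = ⟪x, p.2⟫_A}
      add_mem' := fun {p q} hp hq x => by simp [hp x, hq x]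
      zero_mem' := fun x => by simp
      smul_mem' := fun c p hp x => by simp [hp x] }
  have hS : IsClosed (S : Set (F × E)) := by
    have : (S : Set (F × E)) = ⋂ x, {p | ⟪T x, p.1⟫_A = ⟪x, p.2⟫_A} := by
      ext p
      simp [S]
    rw [this]
    refine isClosed_iInter fun x => isClosed_eq ?_ ?_
    · exact (CStarModule.continuous_inner (A := A)).comp (by fun_prop :
        Continuous fun q : F × E => (T x, q.1))
    · exact (CStarModule.continuous_inner (A := A)).comp (by fun_prop :
        Continuous fun q : F × E => (x, q.2))
  have hb : ∀ p ∈ S, ‖p.2‖ ≤ ‖T‖ * ‖p.1‖ := fun p hp => by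
    rcases (norm_nonneg p.2).eq_or_lt with h | h
    · rw [← h]; positivity
    refine le_of_mul_le_mul_left ?_ h
    calc ‖p.2‖ * ‖p.2‖ = ‖⟪T p.2, p.1⟫_A‖ := by
          rw [hp, ← CStarModule.norm_sq_eq A, sq]
      _ ≤ ‖T p.2‖ * ‖p.1‖ := CStarModule.norm_inner_le F
      _ ≤ (‖T‖ * ‖p.2‖) * ‖p.1‖ := by
          gcongr; exact T.le_opNorm _
      _ = _ := by ring
  obtain ⟨f, hf⟩ := exists_clm_of_bound S ‖T‖ hb fun y => by
    obtain ⟨z, hz⟩ := exists_mem_closure_of_bound S ‖T‖ hb hd y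
    exact ⟨z, hS.closure_subset hz⟩
  exact ⟨f, fun x y => hf y x⟩

theorem Adj.ext_of_dense {S T : Adj A E F} {s : Set E} (hs : Dense s)
    (h : ∀ x ∈ s, S x = T x) : S = T :=
  Adj.toCLM_injective (ContinuousLinearMap.ext fun x =>
    (isClosed_eq S.continuous T.continuous).closure_subset_iff.mpr h (hs x))

namespace UOp

variable [CompleteSpace E] [CompleteSpace F] {t : UOp A E F}

theorem IsRegular.isInvSqrt_iff (ht : t.IsRegular) {Q : Adj A E E} :
    t.IsInvSqrt Q ↔ (∀ x, 0 ≤ ⟪x, Q x⟫_A) ∧ Q * Q = t.res := by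
  have hR := ht.isResolvent
  refine and_congr_right fun _ => ⟨fun h => Adj.ext fun x => ?_, fun h => ⟨fun x => ?_, fun x => ?_⟩⟩
  · obtain ⟨h1, h2⟩ := h.1 x
    obtain ⟨w, h3, h4⟩ := mem_gr_comp.mp ((t.adjoint.comp t).apply_mem_gr ⟨_, h1⟩)
    rw [eq_sub_of_add_eq' h2] at h4
    exact (hR.eq_of_mem h3 h4).1.symm
  · have h1 : (t.res x, x - t.res x) ∈ (t.adjoint.comp t).gr :=
      mem_gr_comp.mpr ⟨_, hR.mem x, hR.mem_adj x⟩
    rw [← h] at h1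
    obtain ⟨h2, h3⟩ := mem_gr.mp h1
    exact ⟨h2, by erw [h3]; exact add_sub_cancel _ _⟩
  · obtain ⟨w, h3, h4⟩ := mem_gr_comp.mp ((t.adjoint.comp t).apply_mem_gr x)
    have h5 := (hR.eq_of_mem (x := x + t.adjoint.comp t x) h3 (by rwa [add_sub_cancel_left])).1
    rwa [← h] at h5

/-- The resolvent is positive and so has a positive square root; the default 0 in `invSqrt` is not
reached for regular t. -/
theorem IsRegular.invSqrt_spec (ht : t.IsRegular) :
    (∀ x, 0 ≤ ⟪x, t.invSqrt x⟫_A) ∧ t.invSqrt * t.invSqrt = t.res := by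
  have h : ∃ Q, t.IsInvSqrt Q := by
    obtain ⟨Q, hQ⟩ := Adj.exists_sqrt ht.isResolvent.inner_apply_self_nonneg
    exact ⟨Q, ht.isInvSqrt_iff.mpr hQ⟩
  rw [← ht.isInvSqrt_iff, invSqrt, dif_pos h]
  exact h.choose_spec

theorem IsRegular.invSqrt_adj (ht : t.IsRegular) : t.invSqrt.adj = t.invSqrt :=
  Adj.adj_eq_of_inner_nonneg ht.invSqrt_spec.1

theorem IsRegular.invSqrt_invSqrt (ht : t.IsRegular) (x : E) :
    t.invSqrt (t.invSqrt x) = t.res x :=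
  congrArg (fun S : Adj A E E => S x) ht.invSqrt_spec.2

theorem IsRegular.invSqrt_res (ht : t.IsRegular) (x : E) :
    t.invSqrt (t.res x) = t.res (t.invSqrt x) := by
  rw [← ht.invSqrt_invSqrt, ← ht.invSqrt_invSqrt]

theorem IsRegular.denseRange_res (ht : t.IsRegular) : DenseRange t.res :=
  ht.isResolvent.denseRange (by rw [← coe_domain]; exact ht.dense_domain)
    (by rw [← coe_domain]; exact ht.dense_adjoint_domain)

theorem IsRegular.denseRange_invSqrt (ht : t.IsRegular) : DenseRange t.invSqrt :=
  ht.denseRange_res.mono (by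
    rintro _ ⟨x, rfl⟩
    exact ⟨t.invSqrt x, ht.invSqrt_invSqrt x⟩)

/-- On the kernel of `t` the operator `(1 + t* t)^(-1/2)` is the identity. -/
theorem IsRegular.invSqrt_of_mem_ker (ht : t.IsRegular) {x : E} (hx : (x, (0 : F)) ∈ t.gr) :
    t.invSqrt x = x := by
  -- On the kernel Q² x = x, so Q x - x would be an eigenvector of Q for -1, which positivity of Q
  -- excludes unless it is 0.
  have h1 : t.invSqrt (t.invSqrt x - x) = -(t.invSqrt x - x) := by
    rw [map_sub, ht.invSqrt_invSqrt, ht.isResolvent.apply_of_mem_ker hx]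
    abel
  have h2 := ht.invSqrt_spec.1 (t.invSqrt x - x)
  rw [h1, CStarModule.inner_neg_right] at h2
  exact sub_eq_zero.mp (CStarModule.inner_self.mp
    (le_antisymm (neg_nonneg.mp h2) CStarModule.inner_self_nonneg))

/-- The bounded transform of a regular operator is an adjointable operator. -/
theorem IsRegular.exists_boundedTransform (ht : t.IsRegular) :
    ∃ T : Adj A E F, t.boundedTransform = T.toUOp ∧ (∀ x, (t.invSqrt x, T x) ∈ t.gr) ∧
      T.adj.comp T = 1 - t.res ∧ T.comp T.adj = 1 - t.adjoint.res := by
  have hR := ht.isResolvent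
  have hQ := ht.invSqrt_adj
  set Q := t.invSqrt with hQdef
  -- The pairs (Q x, t Q² x): the transform t Q restricted to the dense subspace ran Q, where it is
  -- contractive. The bounded operator T is its closure.
  let S : Submodule ℂ (E × F) :=
    LinearMap.range (Q.toContinuousLinearMap.prod t.tres.toContinuousLinearMap).toLinearMap
  have hb : ∀ p ∈ S.topologicalClosure, ‖p.2‖ ≤ 1 * ‖p.1‖ := by
    have : IsClosed {p : E × F | ‖p.2‖ ≤ 1 * ‖p.1‖} :=
      isClosed_le (by fun_prop) (by fun_prop)
    refine this.closure_subset_iff.mpr ?_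
    rintro _ ⟨x, rfl⟩
    rw [Set.mem_ofPred_eq, one_mul]
    refine norm_le_of_inner_le (A := A) ?_
    change ⟪t.tres x, t.tres x⟫_A ≤ ⟪Q x, Q x⟫_A
    rw [hR.inner_mul, Adj.inner_left, hQ, hQdef, ht.invSqrt_invSqrt, map_sub,
      CStarModule.inner_sub_right, ← hR.inner_apply x (t.res x)]
    exact sub_le_self _ CStarModule.inner_self_nonneg
  have hS : ∀ p ∈ S.topologicalClosure, (Q p.1, p.2) ∈ t.gr := by
    have : IsClosed {p : E × F | (Q p.1, p.2) ∈ t.gr} :=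
      ht.closed.preimage (f := fun p : E × F => (Q p.1, p.2)) (by fun_prop)
    refine this.closure_subset_iff.mpr ?_
    rintro _ ⟨x, rfl⟩
    have h1 := hR.mem x
    rwa [← ht.invSqrt_invSqrt x] at h1
  obtain ⟨T, hT⟩ := exists_clm_of_bound S.topologicalClosure 1 hb fun x =>
    exists_mem_closure_of_bound S 1 (fun p hp => hb p (S.le_topologicalClosure hp))
      (ht.denseRange_invSqrt.mono (by
        rintro _ ⟨x, rfl⟩
        exact ⟨t.tres x, x, rfl⟩)) x
  have hT' : ∀ x, (Q x, T x) ∈ t.gr := fun x => hS _ (hT x)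
  -- On the dense domain of t* the adjoint of T is Q t*.
  have had : ∀ y z, (y, z) ∈ t.adjoint.gr → ∀ x, ⟪T x, y⟫_A = ⟪x, Q z⟫_A := fun y z hyz x => by
    rw [hR.1 _ _ (hT' x) _ _ hyz, Adj.inner_left, hQ]
  let T' : Adj A E F := ⟨T, exists_adjoint_of_dense T (ht.dense_adjoint_domain.mono (by
    intro y hy
    obtain ⟨z, hz⟩ := mem_domain_iff.mp hy
    exact ⟨Q z, had y z hz⟩))⟩
  have had' : ∀ y z, (y, z) ∈ t.adjoint.gr → T'.adj y = Q z := fun y z hyz =>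
    ext_inner A fun x => by
      rw [← Adj.inner_left]
      exact had y z hyz x
  have hTQ : ∀ x, T' (Q x) = t.tres x := fun x => by
    have h1 := hT' (Q x)
    rw [hQdef, ht.invSqrt_invSqrt] at h1
    exact gr_unique h1 (hR.mem x)
  refine ⟨T', ext_gr ?_, hT', ?_, ?_⟩
  · ext ⟨x, y⟩
    rw [mem_gr_toUOp, boundedTransform, mem_gr_comp]
    constructor
    · rintro ⟨z, h1, h2⟩
      rw [← mem_gr_toUOp.mp h1] at h2
      exact gr_unique (hT' x) h2
    · rintro rfl
      exact ⟨_, mem_gr_toUOp.mpr rfl, hT' x⟩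
  · refine Adj.ext_of_dense ht.denseRange_invSqrt ?_
    rintro _ ⟨x, rfl⟩
    rw [Adj.comp_apply, hTQ, had' _ _ (hR.mem_adj x), map_sub, Adj.sub_apply, Adj.one_apply,
      hQdef, ht.invSqrt_res]
  · refine Adj.ext_of_dense ht.dense_adjoint_domain ?_
    intro y hy
    obtain ⟨z, hz⟩ := mem_domain_iff.mp hy
    have h1 := hR.symm.adj_apply hz
    rw [Adj.adj_adj] at h1
    rw [Adj.comp_apply, had' _ _ hz, hTQ, h1]
    rfl

end UOp

end BoundedTransform

/-! ### Graph modules -/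

section GraphNorm

set_option linter.unusedSectionVars false

variable {A : Type u} [NonUnitalCStarAlgebra A] [PartialOrder A] [StarOrderedRing A]
variable {E : Type v} [NormedAddCommGroup E] [NormedSpace ℂ E] [SMul A E] [CStarModule A E]
variable {F : Type v} [NormedAddCommGroup F] [NormedSpace ℂ F] [SMul A F] [CStarModule A F]
variable {G : Type v} [NormedAddCommGroup G] [NormedSpace ℂ G] [SMul A G] [CStarModule A G]

namespace GraphModule

theorem inner_def (t : UOp A E F) (x y : GraphModule t) :
    ⟪x, y⟫_A = ⟪(toDomain t x : E), (toDomain t y : E)⟫_A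
      + ⟪t (toDomain t x), t (toDomain t y)⟫_A := rfl

theorem ext_coe {t : UOp A E F} {x y : GraphModule t} (h : (toDomain t x : E) = toDomain t y) :
    x = y := Subtype.ext h

/-- An operator between a Hilbert module and a graph module from its two components. -/
theorem exists_clm {t : UOp A E F} (f : G →L[ℂ] E) (g : G →L[ℂ] F)
    (h : ∀ x, (f x, g x) ∈ t.gr) : ∃ T : G →L[ℂ] GraphModule t,
      ∀ x, (toDomain t (T x) : E) = f x ∧ t (toDomain t (T x)) = g x := by
  choose h1 h2 using fun x => UOp.mem_gr.mp (h x)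
  let T : G →ₗ[ℂ] GraphModule t := (toDomain t).symm.toLinearMap ∘ₗ
    f.toLinearMap.codRestrict t.domain h1
  refine ⟨T.mkContinuous (‖f‖ + ‖g‖) fun x => ?_, fun x => ⟨rfl, h2 x⟩⟩
  refine (norm_le_add t (T x)).trans ?_
  have e : t (toDomain t (T x)) = g x := h2 x
  have e' : (toDomain t (T x) : E) = f x := rfl
  rw [e, e', add_mul]
  exact add_le_add (f.le_opNorm x) (g.le_opNorm x)

/-- The inclusion of a graph module, as a bounded operator. -/
noncomputable def incl (t : UOp A E F) : GraphModule t →L[ℂ] E :=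
  (t.domain.subtype ∘ₗ (toDomain t).toLinearMap).mkContinuous 1 fun x => by
    rw [one_mul]
    exact norm_coe_le t x

/-- The operator `t` on its graph module, as a bounded operator. -/
noncomputable def applyCLM (t : UOp A E F) : GraphModule t →L[ℂ] F :=
  (t.toFun ∘ₗ (toDomain t).toLinearMap).mkContinuous 1 fun x => by
    rw [one_mul]
    exact norm_apply_le t x

theorem incl_apply (t : UOp A E F) (x : GraphModule t) : incl t x = toDomain t x := rfl

theorem applyCLM_apply (t : UOp A E F) (x : GraphModule t) :
    applyCLM t x = t (toDomain t x) := rfl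

variable [CompleteSpace E] [CompleteSpace F] [CompleteSpace G]

/-- The differentials of the graph-norm complex are adjointable. -/
theorem exists_map_eq_toUOp {t : UOp A E F} {s : UOp A F G} (ht : t.IsRegular)
    (h : ∀ x : t.domain, t x ∈ s.domain) (h0 : ∀ x : t.domain, s ⟨t x, h x⟩ = 0) :
    ∃ T : Adj A (GraphModule t) (GraphModule s), map t s h = T.toUOp ∧
      (∀ x, (toDomain s (T x) : F) = t (toDomain t x)) ∧
      ∀ y, (toDomain t (T.adj y) : E) = t.tres.adj (toDomain s y : F) := by
  have hR := ht.isResolvent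
  obtain ⟨f, hf⟩ := exists_clm (t := s) (applyCLM t) 0 fun x =>
    UOp.mem_gr.mpr ⟨h _, h0 (toDomain t x)⟩
  -- The adjoint is y ↦ t* (1 + t t*)⁻¹ y. Because s t = 0, the graph product of t x with y is just
  -- ⟪t x, y⟫, split by the resolvent into ⟪t x, R' y⟫ + ⟪t x, y - R' y⟫.
  obtain ⟨g, hg⟩ := exists_clm (t := t) (t.tres.adj.toContinuousLinearMap ∘L incl s)
    ((1 - t.adjoint.res).toContinuousLinearMap ∘L incl s) fun y => hR.adj_mem _
  have had : ∀ x y, ⟪f x, y⟫_A = ⟪x, g y⟫_A := fun x y => by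
    rw [inner_def, inner_def, (hf x).1, (hf x).2, (hg y).1, (hg y).2]
    have h1 := hR.1 _ _ (t.apply_mem_gr (toDomain t x)) _ _ (hR.adj_mem_adj (toDomain s y : F))
    simp only [applyCLM_apply, ContinuousLinearMap.comp_apply, incl_apply, Adj.sub_apply,
      Adj.one_apply, CStarModule.inner_sub_right, ← h1, _root_.zero_apply,
      CStarModule.inner_zero_left]
    abel
  let T : Adj A (GraphModule t) (GraphModule s) := ⟨f, g, had⟩
  have hT : ∀ y, T.adj y = g y := fun y => ext_inner A fun x => by
    rw [← Adj.inner_left]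
    exact had x y
  refine ⟨T, UOp.ext_gr ?_, fun x => (hf x).1, fun y => by rw [hT]; exact (hg y).1⟩
  ext ⟨x, y⟩
  rw [UOp.mem_gr_toUOp, UOp.mem_gr]
  constructor
  · rintro ⟨_, rfl⟩
    exact ext_coe (hf x).1
  · rintro rfl
    exact ⟨trivial, ext_coe (hf x).1.symm⟩

/-- The operator `(1 + t* t)^(-1/2)` is unitary from a module to the graph module of `t`. -/
theorem exists_unitary {t : UOp A E F} (ht : t.IsRegular) :
    ∃ U : Adj A E (GraphModule t), (∀ x, (toDomain t (U x) : E) = t.invSqrt x) ∧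
      U.adj.comp U = 1 ∧ U.comp U.adj = 1 := by
  have hR := ht.isResolvent
  have hQ := ht.invSqrt_adj
  obtain ⟨T, -, hT, hTT, -⟩ := ht.exists_boundedTransform
  obtain ⟨f, hf⟩ := exists_clm (t := t) t.invSqrt.toContinuousLinearMap T.toContinuousLinearMap hT
  -- Read off from the graph inner product of (Q x, T x) with (y, t y).
  let g : GraphModule t →L[ℂ] E := t.invSqrt.toContinuousLinearMap ∘L incl t +
    T.adj.toContinuousLinearMap ∘L applyCLM t
  have hg : ∀ y, g y = t.invSqrt (toDomain t y : E) + T.adj (t (toDomain t y)) := fun y => rfl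
  have had : ∀ x y, ⟪f x, y⟫_A = ⟪x, g y⟫_A := fun x y => by
    rw [inner_def, (hf x).1, (hf x).2, hg, CStarModule.inner_add_right, ← Adj.inner_left,
      Adj.inner_left, hQ]
  let U : Adj A E (GraphModule t) := ⟨f, g, had⟩
  have hU : ∀ y, U.adj y = g y := fun y => ext_inner A fun x => by
    rw [← Adj.inner_left]
    exact had x y
  refine ⟨U, fun x => (hf x).1, Adj.ext fun x => ?_, Adj.ext fun z => ext_coe ?_⟩
  · rw [Adj.comp_apply, hU, hg]
    have h1 : T.adj (T x) = x - t.res x := congrArg (fun S : Adj A E E => S x) hTT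
    have h2 : t (toDomain t (U x)) = T x := (hf x).2
    have h3 : (toDomain t (U x) : E) = t.invSqrt x := (hf x).1
    rw [h2, h3, h1, ht.invSqrt_invSqrt]
    exact add_sub_cancel _ _
  · have h3 : (toDomain t (U (U.adj z)) : E) = t.invSqrt (U.adj z) := (hf _).1
    rw [Adj.comp_apply, h3, hU, hg]
    refine ext_inner_left A fun m => ?_
    have h4 : T (t.invSqrt m) = t.tres m :=
      UOp.gr_unique (hT (t.invSqrt m)) (by rw [ht.invSqrt_invSqrt]; exact hR.mem m)
    rw [Adj.inner_left, hQ, CStarModule.inner_add_left, Adj.inner_left, hQ,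
      ht.invSqrt_invSqrt, Adj.inner_left, Adj.adj_adj, h4,
      hR.1 _ _ (t.apply_mem_gr (toDomain t z)) _ _ (hR.mem_adj m), ← CStarModule.inner_add_right,
      add_sub_cancel]
    rfl

end GraphModule

end GraphNorm

/-! ### Conjugating invertibility modulo compacts -/

section Transfer

variable {A : Type u} [NonUnitalCStarAlgebra A] [PartialOrder A]
variable {E : Type*} [NormedAddCommGroup E] [NormedSpace ℂ E] [SMul A E] [CStarModule A E]
variable {F : Type*} [NormedAddCommGroup F] [NormedSpace ℂ F] [SMul A F] [CStarModule A F]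

theorem EssInv.of_intertwine {L : Adj A E E} {L' : Adj A F F} {U : Adj A E F} {V : Adj A F E}
    (hUV : U.comp V = 1) (h : EssInv L) (hL : U.comp L = L'.comp U) (hL' : V.comp L' = L.comp V) :
    EssInv L' := by
  obtain ⟨S, h1, h2⟩ := h
  have e : ∀ x, U (V x) = x := fun x => congrArg (fun T : Adj A F F => T x) hUV
  have eL : ∀ x, U (L x) = L' (U x) := fun x => congrArg (fun T : Adj A E F => T x) hL
  have eL' : ∀ x, V (L' x) = L (V x) := fun x => congrArg (fun T : Adj A F E => T x) hL'
  refine ⟨(U.comp S).comp V, ?_, ?_⟩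
  · have : 1 - ((U.comp S).comp V) * L' = (U.comp (1 - S * L)).comp V := by
      ext x
      simp [e, eL']
    rw [this]
    exact (h1.comp_left U).comp_right V
  · have : 1 - L' * ((U.comp S).comp V) = (U.comp (1 - L * S)).comp V := by
      ext x
      simp [e, eL]
    rw [this]
    exact (h2.comp_left U).comp_right V

end Transfer

section Zero

variable {A : Type u} [NonUnitalCStarAlgebra A] [PartialOrder A] [StarOrderedRing A]
variable {E : Type*} [NormedAddCommGroup E] [NormedSpace ℂ E] [SMul A E] [CStarModule A E]
  [CompleteSpace E]

theorem res_zero : (0 : Adj A E E).toUOp.res = 1 :=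
  Adj.ext fun _ => (Adj.isRegular_toUOp 0).isResolvent.apply_of_mem_ker (UOp.mem_gr_toUOp.mpr rfl)

theorem res_adjoint_zero : (0 : Adj A E E).toUOp.adjoint.res = 1 := by
  rw [(Adj.toUOp_adjoint 0).2, Adj.adj_zero, res_zero]

end Zero

/-! ### Complexes, their bounded Laplacians, and four of the six conditions -/

section Complexes

set_option linter.unusedSectionVars false

variable {A : Type u} [NonUnitalCStarAlgebra A] [PartialOrder A]
variable {E : ℕ → Type v} [∀ k, NormedAddCommGroup (E k)] [∀ k, NormedSpace ℂ (E k)]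
  [∀ k, SMul A (E k)] [∀ k, CStarModule A (E k)]

/-- Each `Pl k` enters only in degree k and each `Pr k` only in degree k + 1, so the degrees
decouple. Degree 0 receives the zero operator on `E 0` as incoming differential. -/
theorem exists_isJointParametrix_iff {t : ∀ k, UOp A (E k) (E (k + 1))} :
    (∃ Pl Pr, IsJointParametrix t Pl Pr) ↔
      LocalFredholm (0 : Adj A (E 0) (E 0)).toUOp (t 0) ∧
        ∀ k, LocalFredholm (t k) (t (k + 1)) := by
  simp only [localFredholm_iff_apply]
  constructor
  · rintro ⟨Pl, Pr, ⟨C, hC, h0⟩, h⟩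
    refine ⟨⟨Pl 0, 0, C, hC, fun x => ⟨trivial, ?_⟩⟩, fun k => ?_⟩
    · rw [← h0]
      exact add_zero _
    · obtain ⟨C, hC, h⟩ := h k
      exact ⟨Pl (k + 1), Pr k, C, hC, h⟩
  · rintro ⟨⟨Pl0, Pr0, C, hC, h0⟩, h⟩
    choose Pl Pr C' hC' h using h
    refine ⟨fun | 0 => Pl0 | k + 1 => Pl k, Pr, ⟨C, hC, fun x => ?_⟩, fun k => ⟨C' k, hC' k, h k⟩⟩
    obtain ⟨_, h1⟩ := h0 x
    rw [← h1]
    exact (add_zero _).symm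

theorem exists_isChainJointParametrix_iff {s : ∀ k, UOp A (E (k + 1)) (E k)} :
    (∃ Pl Pr, IsChainJointParametrix s Pl Pr) ↔
      LocalFredholm (s 0) (0 : Adj A (E 0) (E 0)).toUOp ∧
        ∀ k, LocalFredholm (s (k + 1)) (s k) := by
  simp only [localFredholm_iff_apply]
  constructor
  · rintro ⟨Pl, Pr, ⟨C, hC, h0⟩, h⟩
    refine ⟨⟨0, Pr 0, C, hC, fun x => ?_⟩, fun k => ?_⟩
    · obtain ⟨h1, h2⟩ := h0 x
      exact ⟨h1, (zero_add _).trans h2⟩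
    · obtain ⟨C, hC, h⟩ := h k
      exact ⟨Pl k, Pr (k + 1), C, hC, h⟩
  · rintro ⟨⟨Pl0, Pr0, C, hC, h0⟩, h⟩
    choose Pl Pr C' hC' h using h
    refine ⟨Pl, fun | 0 => Pr0 | k + 1 => Pr k, ⟨C, hC, fun x => ?_⟩, fun k => ⟨C' k, hC' k, h k⟩⟩
    obtain ⟨h1, h2⟩ := h0 ⟨x, trivial⟩
    refine ⟨h1, ?_⟩
    have e : Pl0 ((0 : Adj A (E 0) (E 0)).toUOp ⟨x, trivial⟩) = 0 := map_zero _
    rwa [e, zero_add] at h2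

theorem isComplex_range {t : ∀ k, UOp A (E k) (E (k + 1))} (ht : IsComplex t) (k : ℕ) (x : E k)
    (m : E (k + 1)) (h : (x, m) ∈ (t k).gr) : (m, 0) ∈ (t (k + 1)).gr := by
  obtain ⟨hx, rfl⟩ := UOp.mem_gr.mp h
  exact UOp.mem_gr.mpr (ht.range_le_ker k ⟨x, hx⟩)

theorem IsComplex.of_gr {t : ∀ k, UOp A (E k) (E (k + 1))} (hr : ∀ k, (t k).IsRegular)
    (h : ∀ k x m, (x, m) ∈ (t k).gr → (m, 0) ∈ (t (k + 1)).gr) : IsComplex t :=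
  ⟨hr, fun k x => UOp.mem_gr.mp (h k _ _ ((t k).apply_mem_gr x))⟩

/-- The bounded Laplacian of a complex in degree `k`: the operator `Δ (1 + Δ)⁻¹`. -/
noncomputable def boundedLaplacian (t : ∀ k, UOp A (E k) (E (k + 1))) : ∀ k, Adj A (E k) (E k)
  | 0 => localLaplacian (0 : Adj A (E 0) (E 0)).toUOp (t 0)
  | k + 1 => localLaplacian (t k) (t (k + 1))

variable [StarOrderedRing A] [∀ k, CompleteSpace (E k)]

theorem zero_range (u : UOp A (E 0) (E 1)) (x m : E 0)
    (h : (x, m) ∈ (0 : Adj A (E 0) (E 0)).toUOp.gr) : (m, 0) ∈ u.gr := by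
  rw [← UOp.mem_gr_toUOp.mp h]
  exact u.gr.zero_mem

theorem exists_isJointParametrix_iff_essInv {t : ∀ k, UOp A (E k) (E (k + 1))}
    (ht : IsComplex t) :
    (∃ Pl Pr, IsJointParametrix t Pl Pr) ↔ ∀ k, EssInv (boundedLaplacian t k) := by
  rw [exists_isJointParametrix_iff, localFredholm_iff (ht.regular 0) (Adj.isRegular_toUOp 0)
    (zero_range (t 0))]
  simp only [fun k => localFredholm_iff (ht.regular (k + 1)) (ht.regular k) (isComplex_range ht k)]
  exact ⟨fun h => fun | 0 => h.1 | k + 1 => h.2 k, fun h => ⟨h 0, fun k => h (k + 1)⟩⟩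

theorem isFredholmComplex_iff {t : ∀ k, UOp A (E k) (E (k + 1))} (hE : FiniteLength E)
    (ht : IsComplex t) : IsFredholmComplex t ↔ ∀ k, EssInv (boundedLaplacian t k) := by
  rw [← exists_isJointParametrix_iff_essInv ht]
  exact ⟨fun h => h.2.2, fun h => ⟨hE, ht, h⟩⟩

/-- The adjoint of a complex is a chain complex. -/
theorem IsComplex.adjoint {t : ∀ k, UOp A (E k) (E (k + 1))} (ht : IsComplex t) :
    IsChainComplex fun k => (t k).adjoint := by
  refine ⟨fun k => (ht.regular k).adjoint, fun k x => UOp.mem_gr.mp ?_⟩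
  rw [UOp.mem_gr_adjoint (ht.regular k).dense_domain]
  intro a b hab
  have := UOp.formallyAdjoint (ht.regular (k + 1)).dense_domain _ _ (isComplex_range ht k a b hab)
    _ _ ((t (k + 1)).adjoint.apply_mem_gr x)
  rw [CStarModule.inner_zero_right, ← this, CStarModule.inner_zero_left]

theorem adjoint_range {t : ∀ k, UOp A (E k) (E (k + 1))} (ht : IsComplex t) (k : ℕ)
    (x : E (k + 2)) (m : E (k + 1)) (h : (x, m) ∈ (t (k + 1)).adjoint.gr) :
    (m, 0) ∈ (t k).adjoint.gr := by
  obtain ⟨hx, rfl⟩ := UOp.mem_gr.mp h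
  exact UOp.mem_gr.mpr (ht.adjoint.range_le_ker k ⟨x, hx⟩)

/-- Taking adjoints swaps incoming and outgoing differentials, so, as t** = t, the two summands of
the bounded Laplacian merely trade places. -/
theorem isFredholmChainComplex_adjoint_iff {t : ∀ k, UOp A (E k) (E (k + 1))}
    (hE : FiniteLength E) (ht : IsComplex t) :
    IsFredholmChainComplex (fun k => (t k).adjoint) ↔ ∀ k, EssInv (boundedLaplacian t k) := by
  have h0 := Adj.toUOp_adjoint (0 : Adj A (E 0) (E 0))
  rw [Adj.adj_zero] at h0
  have h1 : (∃ Pl Pr, IsChainJointParametrix (fun k => (t k).adjoint) Pl Pr) ↔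
      ∀ k, EssInv (boundedLaplacian t k) := by
    rw [exists_isChainJointParametrix_iff, localFredholm_iff h0.1 (ht.regular 0).adjoint
      fun x m _ => UOp.mem_gr_toUOp.mpr rfl]
    simp only [fun k => localFredholm_iff (ht.regular k).adjoint (ht.regular (k + 1)).adjoint
      (adjoint_range ht k)]
    have e0 : localLaplacian (t 0).adjoint (0 : Adj A (E 0) (E 0)).toUOp
        = boundedLaplacian t 0 := by
      rw [boundedLaplacian, localLaplacian, localLaplacian, h0.2,
        (ht.regular 0).adjoint_adjoint, add_comm]
    have e : ∀ k, localLaplacian (t (k + 1)).adjoint (t k).adjoint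
        = boundedLaplacian t (k + 1) := fun k => by
      rw [boundedLaplacian, localLaplacian, localLaplacian, (ht.regular (k + 1)).adjoint_adjoint]
      exact add_comm _ _
    rw [e0]
    simp only [e]
    exact ⟨fun h => fun | 0 => h.1 | k + 1 => h.2 k, fun h => ⟨h 0, fun k => h (k + 1)⟩⟩
  rw [← h1]
  exact ⟨fun h => h.2.2, fun h => ⟨hE, ht.adjoint, h⟩⟩

theorem isFredholmComplex_boundedTransform_iff {t : ∀ k, UOp A (E k) (E (k + 1))}
    (hE : FiniteLength E) (ht : IsComplex t) :
    IsFredholmComplex (fun k => (t k).boundedTransform) ↔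
      ∀ k, EssInv (boundedLaplacian t k) := by
  choose T hT hgr hTT hTT' using fun k => (ht.regular k).exists_boundedTransform
  -- The vector `T k x` lies in ker t_{k+1}, where Q_{k+1} is the identity, so applying t_{k+1}
  -- Q_{k+1} gives 0.
  have hz : ∀ k x, T (k + 1) (T k x) = 0 := fun k x => by
    have h1 := isComplex_range ht k _ _ (hgr k x)
    have h2 := hgr (k + 1) (T k x)
    rw [(ht.regular (k + 1)).invSqrt_of_mem_ker h1] at h2
    exact UOp.gr_unique h2 h1
  have hc : IsComplex fun k => (t k).boundedTransform := by
    simp only [hT]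
    refine IsComplex.of_gr (fun k => (T k).isRegular_toUOp) fun k x m h => ?_
    rw [UOp.mem_gr_toUOp] at h ⊢
    rw [← h, hz]
  have h1 : (∃ Pl Pr, IsJointParametrix (fun k => (t k).boundedTransform) Pl Pr) ↔
      ∀ k, EssInv (boundedLaplacian t k) := by
    rw [exists_isJointParametrix_iff]
    simp only [hT, localFredholm_toUOp_iff (hz _)]
    rw [localFredholm_toUOp_iff fun x => by simp]
    have e0 : (T 0).adj.comp (T 0) + (0 : Adj A (E 0) (E 0)).comp (0 : Adj A (E 0) (E 0)).adj
        = boundedLaplacian t 0 := by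
      rw [boundedLaplacian, localLaplacian, hTT, res_adjoint_zero]
      ext x
      simp
    have e : ∀ k, (T (k + 1)).adj.comp (T (k + 1)) + (T k).comp (T k).adj
        = boundedLaplacian t (k + 1) := fun k => by
      rw [boundedLaplacian, localLaplacian, hTT, hTT']
    rw [e0]
    simp only [e]
    exact ⟨fun h => fun | 0 => h.1 | k + 1 => h.2 k, fun h => ⟨h 0, fun k => h (k + 1)⟩⟩
  rw [← h1]
  exact ⟨fun h => h.2.2, fun h => ⟨hE, hc, h⟩⟩

theorem isFredholmComplex_graphComplex_iff {t : ∀ k, UOp A (E k) (E (k + 1))}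
    (hE : FiniteLength E) (ht : IsComplex t) :
    IsFredholmComplex (graphComplex t ht) ↔ ∀ k, EssInv (boundedLaplacian t k) := by
  have hcomp : ∀ k, CompleteSpace (GraphModule (t k)) := fun k =>
    GraphModule.completeSpace (t k) (ht.regular k).closed
  choose T hT hap hadj using fun k => GraphModule.exists_map_eq_toUOp (ht.regular k)
    (fun x => (ht.range_le_ker k x).1) fun x => (ht.range_le_ker k x).2
  have hT' : ∀ k, graphComplex t ht k = (T k).toUOp := hT
  have hz : ∀ k x, T (k + 1) (T k x) = 0 := fun k x => GraphModule.ext_coe <| by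
    rw [hap]
    obtain ⟨h1, h2⟩ := ht.range_le_ker k (GraphModule.toDomain (t k) x)
    refine Eq.trans ?_ h2
    congr 1
    exact Subtype.ext (hap k x)
  have hc : IsComplex (graphComplex t ht) := by
    refine IsComplex.of_gr (fun k => by rw [hT']; exact (T k).isRegular_toUOp) fun k x m h => ?_
    rw [hT', UOp.mem_gr_toUOp] at h ⊢
    rw [← h, hz]
  have hG : FiniteLength fun k => GraphModule (t k) := by
    obtain ⟨n, hn⟩ := hE
    refine ⟨n, fun k hk => ?_⟩
    have := hn k hk
    exact ⟨fun x y => GraphModule.ext_coe (Subsingleton.elim _ _)⟩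
  have hR : ∀ k z, (t k).tres.adj (t k (GraphModule.toDomain (t k) z))
      = (GraphModule.toDomain (t k) z : E k) - (t k).res (GraphModule.toDomain (t k) z) :=
    fun k z => (ht.regular k).isResolvent.adj_apply ((t k).apply_mem_gr _)
  -- If L commutes with Q and L' is L restricted to the domain, then the unitary given by Q
  -- intertwines them.
  have key : ∀ k (L : Adj A (E k) (E k)) (L' : Adj A (GraphModule (t k)) (GraphModule (t k))),
      L * (t k).invSqrt = (t k).invSqrt * L → L.adj = L → L'.adj = L' →
      (∀ z, (GraphModule.toDomain (t k) (L' z) : E k) = L (GraphModule.toDomain (t k) z)) →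
      (EssInv L' ↔ EssInv L) := by
    intro k L L' hLQ hL hL' h
    obtain ⟨U, hU, hU1, hU2⟩ := GraphModule.exists_unitary (ht.regular k)
    have e1 : U.comp L = L'.comp U := Adj.ext fun x => GraphModule.ext_coe <| by
      rw [Adj.comp_apply, Adj.comp_apply, hU, h, hU]
      exact (congrArg (fun S : Adj A (E k) (E k) => S x) hLQ).symm
    have e2 : U.adj.comp L' = L.comp U.adj := by
      have := congrArg Adj.adj e1
      rw [Adj.adj_comp, Adj.adj_comp, hL, hL'] at this
      exact this.symm
    exact ⟨fun h => h.of_intertwine hU1 e2 e1, fun h => h.of_intertwine hU2 e1 e2⟩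
  have hQR : ∀ k, (1 - (t k).res) * (t k).invSqrt = (t k).invSqrt * (1 - (t k).res) := fun k =>
    Adj.ext fun x => by
      simp only [Adj.mul_apply, Adj.sub_apply, Adj.one_apply, map_sub,
        (ht.regular k).invSqrt_res]
  -- The range of 1 - R'_k lies in ker t_{k+1}, which Q_{k+1} fixes; the adjoint of this identity
  -- gives the other order of the product.
  have hQR' : ∀ k, (1 - (t k).adjoint.res) * (t (k + 1)).invSqrt
      = (t (k + 1)).invSqrt * (1 - (t k).adjoint.res) := fun k => by
    have h1 : (t (k + 1)).invSqrt * (1 - (t k).adjoint.res) = 1 - (t k).adjoint.res :=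
      Adj.ext fun x => (ht.regular (k + 1)).invSqrt_of_mem_ker
        (isComplex_range ht k _ _ ((ht.regular k).isResolvent.adj_mem x))
    have h2 := congrArg Adj.adj h1
    rw [Adj.adj_mul, Adj.adj_sub, Adj.adj_one, (ht.regular (k + 1)).invSqrt_adj,
      (ht.regular k).adjoint.res_adj] at h2
    rw [h1, h2]
  have h1 : (∃ Pl Pr, IsJointParametrix (graphComplex t ht) Pl Pr) ↔
      ∀ k, EssInv (boundedLaplacian t k) := by
    refine (exists_isJointParametrix_iff (E := fun k => GraphModule (t k))).trans ?_
    simp only [hT', localFredholm_toUOp_iff (hz _)]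
    rw [localFredholm_toUOp_iff fun x => by simp]
    rw [key 0 (boundedLaplacian t 0) _ ?_ (localLaplacian_adj (ht.regular 0) (Adj.isRegular_toUOp 0))
      (by simp) ?_]
    · have := fun k => key (k + 1) (boundedLaplacian t (k + 1))
        ((T (k + 1)).adj.comp (T (k + 1)) + (T k).comp (T k).adj) ?_
        (localLaplacian_adj (ht.regular (k + 1)) (ht.regular k)) (by simp) ?_
      · simp only [this]
        exact ⟨fun h => fun | 0 => h.1 | k + 1 => h.2 k, fun h => ⟨h 0, fun k => h (k + 1)⟩⟩
      · rw [boundedLaplacian, localLaplacian, add_mul, mul_add, hQR, hQR']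
      · intro z
        rw [Adj.add_apply, map_add, Submodule.coe_add, Adj.comp_apply, Adj.comp_apply, hadj, hap,
          hap, hR, boundedLaplacian, localLaplacian, Adj.add_apply, Adj.sub_apply, Adj.one_apply]
        congr 1
        refine UOp.gr_unique ((t k).apply_mem_gr _) ?_
        rw [hadj]
        exact (ht.regular k).isResolvent.adj_mem _
    · rw [boundedLaplacian, localLaplacian, res_adjoint_zero, sub_self, add_zero, hQR]
    · intro z
      rw [Adj.add_apply, map_add, Submodule.coe_add, Adj.comp_apply, hadj, hap,
        hR, boundedLaplacian, localLaplacian, res_adjoint_zero]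
      simp
  rw [← h1]
  exact ⟨fun h => h.2.2, fun h => ⟨hG, hc, h⟩⟩

end Complexes

/-! ### Finite orthogonal sums -/

section DirectSum

set_option linter.unusedSectionVars false

variable {A : Type u} [NonUnitalCStarAlgebra A] [PartialOrder A] [StarOrderedRing A]
variable {ι : Type} [Fintype ι] {M : ι → Type v} [∀ i, NormedAddCommGroup (M i)]
  [∀ i, NormedSpace ℂ (M i)] [∀ i, SMul A (M i)] [∀ i, CStarModule A (M i)]

theorem exists_diag (L : ∀ i, Adj A (M i) (M i)) :
    ∃ T : Adj A C⋆ᵐᵒᵈ(A, Π i, M i) C⋆ᵐᵒᵈ(A, Π i, M i), ∀ x i, T x i = L i (x i) := by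
  have key : ∀ L : ∀ i, Adj A (M i) (M i), ∃ T : C⋆ᵐᵒᵈ(A, Π i, M i) →L[ℂ] C⋆ᵐᵒᵈ(A, Π i, M i),
      ∀ x i, T x i = L i (x i) := fun L => by
    refine ⟨LinearMap.mkContinuous
      { toFun := fun x => (WithCStarModule.equiv A (Π i, M i)).symm fun i => L i (x i)
        map_add' := fun x y => by ext i; exact map_add (L i).toContinuousLinearMap _ _
        map_smul' := fun c x => by ext i; exact map_smul (L i).toContinuousLinearMap _ _ }
      (∑ i, ‖(L i).toContinuousLinearMap‖) fun x => ?_, fun x i => rfl⟩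
    refine (WithCStarModule.pi_norm_le_sum_norm _).trans ?_
    rw [Finset.sum_mul]
    refine Finset.sum_le_sum fun i _ => ((L i).toContinuousLinearMap.le_opNorm _).trans ?_
    gcongr
    exact WithCStarModule.norm_apply_le_norm x i
  obtain ⟨T, hT⟩ := key L
  obtain ⟨S, hS⟩ := key fun i => (L i).adj
  refine ⟨⟨T, S, fun x y => ?_⟩, hT⟩
  rw [WithCStarModule.pi_inner, WithCStarModule.pi_inner]
  exact Finset.sum_congr rfl fun i _ => by rw [hT, hS, Adj.inner_left]

/-- The orthogonal sum of adjointable operators. -/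
noncomputable def diag (L : ∀ i, Adj A (M i) (M i)) :
    Adj A C⋆ᵐᵒᵈ(A, Π i, M i) C⋆ᵐᵒᵈ(A, Π i, M i) := (exists_diag L).choose

@[simp]
theorem diag_apply (L : ∀ i, Adj A (M i) (M i)) (x : C⋆ᵐᵒᵈ(A, Π i, M i)) (i : ι) :
    diag L x i = L i (x i) := (exists_diag L).choose_spec x i

theorem adj_ext_pi {E : Type*} [NormedAddCommGroup E] [NormedSpace ℂ E] [SMul A E]
    [CStarModule A E] {S T : Adj A E C⋆ᵐᵒᵈ(A, Π i, M i)} (h : ∀ x i, S x i = T x i) : S = T :=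
  Adj.ext fun x => WithCStarModule.ext fun i => h x i

theorem diag_adj (L : ∀ i, Adj A (M i) (M i)) : (diag L).adj = diag fun i => (L i).adj := by
  refine (Adj.eq_adj fun x y => ?_).symm
  rw [WithCStarModule.pi_inner, WithCStarModule.pi_inner]
  exact Finset.sum_congr rfl fun i _ => by rw [diag_apply, diag_apply, Adj.inner_left]

theorem one_sub_diag (L : ∀ i, Adj A (M i) (M i)) : 1 - diag L = diag fun i => 1 - L i :=
  adj_ext_pi fun x i => by simp

theorem diag_mul (L S : ∀ i, Adj A (M i) (M i)) : diag L * diag S = diag fun i => L i * S i :=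
  adj_ext_pi fun x i => by simp

theorem exists_single [DecidableEq ι] (i : ι) :
    ∃ J : Adj A (M i) C⋆ᵐᵒᵈ(A, Π i, M i),
      (∀ y, J y = (WithCStarModule.equiv A (Π i, M i)).symm (Pi.single i y)) ∧
      ∀ x, J.adj x = x i := by
  let J : M i →L[ℂ] C⋆ᵐᵒᵈ(A, Π i, M i) := LinearMap.mkContinuous
    { toFun := fun y => (WithCStarModule.equiv A (Π i, M i)).symm (Pi.single i y)
      map_add' := fun x y => by ext j; simp [Pi.single_add]
      map_smul' := fun c y => by ext j; simp [Pi.single_smul] } 1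
    fun y => by
      rw [one_mul]
      exact (WithCStarModule.norm_single i y).le
  let P : C⋆ᵐᵒᵈ(A, Π i, M i) →L[ℂ] M i := LinearMap.mkContinuous
    { toFun := fun x => x i
      map_add' := fun x y => rfl
      map_smul' := fun c y => rfl } 1 fun x => by
      rw [one_mul]
      exact WithCStarModule.norm_apply_le_norm x i
  have h : ∀ y x, ⟪J y, x⟫_A = ⟪y, P x⟫_A := fun y x =>
    WithCStarModule.inner_single_left x y
  let J' : Adj A (M i) C⋆ᵐᵒᵈ(A, Π i, M i) := ⟨J, P, h⟩
  exact ⟨J', fun y => rfl, fun x => ext_inner A fun y => by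
    rw [← Adj.inner_left]
    exact h y x⟩

theorem sum_single [DecidableEq ι] (x : C⋆ᵐᵒᵈ(A, Π i, M i)) :
    ∑ i, (WithCStarModule.equiv A (Π i, M i)).symm (Pi.single i (x i)) = x := by
  have h : ∑ i, Pi.single i (x i) = (WithCStarModule.equiv A (Π i, M i)) x :=
    Finset.univ_sum_single (WithCStarModule.equiv A (Π i, M i) x)
  have h2 := congrArg (WithCStarModule.linearEquiv ℂ A (Π i, M i)).symm h
  rw [map_sum] at h2
  exact h2

theorem diag_single [DecidableEq ι] (L : ∀ i, Adj A (M i) (M i)) (i : ι) (y : M i) :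
    diag L ((WithCStarModule.equiv A (Π i, M i)).symm (Pi.single i y)) =
      (WithCStarModule.equiv A (Π i, M i)).symm (Pi.single i (L i y)) := by
  ext j
  rw [diag_apply, WithCStarModule.equiv_symm_pi_apply, WithCStarModule.equiv_symm_pi_apply]
  rcases eq_or_ne j i with rfl | h
  · simp
  · simp [Pi.single_eq_of_ne h]

theorem isCompact_diag {L : ∀ i, Adj A (M i) (M i)} (h : ∀ i, (L i).IsCompact) :
    (diag L).IsCompact := by
  classical
  choose J hJ hJ' using fun i => exists_single (A := A) (M := M) i
  have e : diag L = ∑ i, (J i).comp ((L i).comp (J i).adj) := by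
    refine Adj.ext fun x => ?_
    have e1 : (∑ i, (J i).comp ((L i).comp (J i).adj)) x
        = ∑ i, (J i).comp ((L i).comp (J i).adj) x := by
      have := congrArg (fun T : C⋆ᵐᵒᵈ(A, Π i, M i) →L[ℂ] C⋆ᵐᵒᵈ(A, Π i, M i) => T x)
        (map_sum (Adj.toCLMHom A _ _) (fun i => (J i).comp ((L i).comp (J i).adj)) Finset.univ)
      exact this.trans (_root_.sum_apply _ _ _)
    rw [e1]
    refine (sum_single (A := A) (M := M) (diag L x)).symm.trans ?_
    refine Finset.sum_congr rfl fun i _ => ?_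
    rw [Adj.comp_apply, Adj.comp_apply, hJ, hJ', diag_apply]
  rw [e]
  have : ∀ s : Finset ι, (∑ i ∈ s, (J i).comp ((L i).comp (J i).adj)).IsCompact := fun s => by
    classical
    induction s using Finset.induction_on with
    | empty => exact Adj.IsCompact.zero
    | insert i s hi ih =>
      rw [Finset.sum_insert hi]
      exact (((h i).comp_right _).comp_left _).add ih
  exact this _

/-- An inverse of the sum is compressed to a summand by the coordinate inclusion and its adjoint;
inverses of the summands are assembled diagonally. -/
theorem essInv_diag_iff {L : ∀ i, Adj A (M i) (M i)} :
    EssInv (diag L) ↔ ∀ i, EssInv (L i) := by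
  classical
  constructor
  · rintro ⟨S, h1, h2⟩ i
    obtain ⟨J, hJ, hJ'⟩ := exists_single (A := A) (M := M) i
    refine ⟨J.adj.comp (S.comp J), ?_, ?_⟩
    · have : 1 - J.adj.comp (S.comp J) * L i = J.adj.comp ((1 - S * diag L).comp J) := by
        ext y
        simp [hJ, hJ', diag_single]
      rw [this]
      exact (h1.comp_right _).comp_left _
    · have : 1 - L i * J.adj.comp (S.comp J) = J.adj.comp ((1 - diag L * S).comp J) := by
        ext y
        simp [hJ, hJ']
      rw [this]
      exact (h2.comp_right _).comp_left _
  · intro h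
    choose S h1 h2 using h
    refine ⟨diag S, ?_, ?_⟩
    · rw [diag_mul, one_sub_diag]
      exact isCompact_diag h1
    · rw [diag_mul, one_sub_diag]
      exact isCompact_diag h2

theorem denseRange_diag {L : ∀ i, Adj A (M i) (M i)} (h : ∀ i, DenseRange (L i)) :
    DenseRange (diag L) := by
  classical
  choose J hJ hJ' using fun i => exists_single (A := A) (M := M) i
  intro x
  change x ∈ (LinearMap.range (diag L).toLinearMap).topologicalClosure
  rw [← sum_single x]
  refine Submodule.sum_mem _ fun i _ => ?_
  rw [← hJ]
  refine map_mem_closure (J i).continuous (h i (x i)) ?_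
  rintro _ ⟨y, rfl⟩
  refine ⟨J i y, ?_⟩
  change diag L (J i y) = J i (L i y)
  rw [hJ, hJ, diag_single]

theorem mem_gr_directSum {T : ∀ i, UOp A (M i) (M i)} {x y : C⋆ᵐᵒᵈ(A, Π i, M i)} :
    (x, y) ∈ (directSum T).gr ↔ ∀ i, (x i, y i) ∈ (T i).gr := by
  simp only [UOp.mem_gr]
  constructor
  · rintro ⟨h, rfl⟩ i
    exact ⟨h i, rfl⟩
  · intro h
    exact ⟨fun i => (h i).1, WithCStarModule.ext fun i => (h i).2⟩

end DirectSum

/-! ### The Laplace operator -/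

section Laplace

set_option linter.unusedSectionVars false

variable {A : Type u} [NonUnitalCStarAlgebra A] [PartialOrder A] [StarOrderedRing A]
variable {E : Type*} [NormedAddCommGroup E] [NormedSpace ℂ E] [SMul A E] [CStarModule A E]
  [CompleteSpace E]

/-- An operator `T` with densely defined inverse of the self-adjoint bounded operator
`G = (1 + T)⁻¹` is regular. -/
theorem isRegular_of_inverse {T : UOp A E E} {G : Adj A E E} (hG : G.adj = G)
    (hd : DenseRange G) (hT : ∀ x y, (x, y) ∈ T.gr ↔ G (x + y) = x) : T.IsRegular := by
  have hf : FormallyAdjoint A T.gr T.gr := fun x y hx a b ha => by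
    rw [hT] at hx ha
    have h1 : ⟪G (x + y), a + b⟫_A = ⟪x + y, G (a + b)⟫_A := by rw [Adj.inner_left, hG]
    rw [hx, ha, CStarModule.inner_add_left, CStarModule.inner_add_right] at h1
    exact (add_left_cancel h1).symm
  have hs : ∀ x, ∃ y, (x, y) ∈ solutions T.gr T.gr := fun x => by
    -- Formally T = (1 - G) G⁻¹, so 1 + T² = (G² + (1 - G)²) G⁻², and 2 (G² + (1 - G)²) = 1 + (1 - 2
    -- G)² is invertible. With s solving (G² + (1 - G)²) s = x, the solution is a = G² s, T a = (G -
    -- G²) s, T² a = (1 - G)² s.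
    set V : Adj A E E := 1 - (2 : ℂ) • G with hV
    obtain ⟨S, -, hS⟩ := Adj.exists_inverse (T := 1 + V.adj.comp V) fun x => by
      simp only [Adj.add_apply, Adj.one_apply, Adj.comp_apply, CStarModule.inner_add_right,
        ← Adj.inner_left]
      exact le_add_of_nonneg_right CStarModule.inner_self_nonneg
    set s := (2 : ℂ) • S x with hs
    have h1 : x = G (G s) + (s - (2 : ℂ) • G s + G (G s)) := by
      have : (1 + V.adj.comp V) (S x) = x := congrArg (fun U : Adj A E E => U x) hS
      conv_lhs => rw [← this]
      simp only [hV, Adj.adj_sub, Adj.adj_smul, Adj.adj_one, hG, Adj.add_apply, Adj.one_apply,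
        Adj.comp_apply, Adj.sub_apply, Adj.smul_apply, map_sub, map_smul, hs]
      rw [show star (2 : ℂ) = 2 by simp]
      module
    refine ⟨(G (G s), G s - G (G s)), (hT _ _).mpr ?_, (hT _ _).mpr ?_⟩
    · congr 1
      abel
    · dsimp only
      have e : x - G (G s) = s - (2 : ℂ) • G s + G (G s) := sub_eq_iff_eq_add'.mpr h1
      have e' : G s - G (G s) + (x - G (G s)) = s - G s := by
        rw [e]
        module
      rw [e', map_sub]
  obtain ⟨R, B, R', h⟩ := hf.exists_isResolvent hs hs
  have hdT : Dense (T.domain : Set E) := hd.mono (by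
    rintro _ ⟨x, rfl⟩
    exact UOp.mem_domain_iff.mpr ⟨x - G x, (hT _ _).mpr (by rw [add_sub_cancel])⟩)
  exact (h.isRegular hdT (by rwa [← UOp.coe_domain])).1

/-- An operator `T` with self-adjoint bounded inverse `G = (1 + T)⁻¹` is Fredholm if and only if
`T (1 + T)⁻¹` is invertible modulo compact operators. -/
theorem isFredholm_iff_of_inverse {T : UOp A E E} {G : Adj A E E} (hG : G.adj = G)
    (hd : DenseRange G) (hT : ∀ x y, (x, y) ∈ T.gr ↔ G (x + y) = x) :
    T.IsFredholm ↔ EssInv (1 - G) := by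
  have hmem : ∀ x, (G x, x - G x) ∈ T.gr := fun x => (hT _ _).mpr (by rw [add_sub_cancel])
  constructor
  · rintro ⟨-, Pl, Pr, Cl, Cr, hCl, hCr, h1, h2⟩
    -- Since 1 - G = T G, one has Pl (1 - G) = G - Cl G, and adding 1 - G leaves 1 - Cl G.
    refine EssInv.of_left (S := 1 + Pl) (by simp [hG]) ?_
    have : 1 - (1 + Pl) * (1 - G) = Cl * G := by
      ext x
      obtain ⟨h3, h4⟩ := UOp.mem_gr.mp (hmem x)
      have h5 := h1 ⟨G x, h3⟩
      rw [h4, map_sub] at h5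
      change Pl x - Pl (G x) = G x - Cl (G x) at h5
      rw [sub_eq_iff_eq_add] at h5
      simp only [Adj.sub_apply, Adj.one_apply, Adj.mul_apply, Adj.add_apply, map_sub, h5]
      abel
    rw [this]
    exact hCl.mul_right G
  · rintro ⟨S, h1, h2⟩
    -- G T = 1 - G on dom T and T G = 1 - G, so both errors are those of S against 1 - G.
    refine ⟨isRegular_of_inverse hG hd hT, S * G, G * S, _, _, h1, h2, fun x => ?_, fun y => ?_⟩
    · have h3 := (hT _ _).mp (T.apply_mem_gr x)
      have h4 : G (T x) = x - G x := by
        rw [map_add] at h3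
        exact eq_sub_of_add_eq' h3
      simp [h4]
    · obtain ⟨h3, h4⟩ := UOp.mem_gr.mp (hmem (S y))
      refine ⟨h3, h4.trans ?_⟩
      simp

variable {E : ℕ → Type v} [∀ k, NormedAddCommGroup (E k)] [∀ k, NormedSpace ℂ (E k)]
  [∀ k, SMul A (E k)] [∀ k, CStarModule A (E k)] [∀ k, CompleteSpace (E k)]
  {t : ∀ k, UOp A (E k) (E (k + 1))}

theorem one_sub_boundedLaplacian_zero : 1 - boundedLaplacian t 0 = (t 0).res := by
  rw [boundedLaplacian, localLaplacian, res_adjoint_zero]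
  abel

theorem one_sub_boundedLaplacian_succ (ht : IsComplex t) (k : ℕ) :
    1 - boundedLaplacian t (k + 1) = (t (k + 1)).res * (t k).adjoint.res :=
  one_sub_localLaplacian (ht.regular (k + 1)) (ht.regular k) (isComplex_range ht k)

theorem one_sub_boundedLaplacian_succ' (ht : IsComplex t) (k : ℕ) :
    1 - boundedLaplacian t (k + 1) = (t k).adjoint.res * (t (k + 1)).res := by
  rw [one_sub_boundedLaplacian_succ ht, res_mul_res (ht.regular (k + 1)) (ht.regular k)
    (isComplex_range ht k), res_mul_res' (ht.regular (k + 1)) (ht.regular k)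
    (isComplex_range ht k)]

theorem boundedLaplacian_adj (ht : IsComplex t) :
    ∀ k, (boundedLaplacian t k).adj = boundedLaplacian t k
  | 0 => localLaplacian_adj (ht.regular 0) (Adj.isRegular_toUOp 0)
  | k + 1 => localLaplacian_adj (ht.regular (k + 1)) (ht.regular k)

theorem one_sub_boundedLaplacian_adj (ht : IsComplex t) (k : ℕ) :
    (1 - boundedLaplacian t k).adj = 1 - boundedLaplacian t k := by
  rw [Adj.adj_sub, Adj.adj_one, boundedLaplacian_adj ht]

theorem denseRange_one_sub_boundedLaplacian (ht : IsComplex t) :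
    ∀ k, DenseRange (1 - boundedLaplacian t k).toContinuousLinearMap
  | 0 => by
    rw [one_sub_boundedLaplacian_zero]
    exact (ht.regular 0).denseRange_res
  | k + 1 => by
    rw [one_sub_boundedLaplacian_succ ht]
    exact (ht.regular (k + 1)).denseRange_res.comp (ht.regular k).adjoint.denseRange_res
      (t (k + 1)).res.continuous

/-- The resolvent of the Laplace operator is `1` minus the bounded Laplacian. -/
theorem mem_gr_laplaceAt (ht : IsComplex t) : ∀ (k : ℕ) (x y : E k),
    (x, y) ∈ (laplaceAt t k).gr ↔ (1 - boundedLaplacian t k) (x + y) = x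
  | 0, x, y => by
    have hR := (ht.regular 0).isResolvent
    rw [one_sub_boundedLaplacian_zero, laplaceAt, UOp.mem_gr_comp]
    constructor
    · rintro ⟨a, h1, h2⟩
      exact (hR.eq_of_mem h1 (by rwa [add_sub_cancel_left])).1
    · intro h
      have h1 := hR.mem (x + y)
      have h2 := hR.mem_adj (x + y)
      rw [h] at h1 h2
      rw [add_sub_cancel_left] at h2
      exact ⟨_, h1, h2⟩
  | k + 1, x, y => by
    have hR := (ht.regular (k + 1)).isResolvent
    have hR' := (ht.regular k).isResolvent.symm
    rw [laplaceAt, UOp.mem_gr_add]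
    simp only [UOp.mem_gr_comp]
    constructor
    · rintro ⟨y1, y2, ⟨a, h1, h2⟩, ⟨b, h3, h4⟩, rfl⟩
      rw [one_sub_boundedLaplacian_succ ht, Adj.mul_apply]
      -- Here y1 = t_{k+1}* t_{k+1} x is killed by t_k*, so R' fixes it, and R R' strips the two
      -- summands of 1 + Δ one after the other.
      have e1 : (t k).adjoint.res y1 = y1 := hR'.apply_of_mem_ker (adjoint_range ht k _ _ h2)
      have e2 : (t k).adjoint.res (x + y2) = x :=
        (hR'.eq_of_mem h3 (by rwa [add_sub_cancel_left])).1
      have e3 : x + (y1 + y2) = x + y2 + y1 := by abel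
      rw [e3, map_add, e1, e2]
      exact (hR.eq_of_mem h1 (by rwa [add_sub_cancel_left])).1
    · intro h
      have g1 : (t (k + 1)).res ((t k).adjoint.res (x + y)) = x := by
        rwa [one_sub_boundedLaplacian_succ ht] at h
      have g2 : (t k).adjoint.res ((t (k + 1)).res (x + y)) = x := by
        rwa [one_sub_boundedLaplacian_succ' ht] at h
      -- R R' = R + R' - 1 guarantees that the two candidate summands, R'(x + y) - x and R(x + y) -
      -- x, add up to y.
      have g3 : (t (k + 1)).res (x + y) + (t k).adjoint.res (x + y) - (x + y) = x := by
        have := congrArg (fun S : Adj A _ _ => S (x + y)) (res_mul_res (ht.regular (k + 1))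
          (ht.regular k) (isComplex_range ht k))
        exact this.symm.trans g1
      refine ⟨(t k).adjoint.res (x + y) - x, (t (k + 1)).res (x + y) - x,
        ⟨(t (k + 1)).tres ((t k).adjoint.res (x + y)), ?_, ?_⟩,
        ⟨(t k).tres.adj ((t (k + 1)).res (x + y)), ?_, ?_⟩, ?_⟩
      · have := hR.mem ((t k).adjoint.res (x + y))
        rwa [g1] at this
      · have := hR.mem_adj ((t k).adjoint.res (x + y))
        rwa [g1] at this
      · have := hR'.mem ((t (k + 1)).res (x + y))
        rwa [g2] at this
      · have := hR'.mem_adj ((t (k + 1)).res (x + y))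
        rwa [g2] at this
      · rw [sub_eq_iff_eq_add] at g3
        have : (t (k + 1)).res (x + y) = x + (x + y) - (t k).adjoint.res (x + y) :=
          eq_sub_of_add_eq g3
        rw [this]
        abel

theorem laplace_isFredholm_iff (ht : IsComplex t) (N : ℕ) :
    (laplace N t).IsFredholm ↔ ∀ k : Fin (N + 2), EssInv (boundedLaplacian t k) := by
  rw [laplace, isFredholm_iff_of_inverse (G := diag fun k : Fin (N + 2) => 1 - boundedLaplacian t k),
    one_sub_diag, essInv_diag_iff]
  · simp only [sub_sub_cancel]
  · simp only [diag_adj, one_sub_boundedLaplacian_adj ht]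
  · exact denseRange_diag fun k => denseRange_one_sub_boundedLaplacian ht k
  · intro x y
    rw [mem_gr_directSum]
    simp only [mem_gr_laplaceAt ht]
    constructor
    · intro h
      ext k
      rw [diag_apply]
      exact h k
    · intro h k
      have := congrArg (fun z : C⋆ᵐᵒᵈ(A, Π k : Fin (N + 2), E k) => z k) h
      simp only [diag_apply] at this
      exact this

end Laplace

theorem UOp.apply_eq_zero {A : Type u} {E F : Type*} [NormedAddCommGroup E] [NormedSpace ℂ E]
    [SMul A E] [NormedAddCommGroup F] [NormedSpace ℂ F] [SMul A F] (t : UOp A E F) {x : t.domain}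
    (hx : (x : E) = 0) : t x = 0 := by
  obtain rfl : x = 0 := Subtype.ext hx
  exact map_zero t.toFun

/-! ### Fredholm operators through their two resolvents -/

section Fredholm

variable {A : Type u} [NonUnitalCStarAlgebra A] [PartialOrder A] [StarOrderedRing A]
variable {E : Type*} [NormedAddCommGroup E] [NormedSpace ℂ E] [SMul A E] [CStarModule A E]
  [CompleteSpace E]
variable {F : Type*} [NormedAddCommGroup F] [NormedSpace ℂ F] [SMul A F] [CStarModule A F]
  [CompleteSpace F]

/-- A left parametrix is a parametrix at E of the sequence 0, t, and a right one a parametrix at F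
of t, 0; a zero differential contributes nothing to the local Laplacian. -/
theorem UOp.IsRegular.isFredholm_iff {t : UOp A E F} (ht : t.IsRegular) :
    t.IsFredholm ↔ EssInv (1 - t.res) ∧ EssInv (1 - t.adjoint.res) := by
  have e1 : localLaplacian (0 : Adj A E E).toUOp t = 1 - t.res := by
    rw [localLaplacian, res_adjoint_zero, sub_self, add_zero]
  have e2 : localLaplacian t (0 : Adj A F F).toUOp = 1 - t.adjoint.res := by
    rw [localLaplacian, res_zero, sub_self, zero_add]
  rw [← e1, ← e2, ← localFredholm_iff ht (Adj.isRegular_toUOp 0) fun x m h => by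
      rw [← UOp.mem_gr_toUOp.mp h]
      exact t.gr.zero_mem,
    ← localFredholm_iff (Adj.isRegular_toUOp 0) ht fun x m _ => UOp.mem_gr_toUOp.mpr rfl]
  constructor
  · rintro ⟨-, Pl, Pr, Cl, Cr, hCl, hCr, h1, h2⟩
    refine ⟨⟨Pl, 0, Cl, hCl, fun x y hxy => UOp.mem_gr_toUOp.mpr ?_⟩,
      ⟨0, Pr, Cr, hCr, fun x y _ => UOp.mem_gr.mpr ?_⟩⟩
    · obtain ⟨hx, rfl⟩ := UOp.mem_gr.mp hxy
      rw [h1 ⟨x, hx⟩]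
      exact (sub_self _).symm
    · obtain ⟨h3, h4⟩ := h2 x
      exact ⟨h3, by rw [h4]; exact (sub_zero _).symm⟩
  · rintro ⟨⟨Pl, _, Cl, hCl, h1⟩, ⟨Pl', Pr, Cr, hCr, h2⟩⟩
    refine ⟨ht, Pl, Pr, Cl, Cr, hCl, hCr, fun x => ?_, fun y => ?_⟩
    · have := UOp.mem_gr_toUOp.mp (h1 _ _ (t.apply_mem_gr x))
      exact (sub_eq_zero.mp this.symm).symm
    · have := h2 y 0 (UOp.mem_gr_toUOp.mpr rfl)
      rw [map_zero, sub_zero] at this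
      exact UOp.mem_gr.mp this

end Fredholm

/-! ### The even Dirac operator -/

section Dirac

set_option linter.unusedSectionVars false

variable {A : Type u} [NonUnitalCStarAlgebra A] [PartialOrder A]
variable {E : ℕ → Type v} [∀ k, NormedAddCommGroup (E k)] [∀ k, NormedSpace ℂ (E k)]
  [∀ k, SMul A (E k)] [∀ k, CStarModule A (E k)]

/-- The graph of `t + t*` on graded families. -/
def rollGraph (t : ∀ k, UOp A (E k) (E (k + 1))) : Submodule ℂ ((∀ n, E n) × (∀ n, E n)) where
  carrier := {p | ∃ (α : ∀ n, E (n + 1)) (β : ∀ n, E n), (∀ n, (p.1 n, α n) ∈ (t n).gr) ∧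
    (∀ n, (p.1 (n + 1), β n) ∈ (t n).adjoint.gr) ∧ p.2 0 = β 0 ∧
    ∀ n, p.2 (n + 1) = α n + β (n + 1)}
  add_mem' := by
    rintro p q ⟨α, β, h1, h2, h3, h4⟩ ⟨α', β', h1', h2', h3', h4'⟩
    refine ⟨α + α', β + β', fun n => (t n).gr.add_mem (h1 n) (h1' n),
      fun n => (t n).adjoint.gr.add_mem (h2 n) (h2' n), ?_, fun n => ?_⟩
    · exact congrArg₂ (· + ·) h3 h3'
    · exact (congrArg₂ (· + ·) (h4 n) (h4' n)).trans (add_add_add_comm _ _ _ _)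
  zero_mem' := ⟨0, 0, fun n => (t n).gr.zero_mem, fun n => (t n).adjoint.gr.zero_mem, rfl,
    fun n => (add_zero _).symm⟩
  smul_mem' := by
    rintro c p ⟨α, β, h1, h2, h3, h4⟩
    refine ⟨c • α, c • β, fun n => (t n).gr.smul_mem c (h1 n),
      fun n => (t n).adjoint.gr.smul_mem c (h2 n), ?_, fun n => ?_⟩
    · exact congrArg (c • ·) h3
    · exact (congrArg (c • ·) (h4 n)).trans (smul_add _ _ _)

theorem mem_rollGraph_iff {t : ∀ k, UOp A (E k) (E (k + 1))} {x y : ∀ n, E n} :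
    (x, y) ∈ rollGraph t ↔ ∃ h : x ∈ rollDomain t, ∀ n, roll t ⟨x, h⟩ n = y n := by
  constructor
  · rintro ⟨α, β, h1, h2, h3, h4⟩
    choose a1 a2 using fun n => UOp.mem_gr.mp (h1 n)
    choose b1 b2 using fun n => UOp.mem_gr.mp (h2 n)
    refine ⟨fun n => ⟨a1 n, b1 n⟩, fun n => ?_⟩
    cases n with
    | zero => exact (b2 0).trans h3.symm
    | succ n => exact (congrArg₂ (· + ·) (a2 n) (b2 (n + 1))).trans (h4 n).symm
  · rintro ⟨h, h'⟩
    exact ⟨fun n => t n ⟨x n, (h n).1⟩, fun n => (t n).adjoint ⟨x (n + 1), (h n).2⟩,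
      fun n => UOp.mem_gr.mpr ⟨(h n).1, rfl⟩, fun n => UOp.mem_gr.mpr ⟨(h n).2, rfl⟩,
      (h' 0).symm, fun n => (h' (n + 1)).symm⟩

variable (A E) in
/-- The orthogonal sum of the modules in the degrees `0, …, N + 1` satisfying `P`. -/
abbrev PartSum (P : ℕ → Prop) (N : ℕ) : Type v :=
  C⋆ᵐᵒᵈ(A, Π k : {k : Fin (N + 2) // P k}, E (k.1 : ℕ))

open Classical in
/-- The graded family of the components of an element of an orthogonal sum. -/
noncomputable def component (P : ℕ → Prop) (N : ℕ) : PartSum A E P N →ₗ[ℂ] ∀ n, E n where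
  toFun x n := if h : n < N + 2 ∧ P n then x ⟨⟨n, h.1⟩, h.2⟩ else 0
  map_add' x y := by
    ext n
    simp only [Pi.add_apply]
    split_ifs <;> simp
  map_smul' c x := by
    ext n
    simp only [Pi.smul_apply, RingHom.id_apply]
    split_ifs <;> simp

theorem component_of_mem {P : ℕ → Prop} {N n : ℕ} (x : PartSum A E P N) (hn : n < N + 2)
    (hP : P n) : component P N x n = x ⟨⟨n, hn⟩, hP⟩ :=
  dif_pos ⟨hn, hP⟩

theorem component_of_not {P : ℕ → Prop} {N n : ℕ} (x : PartSum A E P N)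
    (h : ¬ (n < N + 2 ∧ P n)) : component P N x n = 0 :=
  dif_neg h

theorem evenComponent_eq {N : ℕ} (x : EvenSum A E N) : evenComponent x = component Even N x := by
  ext n
  by_cases h : n < N + 2 ∧ Even n
  · rw [component_of_mem x h.1 h.2, evenComponent, dif_pos h]
  · rw [component_of_not x h, evenComponent, dif_neg h]

/-- A family vanishing outside the degrees in question comes from the orthogonal sum. -/
theorem exists_component_eq {P : ℕ → Prop} {N : ℕ} (y : ∀ n, E n)
    (hy : ∀ n, ¬ (n < N + 2 ∧ P n) → y n = 0) : ∃ x : PartSum A E P N, component P N x = y := by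
  refine ⟨(WithCStarModule.equiv A (Π k : {k : Fin (N + 2) // P k}, E (k.1 : ℕ))).symm
    fun k => y k.1, funext fun n => ?_⟩
  by_cases h : n < N + 2 ∧ P n
  · rw [component_of_mem _ h.1 h.2]
    rfl
  · rw [component_of_not _ h, hy n h]

/-- The graph of the part of `t + t*` from the degrees satisfying `P` to those satisfying `Q`. -/
noncomputable def diracGraph (P Q : ℕ → Prop) (N : ℕ) (t : ∀ k, UOp A (E k) (E (k + 1))) :
    Submodule ℂ (PartSum A E P N × PartSum A E Q N) :=
  (rollGraph t).comap ((component P N).prodMap (component Q N))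

theorem mem_diracGraph {P Q : ℕ → Prop} {N : ℕ} {t : ∀ k, UOp A (E k) (E (k + 1))}
    {x : PartSum A E P N} {y : PartSum A E Q N} :
    (x, y) ∈ diracGraph P Q N t ↔ (component P N x, component Q N y) ∈ rollGraph t := Iff.rfl

variable [StarOrderedRing A]

theorem inner_eq_sum_component {P : ℕ → Prop} [DecidablePred P] {N : ℕ} (x y : PartSum A E P N) :
    ⟪x, y⟫_A = ∑ n ∈ Finset.range (N + 2), ⟪component P N x n, component P N y n⟫_A := by
  rw [WithCStarModule.pi_inner, ← Fin.sum_univ_eq_sum_range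
    (fun n => ⟪component P N x n, component P N y n⟫_A)]
  have h1 : ∀ k : {k : Fin (N + 2) // P k}, ⟪x k, y k⟫_A
      = ⟪component P N x (k.1 : ℕ), component P N y (k.1 : ℕ)⟫_A := fun k => by
    rw [component_of_mem x k.1.2 k.2, component_of_mem y k.1.2 k.2]
  rw [Finset.sum_congr rfl fun k _ => h1 k,
    ← Finset.sum_filter_of_ne (p := fun k : Fin (N + 2) => P k) fun k _ hk => by
      by_contra hP
      exact hk (by rw [component_of_not x fun h => hP h.2, CStarModule.inner_zero_left])]
  exact (Finset.sum_subtype _ (fun k => by simp) fun k : Fin (N + 2) =>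
    ⟪component P N x (k : ℕ), component P N y (k : ℕ)⟫_A).symm

theorem rollGraph_formallyAdjoint {t : ∀ k, UOp A (E k) (E (k + 1))}
    (ht : ∀ k, (t k).IsRegular) {N : ℕ} {x x' y y' : ∀ n, E n} (hx : (x, x') ∈ rollGraph t)
    (hy : (y, y') ∈ rollGraph t) (hx0 : x (N + 2) = 0) (hy0 : y (N + 2) = 0) :
    ∑ n ∈ Finset.range (N + 2), ⟪x' n, y n⟫_A = ∑ n ∈ Finset.range (N + 2), ⟪x n, y' n⟫_A := by
  obtain ⟨α, β, h1, h2, h3, h4⟩ := hx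
  obtain ⟨α', β', h1', h2', h3', h4'⟩ := hy
  have hf : ∀ n, FormallyAdjoint A (t n).gr (t n).adjoint.gr := fun n =>
    UOp.formallyAdjoint (ht n).dense_domain
  -- Summation by parts: cutting the sum after degree M leaves one unmatched t* term on each side.
  -- These terms vanish at M = N + 1, because x and y are zero in degree N + 2.
  have key : ∀ M, ∑ n ∈ Finset.range (M + 1), ⟪x' n, y n⟫_A + ⟪x M, β' M⟫_A
      = ∑ n ∈ Finset.range (M + 1), ⟪x n, y' n⟫_A + ⟪β M, y M⟫_A := fun M => by
    induction M with
    | zero =>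
      simp only [zero_add, Finset.sum_range_one]
      dsimp only at h3 h3'
      rw [h3, h3', add_comm]
    | succ M ih =>
      have e1 := hf M _ _ (h1 M) _ _ (h2' M)
      have e2 := (hf M).symm _ _ (h2 M) _ _ (h1' M)
      dsimp only at h4 h4' e1 e2
      rw [Finset.sum_range_succ, Finset.sum_range_succ _ (M + 1), h4, h4',
        CStarModule.inner_add_left, CStarModule.inner_add_right, e1, ← e2,
        add_assoc, add_assoc, ← add_assoc, ih]
      abel
  have hβ : β (N + 1) = 0 := by
    have := h2 (N + 1)
    dsimp only at this
    rw [hx0] at this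
    exact UOp.gr_unique this (t (N + 1)).adjoint.gr.zero_mem
  have hβ' : β' (N + 1) = 0 := by
    have := h2' (N + 1)
    dsimp only at this
    rw [hy0] at this
    exact UOp.gr_unique this (t (N + 1)).adjoint.gr.zero_mem
  have := key (N + 1)
  rwa [hβ, hβ', CStarModule.inner_zero_left, CStarModule.inner_zero_right, add_zero,
    add_zero] at this

theorem diracGraph_formallyAdjoint {P Q : ℕ → Prop} [DecidablePred P] [DecidablePred Q] {N : ℕ}
    {t : ∀ k, UOp A (E k) (E (k + 1))} (ht : ∀ k, (t k).IsRegular) :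
    FormallyAdjoint A (diracGraph P Q N t) (diracGraph Q P N t) := fun x x' hx y y' hy => by
  rw [inner_eq_sum_component, inner_eq_sum_component]
  exact rollGraph_formallyAdjoint ht hx hy (component_of_not _ (by simp))
    (component_of_not _ (by simp))

variable [∀ k, CompleteSpace (E k)] {t : ∀ k, UOp A (E k) (E (k + 1))}

/-- The operator `t (1 + Δ)⁻¹`. -/
theorem exists_outgoing (ht : IsComplex t) : ∀ n, ∃ T : Adj A (E n) (E (n + 1)),
    ∀ m, ((1 - boundedLaplacian t n) m, T m) ∈ (t n).gr ∧
      (T m, m - (t n).res m) ∈ (t n).adjoint.gr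
  | 0 => ⟨(t 0).tres, fun m => by
      rw [one_sub_boundedLaplacian_zero]
      exact ⟨(ht.regular 0).isResolvent.mem m, (ht.regular 0).isResolvent.mem_adj m⟩⟩
  | n + 1 => ⟨(t (n + 1)).tres.comp (t n).adjoint.res, fun m => by
      have h1 := (ht.regular (n + 1)).isResolvent.mem ((t n).adjoint.res m)
      have h2 := (ht.regular (n + 1)).isResolvent.mem_adj ((t n).adjoint.res m)
      have h3 := res_apply_range (ht.regular (n + 1)) (ht.regular n) (isComplex_range ht n) m
      -- That is, R' - R R' = 1 - R, so t* t (1 + Δ)⁻¹ = 1 - R.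
      have e : (t n).adjoint.res m - (t (n + 1)).res ((t n).adjoint.res m)
          = m - (t (n + 1)).res m := by
        rw [map_sub, sub_eq_sub_iff_add_eq_add] at h3
        exact sub_eq_sub_iff_add_eq_add.mpr ((add_comm _ _).trans h3)
      rw [e] at h2
      rw [one_sub_boundedLaplacian_succ ht]
      exact ⟨h1, h2⟩⟩

/-- The operator `t* (1 + Δ)⁻¹`. -/
theorem exists_incoming (ht : IsComplex t) (n : ℕ) : ∃ T : Adj A (E (n + 1)) (E n),
    ∀ m, ((1 - boundedLaplacian t (n + 1)) m, T m) ∈ (t n).adjoint.gr ∧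
      (T m, m - (t n).adjoint.res m) ∈ (t n).gr := by
  refine ⟨(t n).tres.adj.comp (t (n + 1)).res, fun m => ?_⟩
  have h1 := (ht.regular n).isResolvent.adj_mem_adj ((t (n + 1)).res m)
  have h2 := (ht.regular n).isResolvent.adj_mem ((t (n + 1)).res m)
  have e : (t (n + 1)).res m - (t n).adjoint.res ((t (n + 1)).res m)
      = m - (t n).adjoint.res m := by
    have h3 := congrArg (fun S : Adj A _ _ => S m)
      (one_sub_mul_one_sub (ht.regular (n + 1)) (ht.regular n) (isComplex_range ht n)).2
    simp only [Adj.mul_apply, Adj.sub_apply, Adj.one_apply, map_sub, Adj.zero_apply] at h3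
    rw [← sub_eq_zero, ← neg_eq_zero, ← h3]
    abel
  rw [e] at h2
  rw [one_sub_boundedLaplacian_succ' ht]
  exact ⟨h1, h2⟩

/-- The operator `1 + (t + t*)²` on graded families is solved by the resolvents of the Laplacians,
and the solution has the expected degrees. -/
theorem exists_roll_solution (ht : IsComplex t) (x : ∀ n, E n) :
    ∃ b : ∀ n, E n, ((fun n => (1 - boundedLaplacian t n) (x n)), b) ∈ rollGraph t ∧
      (b, fun n => boundedLaplacian t n (x n)) ∈ rollGraph t ∧ (x 1 = 0 → b 0 = 0) ∧
      ∀ n, x n = 0 → x (n + 2) = 0 → b (n + 1) = 0 := by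
  choose S hS hS' using exists_outgoing ht
  choose T hT hT' using exists_incoming ht
  let b : ∀ n, E n := fun
    | 0 => T 0 (x 1)
    | n + 1 => S n (x n) + T (n + 1) (x (n + 2))
  refine ⟨b, ⟨fun n => S n (x n), fun n => T n (x (n + 1)), fun n => hS n _, fun n => hT n _, rfl,
    fun n => rfl⟩, ⟨fun n => x (n + 1) - (t n).adjoint.res (x (n + 1)),
    fun n => x n - (t n).res (x n), ?_, ?_, ?_, ?_⟩, ?_, ?_⟩
  · rintro (_ | n)
    · exact hT' 0 _
    · have := (t (n + 1)).gr.add_mem (isComplex_range ht n _ _ (hS n (x n))) (hT' (n + 1) (x (n + 2)))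
      rwa [Prod.mk_add_mk, zero_add] at this
  · intro n
    have := (t n).adjoint.gr.add_mem (hS' n (x n))
      (adjoint_range ht n _ _ (hT (n + 1) (x (n + 2))))
    rwa [Prod.mk_add_mk, add_zero] at this
  · change boundedLaplacian t 0 (x 0) = _
    rw [← sub_sub_cancel 1 (boundedLaplacian t 0), one_sub_boundedLaplacian_zero]
    rfl
  · intro n
    exact add_comm _ _
  · intro h
    change T 0 (x 1) = 0
    rw [h, map_zero]
  · intro n h h'
    change S n (x n) + T (n + 1) (x (n + 2)) = 0
    rw [h, h', map_zero, map_zero, add_zero]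

theorem component_diag {P : ℕ → Prop} [DecidablePred P] {N : ℕ} (L : ∀ n, Adj A (E n) (E n))
    (x : PartSum A E P N) :
    component P N (diag (fun k : {k : Fin (N + 2) // P k} => L k.1) x)
      = fun n => L n (component P N x n) := by
  ext n
  by_cases h : n < N + 2 ∧ P n
  · rw [component_of_mem _ h.1 h.2, component_of_mem _ h.1 h.2, diag_apply]
  · rw [component_of_not _ h, component_of_not _ h, map_zero]

/-- t + t* shifts degrees by ±1, so `h1` and `h2` confine the graded solution b to the degrees in Q.
Above N + 1 it vanishes because the modules do. -/
theorem exists_dirac_solution (ht : IsComplex t) {N : ℕ}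
    (hE : ∀ k, N + 1 < k → Subsingleton (E k)) {P Q : ℕ → Prop} [DecidablePred P]
    [DecidablePred Q] (h1 : ∀ n, P (n + 1) → Q n) (h2 : ∀ n, P n → Q (n + 1)) (x : PartSum A E P N) :
    ∃ b, (x, (diag (fun k : {k : Fin (N + 2) // P k} => 1 - boundedLaplacian t k.1) x, b)) ∈
      solutions (diracGraph P Q N t) (diracGraph Q P N t) := by
  obtain ⟨b, hb1, hb2, hb3, hb4⟩ := exists_roll_solution ht (component P N x)
  have hb : ∀ n, ¬ (n < N + 2 ∧ Q n) → b n = 0 := fun n hn => by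
    rcases lt_or_ge n (N + 2) with hn' | hn'
    · have hQ : ¬ Q n := fun h => hn ⟨hn', h⟩
      rcases n with _ | n
      · exact hb3 (component_of_not _ fun h => hQ (h1 0 h.2))
      · exact hb4 n (component_of_not _ fun h => hQ (h2 n h.2))
          (component_of_not _ fun h => hQ (h1 (n + 1) h.2))
    · have := hE n hn'
      exact Subsingleton.elim _ _
  obtain ⟨b', rfl⟩ := exists_component_eq (A := A) (P := Q) b hb
  have hc := component_diag (fun n => 1 - boundedLaplacian t n) x
  refine ⟨b', mem_diracGraph.mpr ?_, mem_diracGraph.mpr ?_⟩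
  · rw [hc]
    exact hb1
  · dsimp only
    rw [map_sub, hc]
    convert hb2 using 2
    ext n
    simp

/-- The parts of `t + t*` have resolvents, given by those of the Laplacians. -/
theorem exists_dirac_isResolvent (ht : IsComplex t) {N : ℕ}
    (hE : ∀ k, N + 1 < k → Subsingleton (E k)) {P Q : ℕ → Prop} [DecidablePred P]
    [DecidablePred Q] (h1 : ∀ n, P (n + 1) → Q n) (h2 : ∀ n, P n → Q (n + 1))
    (h3 : ∀ n, Q (n + 1) → P n) (h4 : ∀ n, Q n → P (n + 1)) :
    ∃ B, IsResolvent (diracGraph P Q N t) (diracGraph Q P N t)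
      (diag (fun k : {k : Fin (N + 2) // P k} => 1 - boundedLaplacian t k.1)) B
      (diag (fun k : {k : Fin (N + 2) // Q k} => 1 - boundedLaplacian t k.1)) := by
  obtain ⟨R, B, R', h⟩ := (diracGraph_formallyAdjoint (P := P) (Q := Q) (N := N)
    ht.regular).exists_isResolvent
    (fun x => ⟨_, (exists_dirac_solution ht hE h1 h2 x).choose_spec⟩)
    (fun x => ⟨_, (exists_dirac_solution ht hE h3 h4 x).choose_spec⟩)
  -- Solutions are unique, so the abstract resolvents are the diagonal ones.
  have e1 : R = diag (fun k : {k : Fin (N + 2) // P k} => 1 - boundedLaplacian t k.1) :=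
    Adj.ext fun x => by
      obtain ⟨b, hb⟩ := exists_dirac_solution ht hE h1 h2 x
      exact (h.eq_of_mem hb.1 hb.2).1
  have e2 : R' = diag (fun k : {k : Fin (N + 2) // Q k} => 1 - boundedLaplacian t k.1) :=
    Adj.ext fun x => by
      obtain ⟨b, hb⟩ := exists_dirac_solution ht hE h3 h4 x
      exact (h.symm.eq_of_mem hb.1 hb.2).1
  subst e1 e2
  exact ⟨B, h⟩

/-- `diracGraph` also demands that (t + t*) x vanish outside the odd degrees up to N + 1: this is
parity in even degrees, and triviality of the modules above N + 1. -/
theorem gr_evenDirac {N : ℕ} (hE : ∀ k, N + 1 < k → Subsingleton (E k)) :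
    (evenDirac N t).gr = diracGraph Even Odd N t := by
  ext ⟨x, y⟩
  rw [mem_diracGraph, mem_rollGraph_iff, UOp.mem_gr, ← evenComponent_eq]
  refine exists_congr fun h => ?_
  constructor
  · rintro rfl n
    by_cases hn : n < N + 2 ∧ Odd n
    · rw [component_of_mem _ hn.1 hn.2]
      rfl
    · rw [component_of_not _ hn]
      by_cases hn' : n < N + 2
      · have hn2 : Even n := Nat.not_odd_iff_even.mp fun h => hn ⟨hn', h⟩
        have h0 : ∀ m, Odd m → evenComponent x m = 0 := fun m hm => by
          rw [evenComponent_eq]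
          exact component_of_not _ fun h => (Nat.not_even_iff_odd.mpr hm) h.2
        have ha : ∀ m, Odd (m + 1) → (t m).adjoint ⟨evenComponent x (m + 1), (h m).2⟩ = 0 :=
          fun m hm => UOp.apply_eq_zero _ (h0 _ hm)
        have hb : ∀ m, Odd m → t m ⟨evenComponent x m, (h m).1⟩ = 0 :=
          fun m hm => UOp.apply_eq_zero _ (h0 _ hm)
        cases n with
        | zero => exact ha 0 odd_one
        | succ n =>
          have hodd : Odd n := by
            rw [Nat.even_add_one, Nat.not_even_iff_odd] at hn2
            exact hn2
          exact (congrArg₂ (· + ·) (hb n hodd) (ha (n + 1) (by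
            exact hodd.add_even even_two))).trans (add_zero _)
      · have := hE n (by omega)
        exact Subsingleton.elim _ _
  · intro h'
    refine WithCStarModule.ext fun k => ?_
    have := h' k.1
    rw [component_of_mem y k.1.2 k.2] at this
    exact this

theorem evenDirac_isFredholm_iff (ht : IsComplex t) {N : ℕ}
    (hE : ∀ k, N + 1 < k → Subsingleton (E k)) :
    (evenDirac N t).IsFredholm ↔ ∀ k : Fin (N + 2), EssInv (boundedLaplacian t k) := by
  have h1 : ∀ n : ℕ, Even (n + 1) → Odd n := fun n h => by
    rwa [Nat.even_add_one, Nat.not_even_iff_odd] at h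
  have h2 : ∀ n : ℕ, Odd (n + 1) → Even n := fun n h => by
    rwa [Nat.odd_add_one, Nat.not_odd_iff_even] at h
  obtain ⟨B, h⟩ := exists_dirac_isResolvent ht hE h1 (fun n h => h.add_one) h2
    (fun n h => h.add_one)
  rw [← gr_evenDirac hE] at h
  have hd : ∀ (P : ℕ → Prop) [DecidablePred P], DenseRange
      (diag (fun k : {k : Fin (N + 2) // P k} => 1 - boundedLaplacian t k.1)) := fun P _ =>
    denseRange_diag fun k => denseRange_one_sub_boundedLaplacian ht k.1
  have hd1 : Dense ((evenDirac N t).domain : Set (EvenSum A E N)) := (hd Even).mono (by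
    rintro _ ⟨x, rfl⟩
    exact UOp.mem_domain_iff.mpr ⟨_, h.mem x⟩)
  have hd2 : Dense {x | ∃ y, (x, y) ∈ diracGraph Odd Even N t} := (hd Odd).mono (by
    rintro _ ⟨x, rfl⟩
    exact ⟨_, h.adj_mem_adj x⟩)
  -- Regularity of the Dirac operator comes for free, and its adjoint is the part of t + t* from odd
  -- to even degrees.
  obtain ⟨hr, hadj⟩ := h.isRegular hd1 hd2
  rw [← hadj] at h
  have h' := h.symm
  rw [← hr.adjoint_adjoint_gr] at h'
  rw [hr.isFredholm_iff, (hr.res_eq h).1, (hr.adjoint.res_eq h').1, one_sub_diag, one_sub_diag,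
    essInv_diag_iff, essInv_diag_iff]
  simp only [sub_sub_cancel]
  constructor
  · rintro ⟨he, ho⟩ k
    rcases Nat.even_or_odd (k : ℕ) with hk | hk
    · exact he ⟨k, hk⟩
    · exact ho ⟨k, hk⟩
  · exact fun h => ⟨fun k => h k.1, fun k => h k.1⟩

end Dirac

end HilbertCStar

theorem theorem6p1 {A : Type u} [NonUnitalCStarAlgebra A] [PartialOrder A] [StarOrderedRing A]
    {E : ℕ → Type v} [∀ k, NormedAddCommGroup (E k)] [∀ k, NormedSpace ℂ (E k)]
    [∀ k, SMul A (E k)] [∀ k, CStarModule A (E k)] [∀ k, CompleteSpace (E k)]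
    (N : ℕ) (hE : ∀ k, N + 1 < k → Subsingleton (E k))
    (t : ∀ k, HilbertCStar.UOp A (E k) (E (k + 1))) (ht : HilbertCStar.IsComplex t) :
    List.TFAE [
      HilbertCStar.IsFredholmComplex t,
      (HilbertCStar.evenDirac N t).IsFredholm,
      (HilbertCStar.laplace N t).IsFredholm,
      HilbertCStar.IsFredholmComplex (fun k => (t k).boundedTransform),
      HilbertCStar.IsFredholmChainComplex (fun k => (t k).adjoint),
      HilbertCStar.IsFredholmComplex (HilbertCStar.graphComplex t ht)] := by
  have hF : HilbertCStar.FiniteLength E := ⟨N + 1, hE⟩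
  -- The Dirac and Laplace operators see only degrees up to N + 1; on the zero modules above, every
  -- operator is invertible modulo compacts.
  have hN : (∀ k : Fin (N + 2), HilbertCStar.EssInv (HilbertCStar.boundedLaplacian t k)) ↔
      ∀ k, HilbertCStar.EssInv (HilbertCStar.boundedLaplacian t k) := by
    refine ⟨fun h k => ?_, fun h k => h k⟩
    by_cases hk : k < N + 2
    · exact h ⟨k, hk⟩
    · have := hE k (by omega)
      exact HilbertCStar.EssInv.of_subsingleton _
  rw [HilbertCStar.isFredholmComplex_iff hF ht, HilbertCStar.evenDirac_isFredholm_iff ht hE,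
    HilbertCStar.laplace_isFredholm_iff ht N, hN,
    HilbertCStar.isFredholmComplex_boundedTransform_iff hF ht,
    HilbertCStar.isFredholmChainComplex_adjoint_iff hF ht,
    HilbertCStar.isFredholmComplex_graphComplex_iff hF ht]
  tfae_finish
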